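/- Let $G$ be an acyclic directed mixed graph on $n$ observable variables $V$ with values in a finite non-empty alphabet $\Sigma$: directed edges without directed cycles, and bidirected edges. Let $d$ be the maximum number of directed edges into a vertex. The c-components of $G$ are the classes of vertices connected by bidirected paths; let $k$ be the size of the largest one. A causal Bayes net on $G$ has, for every bidirected edge, an independent hidden variable with an arbitrary finite range, and for every $V_i\in V$ a conditional distribution given its parents in $G$ and the hidden variables on the bidirected edges at $V_i$. It defines the observational distribution $P(v)=\sum_u\prod_e P(u_e)\prod_i P(v_i\mid \mathrm{pa}_i,u)$ and, for $X\in V$ and $x\in\Sigma$, the interventional distribution $P_x$, in which the mechanism of $X$ is replaced by the constant $x$. Let $X\in V$ be such that no child of $X$ lies in the c-component $S_1$ of $X$. For $\alpha>0$, call the net $\alpha$-strongly positive with respect to $X$ if $P(Z=z)>\alpha$ for every assignment $z$ to $Z=S_1\cup\bigcup_{V_i\in S_1}\mathrm{Pa}(V_i)$. There are absolute constants $C>0$ and $c\in\mathbb N$ such that for all such $G$, $\Sigma$, $X$, all $\alpha>0$, $\epsilon,\delta\in(0,1)$, all interventions $x\in\Sigma$ and all $F\subseteq V$ with $|F|=f$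 there is an algorithm which, given $$m\le C\,T\,\log^{c}(2+T)\,\bigl(1+\log\tfrac1\delta\bigr),\qquad T=\frac{|\Sigma|^{2kd}\,n}{\alpha^{k}\epsilon^{2}},$$ independent samples from the observational distribution $P$ of any unknown causal Bayes net on $G$ that is $\alpha$-strongly positive with respect to $X$, runs in time at most $C\,m\,n\,|\Sigma|^{2kd}$ and returns data with the following two properties. (1) With probability at least $1-\delta$ the data are an evaluator for a distribution $\hat P$ on $\Sigma^F$ with $d_{\mathrm{TV}}(P_x|_F,\hat P)\le\epsilon$: from the data and any $w\in\Sigma^F$, the value $\hat P(w)$ is computed in time at most $C\,n|\Sigma|(kd+k)\,|\Sigma|^{n-f}$. (2) Without further samples, a randomized procedure turns the data in time at most $C\,n|\Sigma|(kd+k)\,\frac{|\Sigma|^{f}}{\epsilon^{2}}\bigl(1+\log\frac1\delta\bigr)$ into explicit data which, with overall probability at least $1-\delta$, are an evaluator for a distribution on $\Sigma^F$ within total variation distance $\epsilon$ of $P_x|_F$ that answers each query $w\in\Sigma^F$ in time at most $C(f+1)$. Here algorithms are randomized random access programs with unit-cost exact rational arithmetic, comparisons, indirect addressing and coins of computed rational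 bias. A program may depend on $G,\Sigma,X,x,F,\alpha,\epsilon,\delta$ but not on the net; it is a finite list of instructions without jumps, and its running time is its length. -/

import Mathlib

noncomputable section

open scoped ENNReal Classical

namespace CausalLearning

/-! ### Acyclic directed mixed graphs -/

/-- An acyclic directed mixed graph on `n` observable variables: `dir i j` is the directed edge
`i → j`, `bi` is the graph of bidirected edges. A pair may carry both kinds of edge. -/
structure ADMG (n : ℕ) where
  dir : Fin n → Fin n → Prop
  bi : SimpleGraph (Fin n)
  acyclic : ∀ i, ¬ Relation.TransGen dir i i

namespace ADMG

variable {n : ℕ} (G : ADMG n)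

/-- The observable parents of `i`. -/
def parents (i : Fin n) : Finset (Fin n) := Finset.univ.filter fun j => G.dir j i

/-- The maximum in-degree (directed edges only). -/
def inDegree : ℕ := Finset.univ.sup fun i => (G.parents i).card

/-- The c-component of `i`: all vertices joined to `i` by a path of bidirected edges. -/
def cComp (i : Fin n) : Finset (Fin n) := Finset.univ.filter fun j => G.bi.Reachable i j

/-- The size of the largest c-component. -/
def maxCComp : ℕ := Finset.univ.sup fun i => (G.cComp i).card

/-- `Pa⁺(S) = S ∪ ⋃_{i ∈ S} Pa(i)`. -/
def paPlus (S : Finset (Fin n)) : Finset (Fin n) := S ∪ S.biUnion G.parents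

/-- Identifiability with respect to `X`: no child of `X` lies in the c-component of `X`. -/
def Identifiable (X : Fin n) : Prop := ∀ j, G.dir X j → j ∉ G.cComp X

end ADMG

/-! ### Causal Bayes nets -/

/-- A (semi-Markovian) causal Bayes net over the ADMG `G` with alphabet `Fin s`: one independent
hidden variable for every bidirected edge, with an arbitrary finite range, and for every observable
`i` its conditional distribution given its observable parents and the hidden variables on the
bidirected edges at `i`. -/
structure CBN {n : ℕ} (G : ADMG n) (s : ℕ) where
  U : G.bi.edgeSet → Type
  finU : ∀ e, Fintype (U e)
  hid : ∀ e, PMF (U e)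
  cpd : ∀ i : Fin n, ({j // G.dir j i} → Fin s) →
    (∀ e : {e : G.bi.edgeSet // i ∈ (e : Sym2 (Fin n))}, U e.1) → PMF (Fin s)

namespace CBN

variable {n : ℕ} {G : ADMG n} {s : ℕ}

instance (M : CBN G s) (e : G.bi.edgeSet) : Fintype (M.U e) := M.finU e

/-- The conditional probability of `v i` given the parents' values in `v` and the hidden
values `u`. -/
def factor (M : CBN G s) (u : ∀ e, M.U e) (i : Fin n) (v : Fin n → Fin s) : ℝ≥0∞ :=
  M.cpd i (fun j => v j) (fun e => u e.1) (v i)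

/-- The probability that the observables take the values `v`:
`∑_u ∏_e P(u_e) ∏_i P(v_i ∣ pa_i, u)`. -/
def weight (M : CBN G s) (v : Fin n → Fin s) : ℝ≥0∞ :=
  ∑ u : (∀ e, M.U e), (∏ e, M.hid e (u e)) * ∏ i, M.factor u i v

theorem sum_update (i : Fin n) (g : (Fin n → Fin s) → ℝ≥0∞) :
    ∑ v, ∑ a, g (Function.update v i a) = s * ∑ v, g v := by
  have h : ∑ p : (Fin n → Fin s) × Fin s, g (Function.update p.1 i p.2)
      = ∑ p : (Fin n → Fin s) × Fin s, g p.1 := by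
    refine Finset.sum_bij' (fun p _ => (Function.update p.1 i p.2, p.1 i))
      (fun p _ => (Function.update p.1 i p.2, p.1 i)) ?_ ?_ ?_ ?_ ?_ <;> simp
  rw [Fintype.sum_prod_type, Fintype.sum_prod_type] at h
  rw [h]
  simp [Finset.mul_sum]

theorem sum_prod_factor (M : CBN G s) (u : ∀ e, M.U e) (A : Finset (Fin n)) :
    (s : ℝ≥0∞) ^ A.card * ∑ v, ∏ i ∈ A, M.factor u i v = (s : ℝ≥0∞) ^ n := by
  induction hA : A.card generalizing A with
  | zero =>
    rw [Finset.card_eq_zero] at hA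
    subst hA
    simp
  | succ c ih =>
    have hne : A.Nonempty := by
      rw [← Finset.card_pos]; omega
    obtain ⟨i, hi, hmax⟩ : ∃ i ∈ A, ∀ j ∈ A, ¬ G.dir i j := by
      have : IsTrans (Fin n) (fun a b => Relation.TransGen G.dir b a) :=
        ⟨fun a b c h1 h2 => h2.trans h1⟩
      have : Std.Irrefl (fun a b => Relation.TransGen G.dir b a) := ⟨G.acyclic⟩
      obtain ⟨i, hi, h⟩ := (Finite.wellFounded_of_trans_of_irrefl
        (fun a b => Relation.TransGen G.dir b a)).has_min (A : Set (Fin n)) hne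
      exact ⟨i, hi, fun j hj hd => h j hj (Relation.TransGen.single hd)⟩
    have hc : (A.erase i).card = c := by rw [Finset.card_erase_of_mem hi]; omega
    have key : s * ∑ v, ∏ j ∈ A, M.factor u j v = ∑ v, ∏ j ∈ A.erase i, M.factor u j v := by
      rw [← sum_update i]
      refine Finset.sum_congr rfl fun v _ => ?_
      have h1 : ∀ a, ∏ j ∈ A, M.factor u j (Function.update v i a)
          = M.cpd i (fun j => v j) (fun e => u e.1) a * ∏ j ∈ A.erase i, M.factor u j v := by
        intro a
        rw [← Finset.mul_prod_erase A _ hi]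
        congr 1
        · have : (fun j : {j // G.dir j i} => Function.update v i a j)
              = fun j : {j // G.dir j i} => v j := by
            funext j
            refine Function.update_of_ne ?_ _ _
            intro h
            have hj := j.2
            rw [h] at hj
            exact hmax i hi hj
          unfold factor
          rw [this, Function.update_self]
        · refine Finset.prod_congr rfl fun j hj => ?_
          have hji : j ≠ i := Finset.ne_of_mem_erase hj
          have : (fun l : {l // G.dir l j} => Function.update v i a l)
              = fun l : {l // G.dir l j} => v l := by
            funext l
            refine Function.update_of_ne ?_ _ _
            intro h
            have hl := l.2
            rw [h] at hl
            exact hmax j (Finset.mem_of_mem_erase hj) hl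
          unfold factor
          rw [this, Function.update_of_ne hji]
      simp_rw [h1]
      rw [← Finset.sum_mul]
      have := (M.cpd i (fun j => v j) (fun e => u e.1)).tsum_coe
      rw [tsum_fintype] at this
      rw [this, one_mul]
    rw [pow_succ, mul_assoc, key]
    exact ih _ hc

theorem sum_weight [NeZero s] (M : CBN G s) : ∑ v, M.weight v = 1 := by
  have h1 : ∀ u : (∀ e, M.U e), ∑ v, ∏ i, M.factor u i v = 1 := by
    intro u
    have h := M.sum_prod_factor u Finset.univ
    rw [Finset.card_univ, Fintype.card_fin] at h
    have h0 : (s : ℝ≥0∞) ^ n ≠ 0 := pow_ne_zero _ (by exact_mod_cast NeZero.ne s)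
    have ht : (s : ℝ≥0∞) ^ n ≠ ⊤ := ENNReal.pow_ne_top (ENNReal.natCast_ne_top s)
    exact (ENNReal.mul_right_inj h0 ht).1 (by rw [h, mul_one])
  unfold weight
  rw [Finset.sum_comm]
  simp_rw [← Finset.mul_sum, h1, mul_one]
  rw [← Fintype.prod_sum fun e (a : M.U e) => M.hid e a]
  refine Finset.prod_eq_one fun e _ => ?_
  have := (M.hid e).tsum_coe
  rwa [tsum_fintype] at this

/-- The observational distribution `P`. -/
def obs [NeZero s] (M : CBN G s) : PMF (Fin n → Fin s) := PMF.ofFintype M.weight M.sum_weight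

/-- The net after the intervention `X := x`: the mechanism of `X` is replaced by the constant `x`,
all the others are kept. -/
def intervene (M : CBN G s) (X : Fin n) (x : Fin s) : CBN G s where
  U := M.U
  finU := M.finU
  hid := M.hid
  cpd := fun i pa u => if i = X then PMF.pure x else M.cpd i pa u

/-- The interventional distribution `P_x` (as a distribution on all observables; `X` is
constantly `x`). -/
def interv [NeZero s] (M : CBN G s) (X : Fin n) (x : Fin s) : PMF (Fin n → Fin s) :=
  (M.intervene X x).obs

end CBN

/-- The marginal of a distribution on the set `F` of variables. -/
def marginal {n s : ℕ} (P : PMF (Fin n → Fin s)) (F : Finset (Fin n)) : PMF (F → Fin s) :=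
  P.map fun v i => v i

/-- `α`-strong positivity with respect to `X`: every assignment to `Pa⁺` of the c-component of `X`
has probability more than `α`. -/
def CBN.StronglyPositive {n : ℕ} {G : ADMG n} {s : ℕ} [NeZero s] (M : CBN G s) (X : Fin n)
    (α : ℝ) : Prop :=
  ∀ z, α < (marginal M.obs (G.paPlus (G.cComp X)) z).toReal

/-- Total variation distance on a finite type. -/
def tvDist {β : Type*} [Fintype β] (p q : PMF β) : ℝ :=
  (∑ b, |(p b).toReal - (q b).toReal|) / 2

/-- The law of `m` independent samples from `P`. -/
def iid {β : Type*} [Fintype β] (P : PMF β) (m : ℕ) : PMF (Fin m → β) :=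
  PMF.ofFintype (fun S => ∏ j, P (S j)) <| by
    have h := P.tsum_coe
    rw [tsum_fintype] at h
    rw [← Fintype.prod_sum fun (_ : Fin m) b => P b]
    simp [h]

/-! ### The machine model

A randomized random access machine with rational memory cells and unit cost arithmetic. Programs
are finite lists of instructions without jumps, so the number of executed steps, i.e. the running
time, is the length of the program, and a hard-wired table is paid for in the running time. -/

/-- Instructions. The arguments `a b c` are addresses of memory cells. -/
inductive Instr where
  /-- `mem[a] := q` -/
  | const (a : ℕ) (q : ℚ)
  /-- `mem[a] := input[i]` -/
  | read (a i : ℕ)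
  /-- `mem[a] := mem[b] + mem[c]` -/
  | plus (a b c : ℕ)
  /-- `mem[a] := mem[b] - mem[c]` -/
  | minus (a b c : ℕ)
  /-- `mem[a] := mem[b] * mem[c]` -/
  | times (a b c : ℕ)
  /-- `mem[a] := mem[b] / mem[c]` -/
  | divide (a b c : ℕ)
  /-- `mem[a] := 1` if `mem[b] ≤ mem[c]`, else `mem[a] := 0` -/
  | compare (a b c : ℕ)
  /-- indirect reading, `mem[a] := mem[mem[b]]` -/
  | load (a b : ℕ)
  /-- indirect writing, `mem[mem[a]] := mem[b]` -/
  | store (a b : ℕ)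
  /-- `mem[a]` becomes `1` with probability `mem[b]` (cut off to `[0, 1]`), else `0`,
  independently of the past -/
  | flip (a b : ℕ)

/-- The contents of the memory. -/
abbrev Mem := ℕ → ℚ

/-- A coin with bias `q`, cut off to `[0, 1]`. -/
def coin (q : ℚ) : PMF Bool :=
  PMF.ofFintype (fun r => bif r then min (ENNReal.ofReal (q : ℝ)) 1
    else 1 - min (ENNReal.ofReal (q : ℝ)) 1) <| by
    rw [Fintype.sum_bool]
    exact add_tsub_cancel_of_le (min_le_right _ _)

/-- The effect of one instruction, with input array `inp`. A cell content is used as the address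
given by its natural-number floor. -/
def Instr.step (inp : ℕ → ℚ) (μ : Mem) : Instr → PMF Mem
  | .const a q => PMF.pure (Function.update μ a q)
  | .read a i => PMF.pure (Function.update μ a (inp i))
  | .plus a b c => PMF.pure (Function.update μ a (μ b + μ c))
  | .minus a b c => PMF.pure (Function.update μ a (μ b - μ c))
  | .times a b c => PMF.pure (Function.update μ a (μ b * μ c))
  | .divide a b c => PMF.pure (Function.update μ a (μ b / μ c))
  | .compare a b c => PMF.pure (Function.update μ a (if μ b ≤ μ c then 1 else 0))
  | .load a b => PMF.pure (Function.update μ a (μ ⌊μ b⌋₊))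
  | .store a b => PMF.pure (Function.update μ ⌊μ a⌋₊ (μ b))
  | .flip a b => (coin (μ b)).map fun r => Function.update μ a (if r then 1 else 0)

/-- The distribution of the final memory when a program is run on the input array `inp` with
initial memory `μ`. -/
def run (inp : ℕ → ℚ) : List Instr → Mem → PMF Mem
  | [], μ => PMF.pure μ
  | I :: L, μ => (I.step inp μ).bind (run inp L)

/-- The input array that holds `m` samples one after the other: cell `j * n + i` holds the value of
variable `i` in sample `j`. The cells behind them are `0`. -/
def sampleInput {n s m : ℕ} (S : Fin m → Fin n → Fin s) : ℕ → ℚ := fun a =>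
  if h : a < m * n then
    ((S ⟨a / n, Nat.div_lt_of_lt_mul (by rwa [Nat.mul_comm] at h)⟩
      ⟨a % n, Nat.mod_lt _ (Nat.pos_of_ne_zero (by rintro rfl; simp at h))⟩ : Fin s) : ℕ)
  else 0

/-- The input array for the query `w`, an assignment to `F`: cell `i` holds `w i` for `i ∈ F`, all
other cells are `0`. -/
def queryInput {n s : ℕ} {F : Finset (Fin n)} (w : F → Fin s) : ℕ → ℚ := fun a =>
  if h : ∃ hn : a < n, (⟨a, hn⟩ : Fin n) ∈ F then ((w ⟨⟨a, h.1⟩, h.2⟩ : Fin s) : ℕ) else 0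

/-- The program `E` with the stored data `μ` is an evaluator for a distribution `q` on the
assignments to `F` with `tvDist D q ≤ ε`: for every query `w`, running `E` leaves `q w` in
cell `0`, with certainty. -/
def IsCloseEvaluator {n s : ℕ} {F : Finset (Fin n)} (E : List Instr) (μ : Mem)
    (D : PMF (F → Fin s)) (ε : ℝ) : Prop :=
  ∃ q : PMF (F → Fin s), tvDist D q ≤ ε ∧
    ∀ w, (run (queryInput w) E μ).map (fun ν => ((ν 0 : ℚ) : ℝ)) = PMF.pure (q w).toReal

/-- The memory after program `L` has been run, from an empty memory, on `m` independent samples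
from `P`. -/
def learned {n s : ℕ} (P : PMF (Fin n → Fin s)) (m : ℕ) (L : List Instr) : PMF Mem :=
  (iid P m).bind fun S => run (sampleInput S) L fun _ => 0

end CausalLearning

end

/-! Write Q[A] for the factor `setFactor A` and S for the c-component of X. If no bidirected edge
joins A to B, the hidden variables seen by A and by B are disjoint, hence independent, and Q[A ∪ B]
= Q[A] Q[B] (`setFactor_union`). So P = Q[S] Q[Sᶜ]. Moreover, along a topological order, Q of a
union of c-components is the product of the ratios `cond i` = Q[before i ∪ {i}] / Q[before i]
(`prod_cond`). Such a ratio is the P-probability of V_i given its context: the earlier members of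
its c-component, their parents and the parents of i (`prob_cyl_scope`). Context and i together have
at most K = kd + k elements.

Identification. Since X has no child in S, summing Q[S] over the value of X gives Q[S \ X], and P_x
= Q[S \ X] Q[Sᶜ] at X = x. Equivalently, P_x is the image, under overwriting X by x, of the split
law ∏ `cond i` in which members of S see the natural value of X and all others see x
(`interv_eq_map`). The split law is again a product of conditional distributions along the order,
and all of them can be estimated from samples of P.

Estimation. The conditionals are estimated by frequencies smoothed with a pseudo-count l ≈ log(n s^K
/ δ). If all relevant counts satisfy a Chernoff bound, then P(context) times the χ²-error of the
conditional is O(s l / m), however rare the context is (`smoothed_chi_sq_le`). Squared total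
variation is at most the Kullback-Leibler divergence, which splits over the variables and is bounded
there by the expected χ²-errors (`sq_tv_le_sum_chiSq`). That expectation is under the split law
while the counts come from P. Strong positivity gives domination of contexts with ratio ρ = 1/α
(`dominated_of_stronglyPositive`). Summing over the at most s^(K-1) values of each context yields
TV² = O(ρ n s^K l / m) (`tvDist_est_le`). For d > 0 one has K ≤ 2kd. For d = 0 the split law is P
itself, so ρ = 1, and s^k ≤ α^(-k) because sα < 1.

Programs. The learner only counts. The evaluator multiplies estimated conditionals and sums over the
variables that are not queried. The tabulator draws N = O(s^f / ε²) assignments from the estimated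
split law and stores their empirical law on F, which is close by a union bound over all 2^(s^f)
events (`sq_tvDist_empirical_le`). Randomized programs are compared with the laws they should
realize through couplings (`Sim`): the final memory is coupled with the abstract samples so that the
memory invariant always holds, and failure probabilities are then computed for abstract samples
only. -/

noncomputable section

open scoped ENNReal Classical

namespace CausalLearning

/-! ### Couplings -/

/-- `p` and `q` have a coupling that is supported on the relation `r`. -/
def Sim {β γ : Type*} (p : PMF β) (q : PMF γ) (r : β → γ → Prop) : Prop :=
  ∃ c : PMF (β × γ), c.map Prod.fst = p ∧ c.map Prod.snd = q ∧ ∀ x ∈ c.support, r x.1 x.2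

theorem Sim.pure {β γ : Type*} {r : β → γ → Prop} {b : β} {c : γ} (h : r b c) :
    Sim (PMF.pure b) (PMF.pure c) r :=
  ⟨PMF.pure (b, c), by simp [PMF.pure_map], by simp [PMF.pure_map], by simpa using h⟩

theorem Sim.refl {β : Type*} (p : PMF β) : Sim p p Eq := by
  refine ⟨p.map fun b => (b, b), ?_, ?_, ?_⟩
  · rw [PMF.map_comp]; exact PMF.map_id p
  · rw [PMF.map_comp]; exact PMF.map_id p
  · simp

/-- Couplings of the continuations are glued along the first coupling. At pairs outside `r`, which
have probability zero, the product coupling serves as a default. -/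
theorem Sim.bind {β γ β' γ' : Type*} {p : PMF β} {q : PMF γ} {r : β → γ → Prop}
    {f : β → PMF β'} {g : γ → PMF γ'} {r' : β' → γ' → Prop} (h : Sim p q r)
    (hf : ∀ b c, r b c → Sim (f b) (g c) r') : Sim (p.bind f) (q.bind g) r' := by
  obtain ⟨c, rfl, rfl, hc⟩ := h
  have : ∀ x : β × γ, ∃ d : PMF (β' × γ'), d.map Prod.fst = f x.1 ∧ d.map Prod.snd = g x.2 ∧
      (r x.1 x.2 → ∀ y ∈ d.support, r' y.1 y.2) := by
    intro x
    by_cases hx : r x.1 x.2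
    · obtain ⟨d, h1, h2, h3⟩ := hf _ _ hx
      exact ⟨d, h1, h2, fun _ => h3⟩
    · refine ⟨(f x.1).bind fun a => (g x.2).map fun b => (a, b), ?_, ?_, fun h => (hx h).elim⟩
      · rw [PMF.map_bind]
        simp only [PMF.map_comp]
        have : ∀ a : β', (g x.2).map (Prod.fst ∘ fun b => (a, b)) = PMF.pure a :=
          fun a => PMF.map_const _ _
        simp only [this, PMF.bind_pure]
      · rw [PMF.map_bind]
        simp only [PMF.map_comp]
        have : ∀ a : β', (g x.2).map (Prod.snd ∘ fun b => (a, b)) = g x.2 :=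
          fun a => PMF.map_id _
        simp only [this, PMF.bind_const]
  choose d h1 h2 h3 using this
  refine ⟨c.bind d, ?_, ?_, ?_⟩
  · rw [PMF.map_bind, PMF.bind_map]
    simp only [h1]; rfl
  · rw [PMF.map_bind, PMF.bind_map]
    simp only [h2]; rfl
  · intro y hy
    rw [PMF.mem_support_bind_iff] at hy
    obtain ⟨x, hx, hy⟩ := hy
    exact h3 x (hc x hx) y hy

theorem Sim.bind_left {β γ β' : Type*} {p : PMF β} {q : PMF γ} {r : β → γ → Prop}
    {f : β → PMF β'} {r' : β' → γ → Prop} (h : Sim p q r)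
    (hf : ∀ b c, r b c → Sim (f b) (PMF.pure c) r') : Sim (p.bind f) q r' := by
  have := h.bind (f := f) (g := PMF.pure) hf
  rwa [PMF.bind_pure] at this

theorem Sim.map_right {β γ γ' : Type*} {p : PMF β} {q : PMF γ} {r : β → γ → Prop}
    {g : γ → γ'} {r' : β → γ' → Prop} (h : Sim p q r)
    (hf : ∀ b c, r b c → r' b (g c)) : Sim p (q.map g) r' := by
  have := h.bind (f := PMF.pure) (g := PMF.pure ∘ g) (r' := r')
    (fun b c hbc => Sim.pure (hf b c hbc))
  rwa [PMF.bind_pure, PMF.bind_pure_comp] at this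

/-- This is how couplings are used in the end: a bad final memory forces a bad abstract sample, so
its probability is bounded by that of the latter. -/
theorem Sim.toOuterMeasure_le {β γ : Type*} {p : PMF β} {q : PMF γ} {r : β → γ → Prop}
    (h : Sim p q r) {A : Set β} {B : Set γ} (hAB : ∀ b c, r b c → b ∈ A → c ∈ B) :
    p.toOuterMeasure A ≤ q.toOuterMeasure B := by
  obtain ⟨c, rfl, rfl, hc⟩ := h
  rw [PMF.toOuterMeasure_map_apply, PMF.toOuterMeasure_map_apply]
  refine PMF.toOuterMeasure_mono _ ?_
  rintro x ⟨hx, hs⟩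
  exact hAB _ _ (hc x hs) hx

theorem toOuterMeasure_univ {β : Type*} (p : PMF β) : p.toOuterMeasure Set.univ = 1 := by
  rw [PMF.toOuterMeasure_apply_eq_one_iff]; exact Set.subset_univ _

/-- Failure probabilities add up along a `bind`. -/
theorem toOuterMeasure_bind_le {β γ : Type*} (p : PMF β) (f : β → PMF γ) (A : Set β) (B : Set γ)
    (η : ℝ≥0∞) (h : ∀ b ∉ A, (f b).toOuterMeasure B ≤ η) :
    (p.bind f).toOuterMeasure B ≤ p.toOuterMeasure A + η := by
  rw [PMF.toOuterMeasure_bind_apply, PMF.toOuterMeasure_apply]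
  calc ∑' b, p b * (f b).toOuterMeasure B
      ≤ ∑' b, (A.indicator p b + p b * η) := by
        refine ENNReal.tsum_le_tsum fun b => ?_
        by_cases hb : b ∈ A
        · have h1 : (f b).toOuterMeasure B ≤ 1 := by
            rw [← toOuterMeasure_univ (f b)]
            exact (f b).toOuterMeasure.mono (Set.subset_univ _)
          rw [Set.indicator_of_mem hb]
          exact le_add_right ((mul_le_mul_right h1 _).trans (mul_one _).le)
        · exact le_add_left (mul_le_mul_right (h b hb) _)
    _ = ∑' b, A.indicator p b + η := by
        rw [ENNReal.tsum_add, ENNReal.tsum_mul_right, PMF.tsum_coe, one_mul]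

theorem le_toReal_toOuterMeasure {β : Type*} (p : PMF β) (A : Set β) (δ : ℝ) (hδ : 0 ≤ δ)
    (h : p.toOuterMeasure Aᶜ ≤ ENNReal.ofReal δ) : 1 - δ ≤ (p.toOuterMeasure A).toReal := by
  have h1 : (1 : ℝ≥0∞) ≤ p.toOuterMeasure A + ENNReal.ofReal δ := by
    rw [← toOuterMeasure_univ p, ← Set.union_compl_self A]
    exact (MeasureTheory.measure_union_le _ _).trans (add_le_add le_rfl h)
  have hfin : p.toOuterMeasure A ≠ ⊤ := by
    refine ne_top_of_le_ne_top ENNReal.one_ne_top ?_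
    rw [← toOuterMeasure_univ p]
    exact p.toOuterMeasure.mono (Set.subset_univ _)
  have h2 := ENNReal.toReal_mono (ENNReal.add_ne_top.2 ⟨hfin, ENNReal.ofReal_ne_top⟩) h1
  rw [ENNReal.toReal_add hfin ENNReal.ofReal_ne_top, ENNReal.toReal_ofReal hδ] at h2
  simp at h2
  linarith

theorem sum_toReal {β : Type*} [Fintype β] (p : PMF β) : ∑ b, (p b).toReal = 1 := by
  have h := p.tsum_coe
  rw [tsum_fintype] at h
  rw [← ENNReal.toReal_sum fun b _ => p.apply_ne_top b, h, ENNReal.toReal_one]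

theorem toOuterMeasure_fintype {β : Type*} [Fintype β] (p : PMF β) (A : Set β) :
    p.toOuterMeasure A = ENNReal.ofReal (∑ b, if b ∈ A then (p b).toReal else 0) := by
  rw [PMF.toOuterMeasure_apply_fintype, ENNReal.ofReal_sum_of_nonneg]
  · refine Finset.sum_congr rfl fun b _ => ?_
    by_cases h : b ∈ A <;> simp [h, ENNReal.ofReal_toReal (p.apply_ne_top b)]
  · intro b _
    split_ifs
    · exact ENNReal.toReal_nonneg
    · exact le_rfl

/-! ### Concentration of counts -/

theorem iid_toReal {β : Type*} [Fintype β] (P : PMF β) (m : ℕ) (S : Fin m → β) :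
    (iid P m S).toReal = ∏ j, (P (S j)).toReal := by
  simp [iid, PMF.ofFintype_apply, ENNReal.toReal_prod]

theorem sum_iid_mul_prod {β : Type*} [Fintype β] (P : PMF β) (m : ℕ) (J : Finset (Fin m))
    (g : β → ℝ) :
    ∑ S, (iid P m S).toReal * ∏ j ∈ J, g (S j) = (∑ b, (P b).toReal * g b) ^ J.card := by
  have h1 : ∀ S : Fin m → β, (iid P m S).toReal * ∏ j ∈ J, g (S j)
      = ∏ j, (P (S j)).toReal * if j ∈ J then g (S j) else 1 := by
    intro S
    rw [iid_toReal, Finset.prod_mul_distrib, Finset.prod_ite_mem, Finset.univ_inter]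
  simp_rw [h1]
  rw [← Fintype.prod_sum fun (j : Fin m) b => (P b).toReal * if j ∈ J then g b else 1]
  have h2 : ∀ j : Fin m, (∑ b, (P b).toReal * if j ∈ J then g b else 1)
      = if j ∈ J then ∑ b, (P b).toReal * g b else 1 := by
    intro j
    by_cases hj : j ∈ J <;> simp [hj, sum_toReal]
  simp_rw [h2]
  rw [Finset.prod_ite_mem, Finset.univ_inter, Finset.prod_const]

/-- The probability of an event, as a real number. -/
def prob {β : Type*} [Fintype β] (P : PMF β) (A : Set β) : ℝ :=
  ∑ b, if b ∈ A then (P b).toReal else 0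

/-- The number of samples in `J` that fall into `A`. -/
def countIn {β : Type*} {m : ℕ} (J : Finset (Fin m)) (A : Set β) (S : Fin m → β) : ℕ :=
  (J.filter fun j => S j ∈ A).card

theorem prob_nonneg {β : Type*} [Fintype β] (P : PMF β) (A : Set β) : 0 ≤ prob P A :=
  Finset.sum_nonneg fun b _ => by split_ifs <;> simp

theorem prob_le_one {β : Type*} [Fintype β] (P : PMF β) (A : Set β) : prob P A ≤ 1 := by
  rw [← sum_toReal P]
  exact Finset.sum_le_sum fun b _ => by split_ifs <;> simp

/-- Markov's inequality for exp(t · count), whose expectation is at most exp(μt + μt²). The sign of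
t is free, so both tails are covered. -/
theorem iid_chernoff {β : Type*} [Fintype β] (P : PMF β) (m : ℕ) (J : Finset (Fin m))
    (A : Set β) (t l : ℝ) (ht : |t| ≤ 1) :
    (iid P m).toOuterMeasure {S | t ^ 2 * (J.card * prob P A) + l
      ≤ t * (countIn J A S - J.card * prob P A)} ≤ ENNReal.ofReal (Real.exp (-l)) := by
  rw [toOuterMeasure_fintype]
  refine ENNReal.ofReal_le_ofReal ?_
  set μ := J.card * prob P A with hμ
  have hprod : ∀ S : Fin m → β, Real.exp (t * countIn J A S)
      = ∏ j ∈ J, Real.exp (if S j ∈ A then t else 0) := by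
    intro S
    rw [← Real.exp_sum, Finset.sum_ite, Finset.sum_const, Finset.sum_const_zero, add_zero,
      nsmul_eq_mul, mul_comm, countIn]
  have hE : ∑ b, (P b).toReal * Real.exp (if b ∈ A then t else 0)
      = 1 + prob P A * (Real.exp t - 1) := by
    calc ∑ b, (P b).toReal * Real.exp (if b ∈ A then t else 0)
        = ∑ b, ((P b).toReal + (if b ∈ A then (P b).toReal else 0) * (Real.exp t - 1)) := by
          refine Finset.sum_congr rfl fun b _ => ?_
          by_cases hb : b ∈ A <;> simp [hb]
          ring
      _ = _ := by rw [Finset.sum_add_distrib, sum_toReal, prob, Finset.sum_mul]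
  have hmgf : ∑ S, (iid P m S).toReal * Real.exp (t * countIn J A S)
      ≤ Real.exp (μ * t + t ^ 2 * μ) := by
    simp_rw [hprod]
    rw [sum_iid_mul_prod P m J fun b => Real.exp (if b ∈ A then t else 0), hE]
    have h0 : (0 : ℝ) ≤ 1 + prob P A * (Real.exp t - 1) := by
      rw [← hE]
      exact Finset.sum_nonneg fun b _ => mul_nonneg ENNReal.toReal_nonneg (Real.exp_pos _).le
    calc (1 + prob P A * (Real.exp t - 1)) ^ J.card
        ≤ Real.exp (prob P A * (Real.exp t - 1)) ^ J.card := by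
          refine pow_le_pow_left₀ h0 ?_ _
          rw [add_comm]; exact Real.add_one_le_exp _
      _ = Real.exp (μ * (Real.exp t - 1)) := by
          rw [← Real.exp_nat_mul, hμ]; ring_nf
      _ ≤ _ := by
          refine Real.exp_le_exp.2 ?_
          -- The estimate exp t - 1 ≤ t + t² is where |t| ≤ 1 enters.
          have h2 := (abs_le.1 (Real.abs_exp_sub_one_sub_id_le ht)).2
          have h3 : 0 ≤ μ := mul_nonneg (Nat.cast_nonneg _) (prob_nonneg P A)
          nlinarith
  calc (∑ S, if S ∈ {S : Fin m → β | t ^ 2 * μ + l ≤ t * (countIn J A S - μ)}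
          then (iid P m S).toReal else 0)
      ≤ ∑ S, (iid P m S).toReal * Real.exp (t * countIn J A S)
          * Real.exp (-(μ * t + t ^ 2 * μ) - l) := by
        refine Finset.sum_le_sum fun S _ => ?_
        split_ifs with hS
        · rw [mul_assoc, ← Real.exp_add]
          refine le_mul_of_one_le_right ENNReal.toReal_nonneg (Real.one_le_exp ?_)
          simp only [Set.mem_ofPred_eq] at hS
          linarith
        · positivity
    _ ≤ Real.exp (μ * t + t ^ 2 * μ) * Real.exp (-(μ * t + t ^ 2 * μ) - l) := by
        rw [← Finset.sum_mul]
        exact mul_le_mul_of_nonneg_right hmgf (Real.exp_pos _).le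
    _ = Real.exp (-l) := by rw [← Real.exp_add]; ring_nf

/-- The set of samples for which the count of `A` deviates from its mean. -/
def deviates {β : Type*} [Fintype β] (P : PMF β) {m : ℕ} (J : Finset (Fin m)) (l : ℝ)
    (A : Set β) : Set (Fin m → β) :=
  {S | 4 * l * (J.card * prob P A + l) < (countIn J A S - J.card * prob P A) ^ 2}

/-- With t² = l / (μ + l), a squared deviation above 4l(μ + l) means t |count - μ| > 2l, while t²μ ≤
l. The two tails are then instances of the Chernoff bound for t and -t. -/
theorem iid_deviates_le {β : Type*} [Fintype β] (P : PMF β) (m : ℕ) (J : Finset (Fin m))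
    (A : Set β) (l : ℝ) (hl : 0 < l) :
    (iid P m).toOuterMeasure (deviates P J l A) ≤ ENNReal.ofReal (2 * Real.exp (-l)) := by
  set μ := J.card * prob P A with hμ
  have hμ0 : 0 ≤ μ := mul_nonneg (Nat.cast_nonneg _) (prob_nonneg P A)
  set t := √(l / (μ + l)) with ht
  have hpos : 0 < μ + l := by linarith
  have ht0 : 0 ≤ t := Real.sqrt_nonneg _
  have hsq : t ^ 2 = l / (μ + l) := Real.sq_sqrt (by positivity)
  have ht1 : t ≤ 1 := by
    exact Real.sqrt_le_one.2 ((div_le_one hpos).2 (by linarith))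
  have htμ : t ^ 2 * μ ≤ l := by
    rw [hsq, div_mul_eq_mul_div, div_le_iff₀ hpos]
    nlinarith
  have hsub : deviates P J l A ⊆
      {S | t ^ 2 * μ + l ≤ t * (countIn J A S - μ)} ∪
      {S | (-t) ^ 2 * μ + l ≤ (-t) * (countIn J A S - μ)} := by
    intro S hS
    simp only [deviates, Set.mem_ofPred_eq, ← hμ] at hS
    have h1 : (2 * l) ^ 2 ≤ (t * (countIn J A S - μ)) ^ 2 := by
      rw [mul_pow t, hsq, div_mul_eq_mul_div, le_div_iff₀ hpos]
      nlinarith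
    have h2 := sq_le_sq.1 h1
    rw [abs_of_pos (by linarith : (0:ℝ) < 2 * l)] at h2
    rcases le_abs'.1 h2 with h | h
    · right
      simp only [Set.mem_ofPred_eq, neg_sq]
      linarith
    · left
      simp only [Set.mem_ofPred_eq]
      linarith
  refine (MeasureTheory.measure_mono hsub).trans
    ((MeasureTheory.measure_union_le _ _).trans ?_)
  rw [two_mul, ENNReal.ofReal_add (Real.exp_pos _).le (Real.exp_pos _).le]
  refine add_le_add (iid_chernoff P m J A t l ?_) (iid_chernoff P m J A (-t) l ?_)
  · rwa [abs_of_nonneg ht0]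
  · rwa [abs_neg, abs_of_nonneg ht0]

/-! ### Smoothed empirical frequencies -/

/-- Put U = Na + l and W = N + sl. The left side is μ (pW - U)² / (UW). Smoothing keeps U and W
comparable to pμ + l and μ + l from below even when the counts vanish, so the bound does not
deteriorate for rare contexts. -/
theorem smoothed_term_le (s l p μ N Na : ℝ) (hs : 1 ≤ s) (hl : 0 < l) (hp : 0 ≤ p) (hp1 : p ≤ 1)
    (hμ : 0 ≤ μ) (hN : 0 ≤ N) (hNa : 0 ≤ Na) (hdev : (N - μ) ^ 2 ≤ 4 * l * (μ + l))
    (hdeva : (Na - p * μ) ^ 2 ≤ 4 * l * (p * μ + l)) :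
    μ * ((p - (Na + l) / (N + s * l)) ^ 2 / ((Na + l) / (N + s * l)))
      ≤ 720 * l + (576 * l + 24 * (s * l)) * p := by
  -- If y + l > 6(x + l), then also y + l > 6l, so (y - x)² > (25/36)(y + l)² > (25/6) l (y + l),
  -- which exceeds 4l(y + l).
  have lower : ∀ x y : ℝ, 0 ≤ x → 0 ≤ y → (x - y) ^ 2 ≤ 4 * l * (y + l) → y + l ≤ 6 * (x + l) := by
    intro x y hx hy h
    by_contra hcon
    push Not at hcon
    nlinarith
  have hy := lower Na (p * μ) hNa (mul_nonneg hp hμ) hdeva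
  have hW := lower N μ hN hμ hdev
  have hU0 : 0 < Na + l := by linarith
  have hsl : l ≤ s * l := by nlinarith
  have hW0 : 0 < N + s * l := by linarith
  set U := Na + l with hU
  set W := N + s * l with hWdef
  have e1 : (p - U / W) ^ 2 / (U / W) = (p * W - U) ^ 2 / (U * W) := by
    field_simp
  rw [e1, ← mul_div_assoc, div_le_iff₀ (mul_pos hU0 hW0)]
  have hD : (p * W - U) ^ 2 ≤ 4 * ((5 * l + 4 * l * p) * (p * μ + l) + p ^ 2 * (s * l) ^ 2) := by
    -- Two sampling errors and two smoothing biases.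
    have e2 : p * W - U = p * (N - μ) + (-(Na - p * μ)) + p * (s * l) + (-l) := by
      rw [hU, hWdef]; ring
    have e3 : ∀ a b c d : ℝ, (a + b + c + d) ^ 2 ≤ 4 * (a ^ 2 + b ^ 2 + c ^ 2 + d ^ 2) := by
      intro a b c d
      nlinarith [sq_nonneg (a - b), sq_nonneg (a - c), sq_nonneg (a - d), sq_nonneg (b - c),
        sq_nonneg (b - d), sq_nonneg (c - d)]
    rw [e2]
    refine (e3 _ _ _ _).trans ?_
    have h1 : (p * (N - μ)) ^ 2 ≤ 4 * l * p * (p * μ + l) := by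
      rw [mul_pow]
      have a1 : p ^ 2 * (N - μ) ^ 2 ≤ p ^ 2 * (4 * l * (μ + l)) :=
        mul_le_mul_of_nonneg_left hdev (sq_nonneg p)
      have a2 : p * l ≤ l := by nlinarith
      have a3 : 4 * l * p * (p * (μ + l)) ≤ 4 * l * p * (p * μ + l) :=
        mul_le_mul_of_nonneg_left (by linarith) (by positivity)
      nlinarith
    have h2 : l ^ 2 ≤ l * (p * μ + l) := by nlinarith [mul_nonneg hp hμ, mul_nonneg hl.le (mul_nonneg hp hμ)]
    have e4 : (p * (s * l)) ^ 2 = p ^ 2 * (s * l) ^ 2 := mul_pow _ _ _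
    rw [neg_sq, neg_sq, e4]
    nlinarith
  have hpμ : p * μ ≤ 6 * U := by linarith
  have hμW : μ ≤ 6 * W := by rw [hWdef]; linarith
  have hsW : s * l ≤ W := by rw [hWdef]; linarith
  calc μ * (p * W - U) ^ 2
      ≤ μ * (4 * ((5 * l + 4 * l * p) * (p * μ + l) + p ^ 2 * (s * l) ^ 2)) :=
        mul_le_mul_of_nonneg_left hD hμ
    _ = 4 * (5 * l + 4 * l * p) * (μ * (p * μ + l)) + 4 * (p * (s * l)) * ((p * μ) * (s * l)) := by
        ring
    _ ≤ 4 * (5 * l + 4 * l * p) * ((6 * W) * (6 * U)) + 4 * (p * (s * l)) * ((6 * U) * W) := by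
        gcongr
    _ = _ := by ring

/-- The `χ²`-distance of the smoothed empirical distribution from the true one. -/
theorem smoothed_chi_sq_le (s : ℕ) [NeZero s] (l μ N : ℝ) (p Na : Fin s → ℝ) (hl : 0 < l)
    (hp : ∀ a, 0 ≤ p a) (hp1 : ∑ a, p a = 1) (hμ : 0 ≤ μ) (hN : 0 ≤ N) (hNa : ∀ a, 0 ≤ Na a)
    (hdev : (N - μ) ^ 2 ≤ 4 * l * (μ + l))
    (hdeva : ∀ a, (Na a - p a * μ) ^ 2 ≤ 4 * l * (p a * μ + l)) :
    μ * ∑ a, (p a - (Na a + l) / (N + s * l)) ^ 2 / ((Na a + l) / (N + s * l))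
      ≤ 1320 * (s * l) := by
  have hs : (1 : ℝ) ≤ s := by exact_mod_cast Nat.one_le_iff_ne_zero.2 (NeZero.ne s)
  rw [Finset.mul_sum]
  calc _ ≤ ∑ a, (720 * l + (576 * l + 24 * (s * l)) * p a) :=
        Finset.sum_le_sum fun a _ => smoothed_term_le s l (p a) μ N (Na a) hs hl (hp a)
          (hp1 ▸ Finset.single_le_sum (fun b _ => hp b) (Finset.mem_univ a)) hμ hN (hNa a) hdev
          (hdeva a)
    -- Since s ≥ 1, the constant is 720 + 576 + 24 = 1320.
    _ = 720 * (s * l) + 576 * l + 24 * (s * l) := by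
        rw [Finset.sum_add_distrib, ← Finset.mul_sum Finset.univ p, hp1]
        simp
        ring
    _ ≤ _ := by nlinarith

/-! ### Total variation and Kullback-Leibler divergence -/

/-- The comparison passes through the Bhattacharyya coefficient B = ∑ √(pq). From log x ≤ x - 1 at x
= √(q/p) the divergence is at least 2 - 2B, and Cauchy-Schwarz for |p - q| = |√p - √q| (√p + √q)
gives TV² ≤ 1 - B². -/
theorem sq_tv_le_kl {Ω : Type*} [Fintype Ω] (p q : Ω → ℝ) (hp : ∀ v, 0 ≤ p v)
    (hq : ∀ v, 0 < q v) (hp1 : ∑ v, p v = 1) (hq1 : ∑ v, q v = 1) :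
    ((∑ v, |p v - q v|) / 2) ^ 2 ≤ ∑ v, p v * Real.log (p v / q v) := by
  set B := ∑ v, √(p v) * √(q v) with hB
  have hsp : ∀ v, √(p v) ^ 2 = p v := fun v => Real.sq_sqrt (hp v)
  have hsq : ∀ v, √(q v) ^ 2 = q v := fun v => Real.sq_sqrt (hq v).le
  have hkl : 2 - 2 * B ≤ ∑ v, p v * Real.log (p v / q v) := by
    have : 2 - 2 * B = ∑ v, (2 * p v - 2 * (√(p v) * √(q v))) := by
      rw [Finset.sum_sub_distrib, ← Finset.mul_sum, ← Finset.mul_sum, hp1, mul_one]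
    rw [this]
    refine Finset.sum_le_sum fun v _ => ?_
    rcases (hp v).eq_or_lt with h | h
    · simp [← h]
    · have a0 : 0 < √(p v) := Real.sqrt_pos.2 h
      have b0 : 0 < √(q v) := Real.sqrt_pos.2 (hq v)
      have h1 : Real.log (p v / q v) = -(2 * Real.log (√(q v) / √(p v))) := by
        have : p v / q v = ((√(q v) / √(p v)) ^ 2)⁻¹ := by
          rw [div_pow, hsp, hsq, inv_div]
        rw [this, Real.log_inv, Real.log_pow]; norm_num
      have h2 := Real.log_le_sub_one_of_pos (div_pos b0 a0)
      have h3 : p v * (√(q v) / √(p v)) = √(p v) * √(q v) := by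
        rw [← hsp v]; field_simp; rw [Real.sqrt_sq a0.le]
      rw [h1]
      nlinarith
  have hminus : ∑ v, (√(p v) - √(q v)) ^ 2 = 2 - 2 * B := by
    have : ∀ v, (√(p v) - √(q v)) ^ 2 = p v + q v - 2 * (√(p v) * √(q v)) := by
      intro v; rw [sub_sq, hsp, hsq]; ring
    simp_rw [this]
    rw [Finset.sum_sub_distrib, Finset.sum_add_distrib, ← Finset.mul_sum, hp1, hq1]; ring
  have hplus : ∑ v, (√(p v) + √(q v)) ^ 2 = 2 + 2 * B := by
    have : ∀ v, (√(p v) + √(q v)) ^ 2 = p v + q v + 2 * (√(p v) * √(q v)) := by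
      intro v; rw [add_sq, hsp, hsq]; ring
    simp_rw [this]
    rw [Finset.sum_add_distrib, Finset.sum_add_distrib, ← Finset.mul_sum, hp1, hq1]; ring
  have hcs := Finset.sum_mul_sq_le_sq_mul_sq Finset.univ (fun v => |√(p v) - √(q v)|)
    (fun v => √(p v) + √(q v))
  have habs : ∀ v, |√(p v) - √(q v)| * (√(p v) + √(q v)) = |p v - q v| := by
    intro v
    have h0 : 0 ≤ √(p v) + √(q v) := by positivity
    rw [← abs_of_nonneg h0, ← abs_mul]
    congr 1
    linear_combination hsp v - hsq v
  simp_rw [habs, sq_abs] at hcs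
  rw [hminus, hplus] at hcs
  have hB0 : 0 ≤ 2 - 2 * B := hminus ▸ Finset.sum_nonneg fun v _ => sq_nonneg _
  -- 1 - B² ≤ 2 - 2B because (1 - B)² ≥ 0.
  nlinarith

/-! ### Distributions given by conditional distributions along an order -/

section Chain

variable {ι : Type*} [DecidableEq ι] {s : ℕ}

theorem dependsOn_update {β : Type*} {g : (ι → Fin s) → β} {D : Set ι} (hg : DependsOn g D)
    {i : ι} (hi : i ∉ D) (v : ι → Fin s) (a : Fin s) : g (Function.update v i a) = g v :=
  hg fun _ hj => Function.update_of_ne (ne_of_mem_of_not_mem hj hi) _ _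

/-- A family of conditional distributions along the order given by `rank`. -/
structure IsChain (rank : ι → ℕ) (r : ι → (ι → Fin s) → ℝ) : Prop where
  dep : ∀ i, DependsOn (r i) {j | rank j ≤ rank i}
  sum_one : ∀ i v, ∑ a, r i (Function.update v i a) = 1

variable {rank : ι → ℕ} {r r' : ι → (ι → Fin s) → ℝ}

theorem IsChain.dependsOn_prod (hr : IsChain rank r) (A : Finset ι) (t : ℕ)
    (hA : ∀ j ∈ A, rank j ≤ t) : DependsOn (fun v => ∏ j ∈ A, r j v) {j | rank j ≤ t} := by
  intro v w h
  refine Finset.prod_congr rfl fun j hj => hr.dep j fun k hk => h k ?_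
  exact le_trans hk (hA j hj)

theorem IsChain.prod_update (hr : IsChain rank r) (A : Finset ι) {i : ι}
    (hA : ∀ j ∈ A, rank j < rank i) (v : ι → Fin s) (a : Fin s) :
    ∏ j ∈ A, r j (Function.update v i a) = ∏ j ∈ A, r j v := by
  refine Finset.prod_congr rfl fun j hj => dependsOn_update (hr.dep j) ?_ v a
  simpa using hA j hj

variable [Fintype ι]

theorem sum_sum_update (i : ι) (g : (ι → Fin s) → ℝ) :
    ∑ v, ∑ a, g (Function.update v i a) = s * ∑ v, g v := by
  have h : ∑ p : (ι → Fin s) × Fin s, g (Function.update p.1 i p.2)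
      = ∑ p : (ι → Fin s) × Fin s, g p.1 := by
    refine Finset.sum_bij' (fun p _ => (Function.update p.1 i p.2, p.1 i))
      (fun p _ => (Function.update p.1 i p.2, p.1 i)) ?_ ?_ ?_ ?_ ?_ <;> simp
  rw [Fintype.sum_prod_type, Fintype.sum_prod_type] at h
  rw [h]
  simp [Finset.mul_sum]

/-- The variable of largest rank in `B` occurs in no other factor, so its conditional distribution
sums to 1. Iterating removes all of `B`. As the sums run over full assignments, every removed
coordinate leaves a factor s. -/
theorem IsChain.sum_out (hr : IsChain rank r) (hrank : Function.Injective rank)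
    (h : (ι → Fin s) → ℝ) (B : Finset ι) (hB : DependsOn h (B : Set ι)ᶜ) :
    (s : ℝ) ^ B.card * ∑ v, h v * ∏ j ∈ B, r j v = ∑ v, h v := by
  induction hc : B.card generalizing B with
  | zero =>
    rw [Finset.card_eq_zero] at hc
    subst hc
    simp
  | succ c ih =>
    have hne : B.Nonempty := by rw [← Finset.card_pos]; omega
    obtain ⟨i, hi, hmax⟩ := B.exists_max_image rank hne
    have hcard : (B.erase i).card = c := by rw [Finset.card_erase_of_mem hi]; omega
    rw [pow_succ, mul_assoc, ← sum_sum_update i]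
    have key : ∀ v : ι → Fin s, ∑ a, h (Function.update v i a)
        * ∏ j ∈ B, r j (Function.update v i a) = h v * ∏ j ∈ B.erase i, r j v := by
      intro v
      have h1 : ∀ a, h (Function.update v i a) * ∏ j ∈ B, r j (Function.update v i a)
          = r i (Function.update v i a) * (h v * ∏ j ∈ B.erase i, r j v) := by
        intro a
        rw [dependsOn_update hB (by simpa using hi), ← Finset.mul_prod_erase B _ hi,
          hr.prod_update (B.erase i) (fun j hj => lt_of_le_of_ne
            (hmax j (Finset.mem_of_mem_erase hj))
            (fun he => Finset.ne_of_mem_erase hj (hrank he)))]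
        ring
      simp_rw [h1]
      rw [← Finset.sum_mul, hr.sum_one, one_mul]
    simp_rw [key]
    refine ih _ ?_ hcard
    exact hB.mono (by simp)

theorem IsChain.sum_prod [NeZero s] (hr : IsChain rank r) (hrank : Function.Injective rank) :
    ∑ v, ∏ j, r j v = 1 := by
  have h := hr.sum_out hrank (fun _ => 1) Finset.univ (fun _ _ _ => rfl)
  have h0 : (s : ℝ) ^ (Finset.univ : Finset ι).card ≠ 0 :=
    pow_ne_zero _ (by exact_mod_cast NeZero.ne s)
  simp only [one_mul] at h
  refine mul_left_cancel₀ h0 (h.trans ?_)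
  simp

/-- The tower property: `h` may be replaced by its conditional expectation given the variables
before i. After the later variables are summed out, both sides become the same sum. -/
theorem IsChain.sum_mul_eq [NeZero s] (hr : IsChain rank r) (hrank : Function.Injective rank)
    (i : ι) (h : (ι → Fin s) → ℝ) (hh : DependsOn h {j | rank j ≤ rank i}) :
    ∑ v, (∏ j, r j v) * h v = ∑ v, (∏ j, r j v)
      * ∑ a, r i (Function.update v i a) * h (Function.update v i a) := by
  set A := Finset.univ.filter fun j => rank j < rank i with hA
  set B := Finset.univ.filter fun j => rank i < rank j with hB
  have hsplit : ∀ v, ∏ j, r j v = (r i v * ∏ j ∈ A, r j v) * ∏ j ∈ B, r j v := by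
    intro v
    have hd : Disjoint A B := by
      rw [Finset.disjoint_left]; intro j; simp [hA, hB]; omega
    have hi : i ∉ A ∪ B := by simp [hA, hB]
    have hu : Finset.univ = insert i (A ∪ B) := by
      ext j
      simp only [Finset.mem_univ, Finset.mem_insert, Finset.mem_union, hA, hB,
        Finset.mem_filter, true_and, true_iff]
      rcases lt_trichotomy (rank j) (rank i) with h | h | h
      · exact Or.inr (Or.inl h)
      · exact Or.inl (hrank h)
      · exact Or.inr (Or.inr h)
    rw [hu, Finset.prod_insert hi, Finset.prod_union hd, mul_assoc]
  have hs : (s : ℝ) ≠ 0 := by exact_mod_cast NeZero.ne s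
  have hsB : (s : ℝ) ^ B.card ≠ 0 := pow_ne_zero _ hs
  have reduce : ∀ g : (ι → Fin s) → ℝ, DependsOn g {j | rank j ≤ rank i} →
      (s : ℝ) * ((s : ℝ) ^ B.card * ∑ v, (∏ j, r j v) * g v)
      = ∑ v, (∏ j ∈ A, r j v) * ∑ a, r i (Function.update v i a) * g (Function.update v i a) := by
    intro g hg
    have h1 := hr.sum_out hrank (fun v => (r i v * ∏ j ∈ A, r j v) * g v) B ?_
    · have h2 : ∀ v, (∏ j, r j v) * g v
          = (r i v * ∏ j ∈ A, r j v) * g v * ∏ j ∈ B, r j v := by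
        intro v; rw [hsplit]; ring
      simp_rw [h2]
      rw [h1, ← sum_sum_update i]
      refine Finset.sum_congr rfl fun v _ => ?_
      rw [Finset.mul_sum]
      refine Finset.sum_congr rfl fun a _ => ?_
      rw [hr.prod_update A (by simp [hA])]
      ring
    · have hsub : ∀ v w : ι → Fin s, (∀ j ∈ (B : Set ι)ᶜ, v j = w j) →
          ∀ j ∈ {j | rank j ≤ rank i}, v j = w j := by
        intro v w hvw j hj
        exact hvw j (by simpa [hB] using hj)
      intro v w hvw
      have hvw' := hsub v w hvw
      change r i v * (∏ j ∈ A, r j v) * g v = r i w * (∏ j ∈ A, r j w) * g w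
      rw [hr.dep i hvw', hg hvw']
      rw [show ∏ j ∈ A, r j v = ∏ j ∈ A, r j w from
        hr.dependsOn_prod A (rank i) (by simp only [hA, Finset.mem_filter]; intro j hj; omega) hvw']
  refine mul_left_cancel₀ hsB (mul_left_cancel₀ hs ?_)
  rw [reduce h hh, reduce]
  · refine Finset.sum_congr rfl fun v _ => ?_
    congr 1
    simp only [Function.update_idem]
    rw [← Finset.sum_mul, hr.sum_one, one_mul]
  · intro v w hvw
    refine Finset.sum_congr rfl fun a _ => ?_
    have : ∀ j ∈ {j | rank j ≤ rank i}, Function.update v i a j = Function.update w i a j := by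
      intro j hj
      by_cases hji : j = i
      · subst hji; simp
      · rw [Function.update_of_ne hji, Function.update_of_ne hji]; exact hvw j hj
    rw [hr.dep i this, hh this]

/-- The `χ²`-distance of the conditional distributions of variable `i`, given the others. -/
def chiSq (r r' : ι → (ι → Fin s) → ℝ) (i : ι) (v : ι → Fin s) : ℝ :=
  ∑ a, (r i (Function.update v i a) - r' i (Function.update v i a)) ^ 2
    / r' i (Function.update v i a)

/-- As both have total mass 1, the χ²-distance equals ∑ p (p/q - 1), and log x ≤ x - 1 applies
termwise. -/
theorem sum_mul_log_le_chi_sq {κ : Type*} [Fintype κ] (p q : κ → ℝ) (hp : ∀ a, 0 ≤ p a)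
    (hq : ∀ a, 0 < q a) (hp1 : ∑ a, p a = 1) (hq1 : ∑ a, q a = 1) :
    ∑ a, p a * Real.log (p a / q a) ≤ ∑ a, (p a - q a) ^ 2 / q a := by
  have h : ∑ a, (p a - q a) ^ 2 / q a = ∑ a, (p a * (p a / q a - 1)) := by
    have h1 : ∀ a, (p a - q a) ^ 2 / q a = p a * (p a / q a - 1) + (q a - p a) := by
      intro a
      have := (hq a).ne'
      field_simp
      ring
    simp_rw [h1]
    rw [Finset.sum_add_distrib, Finset.sum_sub_distrib, hp1, hq1]
    ring
  rw [h]
  refine Finset.sum_le_sum fun a _ => ?_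
  rcases (hp a).eq_or_lt with h0 | h0
  · simp [← h0]
  · exact mul_le_mul_of_nonneg_left (Real.log_le_sub_one_of_pos (div_pos h0 (hq a))) (hp a)

/-- The chain rule for the divergence: the logarithm of the ratio of products is a sum over the
variables, and by the tower property each summand becomes an expected conditional divergence, which
χ² bounds. -/
theorem sq_tv_le_sum_chiSq [NeZero s] (hr : IsChain rank r) (hr' : IsChain rank r')
    (hrank : Function.Injective rank) (h0 : ∀ i v, 0 ≤ r i v) (h0' : ∀ i v, 0 < r' i v) :
    ((∑ v, |∏ j, r j v - ∏ j, r' j v|) / 2) ^ 2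
      ≤ ∑ i, ∑ v, (∏ j, r j v) * chiSq r r' i v := by
  refine (sq_tv_le_kl (fun v => ∏ j, r j v) (fun v => ∏ j, r' j v)
    (fun v => Finset.prod_nonneg fun j _ => h0 j v)
    (fun v => Finset.prod_pos fun j _ => h0' j v) (hr.sum_prod hrank)
    (hr'.sum_prod hrank)).trans ?_
  have h1 : ∀ v, (∏ j, r j v) * Real.log ((∏ j, r j v) / ∏ j, r' j v)
      = ∑ i, (∏ j, r j v) * Real.log (r i v / r' i v) := by
    intro v
    by_cases hz : ∏ j, r j v = 0
    · simp [hz]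
    · rw [← Finset.prod_div_distrib, Real.log_prod, Finset.mul_sum]
      intro i _
      exact div_ne_zero (Finset.prod_ne_zero_iff.1 hz i (Finset.mem_univ i)) (h0' i v).ne'
  simp_rw [h1]
  rw [Finset.sum_comm]
  refine Finset.sum_le_sum fun i _ => ?_
  rw [hr.sum_mul_eq hrank i (fun v => Real.log (r i v / r' i v))]
  · refine Finset.sum_le_sum fun v _ => ?_
    exact mul_le_mul_of_nonneg_left (sum_mul_log_le_chi_sq _ _ (fun a => h0 _ _)
      (fun a => h0' _ _) (hr.sum_one i v) (hr'.sum_one i v))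
      (Finset.prod_nonneg fun j _ => h0 j v)
  · intro v w hvw
    change Real.log _ = Real.log _
    rw [hr.dep i hvw, hr'.dep i hvw]

end Chain

/-! ### Independence of functions of disjoint sets of coordinates -/

/-- Take two independent copies (a, b) and swap their coordinates outside `E`. This preserves the
joint weight and turns f(a) g(b) into a function of the first copy alone. -/
theorem sum_prod_mul_of_dependsOn {ι : Type*} [Fintype ι] [DecidableEq ι] {U : ι → Type*} [∀ e, Fintype (U e)]
    (w : ∀ e, U e → ℝ) (hw : ∀ e, ∑ a, w e a = 1) (E : Set ι) (f g : (∀ e, U e) → ℝ)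
    (hf : DependsOn f E) (hg : DependsOn g Eᶜ) :
    ∑ u, (∏ e, w e (u e)) * (f u * g u)
      = (∑ u, (∏ e, w e (u e)) * f u) * ∑ u, (∏ e, w e (u e)) * g u := by
  have hone : ∑ u : (∀ e, U e), ∏ e, w e (u e) = 1 := by
    rw [← Fintype.prod_sum]; exact Finset.prod_eq_one fun e _ => hw e
  let mix : (∀ e, U e) → (∀ e, U e) → ∀ e, U e := fun a b e => if e ∈ E then a e else b e
  have hmix : ∀ a b, mix (mix a b) (mix b a) = a := by
    intro a b; funext e; by_cases he : e ∈ E <;> simp [mix, he]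
  have key : ∑ p : (∀ e, U e) × (∀ e, U e),
        ((∏ e, w e (p.1 e)) * f p.1) * ((∏ e, w e (p.2 e)) * g p.2)
      = ∑ p : (∀ e, U e) × (∀ e, U e),
        ((∏ e, w e (p.1 e)) * (f p.1 * g p.1)) * ∏ e, w e (p.2 e) := by
    refine Finset.sum_bij' (fun p _ => (mix p.1 p.2, mix p.2 p.1))
      (fun p _ => (mix p.1 p.2, mix p.2 p.1)) (by simp) (by simp)
      (fun p _ => by simp [hmix]) (fun p _ => by simp [hmix]) ?_
    rintro ⟨a, b⟩ -
    have h1 : f (mix a b) = f a := hf fun e he => by simp [mix, he]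
    have h2 : g (mix a b) = g b := hg fun e he => by
      have : e ∉ E := he
      simp [mix, this]
    have h3 : (∏ e, w e (a e)) * ∏ e, w e (b e)
        = (∏ e, w e (mix a b e)) * ∏ e, w e (mix b a e) := by
      rw [← Finset.prod_mul_distrib, ← Finset.prod_mul_distrib]
      refine Finset.prod_congr rfl fun e _ => ?_
      by_cases he : e ∈ E <;> simp [mix, he, mul_comm]
    dsimp only
    rw [h1, h2]
    calc _ = ((∏ e, w e (a e)) * ∏ e, w e (b e)) * (f a * g b) := by ring
      _ = _ := by rw [h3]; ring
  rw [Fintype.sum_prod_type, Fintype.sum_prod_type] at key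
  rw [Finset.sum_mul_sum, key]
  refine Finset.sum_congr rfl fun u _ => ?_
  dsimp only
  rw [← Finset.mul_sum, hone, mul_one]

/-! ### Cylinders -/

/-- The assignments that agree with `v` on `D`. -/
def cyl {ι : Type*} {s : ℕ} (D : Finset ι) (v : ι → Fin s) : Set (ι → Fin s) :=
  {w | ∀ j ∈ D, w j = v j}

theorem cyl_congr {ι : Type*} {s : ℕ} {D : Finset ι} {v w : ι → Fin s}
    (h : ∀ j ∈ D, v j = w j) : cyl D v = cyl D w := by
  ext u
  exact forall₂_congr fun j hj => by rw [h j hj]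

theorem exists_extension {ι : Type*} {s : ℕ} [NeZero s] (D : Finset ι) (z : D → Fin s) :
    ∃ v : ι → Fin s, ∀ j : D, v j = z j :=
  ⟨fun j => if h : j ∈ D then z ⟨j, h⟩ else 0, fun j => by simp⟩

/-- The cylinders over `D` partition the space into s^|D| pieces on which `g` is constant. A bound
on probability times error for each context thus gives an expected error. -/
theorem sum_le_of_cyl {ι : Type*} [Fintype ι] [DecidableEq ι] {s : ℕ} [NeZero s] (P : PMF (ι → Fin s))
    (D : Finset ι) (g : (ι → Fin s) → ℝ) (hg : DependsOn g (D : Set ι)) (b : ℝ)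
    (hb : ∀ v, prob P (cyl D v) * g v ≤ b) :
    ∑ v, (P v).toReal * g v ≤ (s : ℝ) ^ D.card * b := by
  let res : (ι → Fin s) → (D → Fin s) := fun v j => v j
  rw [← Finset.sum_fiberwise Finset.univ res]
  have : ∀ z : D → Fin s, ∑ v with res v = z, (P v).toReal * g v ≤ b := by
    intro z
    obtain ⟨v, hv⟩ := exists_extension D z
    refine le_trans (le_of_eq ?_) (hb v)
    rw [prob, Finset.sum_mul, Finset.sum_filter]
    refine Finset.sum_congr rfl fun w _ => ?_
    have hiff : res w = z ↔ w ∈ cyl D v := by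
      constructor
      · rintro rfl j hj; exact (hv ⟨j, hj⟩).symm
      · intro h; funext j; rw [← hv j]; exact h j j.2
    by_cases hw : w ∈ cyl D v
    · rw [if_pos (hiff.2 hw), if_pos hw, hg (fun j hj => hw j hj)]
    · rw [if_neg (fun h => hw (hiff.1 h)), if_neg hw, zero_mul]
  refine (Finset.sum_le_sum fun z _ => this z).trans (le_of_eq ?_)
  simp

theorem iid_deviates_cyl_le {ι : Type*} [Fintype ι] [DecidableEq ι] {s : ℕ} [NeZero s] (P : PMF (ι → Fin s))
    (m : ℕ) (J : Finset (Fin m)) (D : Finset ι) (l : ℝ) (hl : 0 < l) :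
    (iid P m).toOuterMeasure {S | ∃ v, S ∈ deviates P J l (cyl D v)}
      ≤ ENNReal.ofReal ((s : ℝ) ^ D.card * (2 * Real.exp (-l))) := by
  choose ext hext using exists_extension (s := s) D
  have hsub : {S | ∃ v, S ∈ deviates P J l (cyl D v)}
      ⊆ ⋃ z ∈ (Finset.univ : Finset (D → Fin s)), deviates P J l (cyl D (ext z)) := by
    rintro S ⟨v, hv⟩
    simp only [Finset.mem_univ, Set.iUnion_true, Set.mem_iUnion]
    refine ⟨fun j => v j, ?_⟩
    rwa [cyl_congr (w := v) fun j hj => hext (fun j => v j) ⟨j, hj⟩]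
  refine (MeasureTheory.measure_mono hsub).trans
    ((MeasureTheory.measure_biUnion_finset_le _ _).trans
      ((Finset.sum_le_sum fun z _ => iid_deviates_le P m J _ l hl).trans (le_of_eq ?_)))
  rw [Finset.sum_const, nsmul_eq_mul, ENNReal.ofReal_mul (by positivity)]
  simp [ENNReal.ofReal_pow]

/-! ### Graph lemmas -/

namespace ADMG

variable {n : ℕ} (G : ADMG n)

theorem mem_cComp {i j : Fin n} : j ∈ G.cComp i ↔ G.bi.Reachable i j := by simp [cComp]

theorem self_mem_cComp (i : Fin n) : i ∈ G.cComp i := G.mem_cComp.2 (SimpleGraph.Reachable.refl i)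

theorem cComp_comm {i j : Fin n} : j ∈ G.cComp i ↔ i ∈ G.cComp j := by
  rw [mem_cComp, mem_cComp]; exact ⟨fun h => h.symm, fun h => h.symm⟩

theorem mem_cComp_of_adj {i j k : Fin n} (hj : j ∈ G.cComp i) (h : G.bi.Adj j k) :
    k ∈ G.cComp i := by
  rw [mem_cComp] at *
  exact hj.trans h.reachable

theorem mem_paPlus {S : Finset (Fin n)} {j : Fin n} :
    j ∈ G.paPlus S ↔ j ∈ S ∨ ∃ i ∈ S, G.dir j i := by
  simp [paPlus, parents]

theorem paPlus_mono {S S' : Finset (Fin n)} (h : S ⊆ S') : G.paPlus S ⊆ G.paPlus S' := by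
  intro j
  rw [mem_paPlus, mem_paPlus]
  rintro (hj | ⟨i, hi, hd⟩)
  · exact Or.inl (h hj)
  · exact Or.inr ⟨i, h hi, hd⟩

theorem card_paPlus_le (S : Finset (Fin n)) : (G.paPlus S).card ≤ S.card * (G.inDegree + 1) := by
  have h1 : (S.biUnion G.parents).card ≤ S.card * G.inDegree :=
    Finset.card_biUnion_le_card_mul _ _ _ fun i _ =>
      Finset.le_sup (f := fun i => (G.parents i).card) (Finset.mem_univ i)
  have h2 := Finset.card_union_le S (S.biUnion G.parents)
  rw [paPlus, mul_add, mul_one]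
  omega

theorem card_cComp_le (i : Fin n) : (G.cComp i).card ≤ G.maxCComp :=
  Finset.le_sup (f := fun i => (G.cComp i).card) (Finset.mem_univ i)

/-- A topological numbering of the vertices. -/
def rank (i : Fin n) : ℕ :=
  (Finset.univ.filter fun j => Relation.TransGen G.dir j i).card * n + i

theorem rank_injective : Function.Injective G.rank := by
  intro i j h
  have h' := congrArg (· % n) h
  simp only [rank, Nat.mul_add_mod_self_right, Nat.mod_eq_of_lt i.2, Nat.mod_eq_of_lt j.2] at h'
  exact Fin.ext h'

/-- A child has all ancestors of its parent and, by acyclicity, at least one more, namely the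
parent. The index i < n added in `rank` only breaks ties. -/
theorem rank_lt {i j : Fin n} (h : G.dir i j) : G.rank i < G.rank j := by
  have hlt : (Finset.univ.filter fun k => Relation.TransGen G.dir k i).card
      < (Finset.univ.filter fun k => Relation.TransGen G.dir k j).card := by
    refine Finset.card_lt_card ⟨?_, ?_⟩
    · intro k
      simp only [Finset.mem_filter, Finset.mem_univ, true_and]
      exact fun hk => hk.tail h
    · intro hsub
      have : i ∈ Finset.univ.filter fun k => Relation.TransGen G.dir k i :=
        hsub (by simpa using Relation.TransGen.single h)
      exact G.acyclic i (by simpa using this)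
  have h1 := Nat.mul_le_mul_right n (Nat.succ_le_of_lt hlt)
  have h2 := i.2
  simp only [rank]
  rw [Nat.succ_mul] at h1
  omega

/-- The members of the c-component of `i` that come before `i`. -/
def before (i : Fin n) : Finset (Fin n) := (G.cComp i).filter fun j => G.rank j < G.rank i

/-- `i` and the variables its conditional distribution depends on. -/
def scope (i : Fin n) : Finset (Fin n) := G.paPlus (insert i (G.before i))

/-- The variables on which the conditional distribution of `i` depends. -/
def context (i : Fin n) : Finset (Fin n) := (G.scope i).erase i

theorem self_mem_scope (i : Fin n) : i ∈ G.scope i :=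
  G.mem_paPlus.2 (Or.inl (Finset.mem_insert_self _ _))

theorem insert_before_subset (i : Fin n) : insert i (G.before i) ⊆ G.cComp i :=
  Finset.insert_subset (G.self_mem_cComp i) (Finset.filter_subset _ _)

theorem rank_le_of_mem_scope {i j : Fin n} (h : j ∈ G.scope i) : G.rank j ≤ G.rank i := by
  have h1 : ∀ k ∈ insert i (G.before i), G.rank k ≤ G.rank i := by
    intro k hk
    rcases Finset.mem_insert.1 hk with rfl | hk
    · exact le_rfl
    · exact (Finset.mem_filter.1 hk).2.le
  rcases G.mem_paPlus.1 h with h | ⟨k, hk, hd⟩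
  · exact h1 j h
  · exact (G.rank_lt hd).le.trans (h1 k hk)

theorem rank_lt_of_mem_paPlus_before {i j : Fin n} (h : j ∈ G.paPlus (G.before i)) :
    G.rank j < G.rank i := by
  rcases G.mem_paPlus.1 h with h | ⟨k, hk, hd⟩
  · exact (Finset.mem_filter.1 h).2
  · exact (G.rank_lt hd).trans (Finset.mem_filter.1 hk).2

theorem rank_lt_of_mem_context {i j : Fin n} (h : j ∈ G.context i) : G.rank j < G.rank i := by
  obtain ⟨h1, h2⟩ := Finset.mem_erase.1 h
  exact lt_of_le_of_ne (G.rank_le_of_mem_scope h2) fun he => h1 (G.rank_injective he)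

theorem card_scope_le (i : Fin n) :
    (G.scope i).card ≤ G.maxCComp * G.inDegree + G.maxCComp := by
  refine (G.card_paPlus_le _).trans ?_
  have h := (Finset.card_le_card (G.insert_before_subset i)).trans (G.card_cComp_le i)
  calc _ ≤ G.maxCComp * (G.inDegree + 1) := Nat.mul_le_mul_right _ h
    _ = _ := by ring

theorem card_context_add_one (i : Fin n) : (G.context i).card + 1 = (G.scope i).card :=
  Finset.card_erase_add_one (G.self_mem_scope i)

theorem scope_subset (i : Fin n) : G.scope i ⊆ G.paPlus (G.cComp i) :=
  G.paPlus_mono (G.insert_before_subset i)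

theorem cComp_eq_of_mem {i j : Fin n} (h : j ∈ G.cComp i) : G.cComp j = G.cComp i := by
  ext k
  rw [mem_cComp, mem_cComp]
  rw [mem_cComp] at h
  exact ⟨fun hk => h.trans hk, fun hk => h.symm.trans hk⟩

end ADMG

/-! ### Factors of a causal Bayes net -/

namespace CBN

variable {n : ℕ} {G : ADMG n} {s : ℕ} (M : CBN G s)

/-- The factor of the set `A` of variables: `∑_u ∏_e P(u_e) ∏_{i ∈ A} P(v_i ∣ pa_i, u)`. -/
def setFactor (A : Finset (Fin n)) (v : Fin n → Fin s) : ℝ :=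
  ∑ u : (∀ e, M.U e), (∏ e, (M.hid e (u e)).toReal) * ∏ i ∈ A, (M.factor u i v).toReal

theorem factor_ne_top (u : ∀ e, M.U e) (i : Fin n) (v : Fin n → Fin s) : M.factor u i v ≠ ⊤ :=
  PMF.apply_ne_top _ _

theorem factor_le_one (u : ∀ e, M.U e) (i : Fin n) (v : Fin n → Fin s) :
    (M.factor u i v).toReal ≤ 1 := by
  have := ENNReal.toReal_mono ENNReal.one_ne_top
    (PMF.coe_le_one (M.cpd i (fun j => v j) fun e => u e.1) (v i))
  rwa [ENNReal.toReal_one] at this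

theorem setFactor_nonneg (A : Finset (Fin n)) (v : Fin n → Fin s) : 0 ≤ M.setFactor A v :=
  Finset.sum_nonneg fun _ _ => mul_nonneg (Finset.prod_nonneg fun _ _ => ENNReal.toReal_nonneg)
    (Finset.prod_nonneg fun _ _ => ENNReal.toReal_nonneg)

theorem setFactor_empty (v : Fin n → Fin s) : M.setFactor ∅ v = 1 := by
  simp only [setFactor, Finset.prod_empty, mul_one]
  rw [← Fintype.prod_sum fun e (a : M.U e) => (M.hid e a).toReal]
  exact Finset.prod_eq_one fun e _ => sum_toReal _

theorem setFactor_anti {A B : Finset (Fin n)} (h : A ⊆ B) (v : Fin n → Fin s) :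
    M.setFactor B v ≤ M.setFactor A v := by
  refine Finset.sum_le_sum fun u _ => mul_le_mul_of_nonneg_left ?_
    (Finset.prod_nonneg fun _ _ => ENNReal.toReal_nonneg)
  rw [← Finset.prod_sdiff h]
  exact mul_le_of_le_one_left (Finset.prod_nonneg fun _ _ => ENNReal.toReal_nonneg)
    (Finset.prod_le_one (fun _ _ => ENNReal.toReal_nonneg) fun i _ => M.factor_le_one u i v)

theorem setFactor_le_one (A : Finset (Fin n)) (v : Fin n → Fin s) : M.setFactor A v ≤ 1 :=
  (M.setFactor_anti (Finset.empty_subset A) v).trans (M.setFactor_empty v).le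

theorem factor_congr (u : ∀ e, M.U e) (i : Fin n) {v w : Fin n → Fin s}
    (h : ∀ j, j = i ∨ G.dir j i → v j = w j) : M.factor u i v = M.factor u i w := by
  unfold factor
  have : (fun j : {j // G.dir j i} => v j) = fun j : {j // G.dir j i} => w j :=
    funext fun j => h j (Or.inr j.2)
  rw [this, h i (Or.inl rfl)]

theorem dependsOn_setFactor (A : Finset (Fin n)) :
    DependsOn (M.setFactor A) (G.paPlus A : Set (Fin n)) := by
  intro v w h
  refine Finset.sum_congr rfl fun u _ => ?_
  congr 1
  refine Finset.prod_congr rfl fun i hi => ?_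
  rw [M.factor_congr u i]
  rintro j (rfl | hj)
  · exact h _ (G.mem_paPlus.2 (Or.inl hi))
  · exact h _ (G.mem_paPlus.2 (Or.inr ⟨i, hi, hj⟩))

/-- Without children of i in `A`, the value of i enters only its own factor, whose sum is 1 for
every value of the hidden variables. -/
theorem sum_setFactor_update (A : Finset (Fin n)) {i : Fin n} (hi : i ∈ A)
    (hch : ∀ j ∈ A, ¬ G.dir i j) (v : Fin n → Fin s) :
    ∑ a, M.setFactor A (Function.update v i a) = M.setFactor (A.erase i) v := by
  unfold setFactor
  rw [Finset.sum_comm]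
  refine Finset.sum_congr rfl fun u _ => ?_
  rw [← Finset.mul_sum]
  congr 1
  have h1 : ∀ a, ∏ j ∈ A, (M.factor u j (Function.update v i a)).toReal
      = (M.cpd i (fun j => v j) (fun e => u e.1) a).toReal
        * ∏ j ∈ A.erase i, (M.factor u j v).toReal := by
    intro a
    rw [← Finset.mul_prod_erase A _ hi]
    congr 1
    · unfold factor
      have : (fun j : {j // G.dir j i} => Function.update v i a j)
          = fun j : {j // G.dir j i} => v j := by
        funext j
        refine Function.update_of_ne ?_ _ _
        intro h
        have hj := j.2
        rw [h] at hj
        exact hch i hi hj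
      rw [this, Function.update_self]
    · refine Finset.prod_congr rfl fun j hj => ?_
      rw [M.factor_congr u j]
      rintro k (rfl | hk)
      · exact Function.update_of_ne (Finset.ne_of_mem_erase hj) _ _
      · refine Function.update_of_ne ?_ _ _
        rintro rfl
        exact hch j (Finset.mem_of_mem_erase hj) hk
  simp_rw [h1]
  rw [← Finset.sum_mul, sum_toReal, one_mul]

/-- A hidden variable sits on one bidirected edge. If it entered factors of both `A` and `B`, its
edge would join the two sets. The two products therefore depend on disjoint groups of independent
variables. -/
theorem setFactor_union (A B : Finset (Fin n)) (hd : Disjoint A B)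
    (h : ∀ a ∈ A, ∀ b ∈ B, ¬ G.bi.Adj a b) (v : Fin n → Fin s) :
    M.setFactor (A ∪ B) v = M.setFactor A v * M.setFactor B v := by
  unfold setFactor
  simp_rw [Finset.prod_union hd]
  refine sum_prod_mul_of_dependsOn (fun e a => (M.hid e a).toReal) (fun e => sum_toReal _)
    {e | ∃ a ∈ A, a ∈ (e : Sym2 (Fin n))} _ _ ?_ ?_
  · intro u u' hu
    refine Finset.prod_congr rfl fun i hi => ?_
    unfold factor
    have : (fun e : {e : G.bi.edgeSet // i ∈ (e : Sym2 (Fin n))} => u e.1)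
        = fun e : {e : G.bi.edgeSet // i ∈ (e : Sym2 (Fin n))} => u' e.1 := funext fun e => hu e.1 ⟨i, hi, e.2⟩
    rw [this]
  · intro u u' hu
    refine Finset.prod_congr rfl fun i hi => ?_
    unfold factor
    have : (fun e : {e : G.bi.edgeSet // i ∈ (e : Sym2 (Fin n))} => u e.1)
        = fun e : {e : G.bi.edgeSet // i ∈ (e : Sym2 (Fin n))} => u' e.1 := by
      refine funext fun e => hu e.1 ?_
      rintro ⟨a, ha, hae⟩
      have hne : a ≠ i := fun he => Finset.disjoint_left.1 hd ha (he ▸ hi)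
      have he := (Sym2.mem_and_mem_iff hne).1 ⟨hae, e.2⟩
      have hedge := e.1.2
      rw [he, SimpleGraph.mem_edgeSet] at hedge
      exact h a ha i hi hedge
    rw [this]

theorem obs_toReal [NeZero s] (v : Fin n → Fin s) :
    (M.obs v).toReal = M.setFactor Finset.univ v := by
  rw [obs, PMF.ofFintype_apply, weight, ENNReal.toReal_sum]
  · simp [setFactor, ENNReal.toReal_mul, ENNReal.toReal_prod]
  · intro u _
    refine ENNReal.mul_ne_top (ENNReal.prod_ne_top fun e _ => PMF.apply_ne_top _ _)
      (ENNReal.prod_ne_top fun i _ => M.factor_ne_top u i v)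

theorem interv_toReal [NeZero s] (X : Fin n) (x : Fin s) (v : Fin n → Fin s) :
    (M.interv X x v).toReal = if v X = x then M.setFactor (Finset.univ.erase X) v else 0 := by
  rw [interv, obs_toReal]
  have h1 : ∀ (u : ∀ e, M.U e) (i : Fin n), i ≠ X →
      (M.intervene X x).factor u i v = M.factor u i v := by
    intro u i hi
    simp [factor, intervene, hi]
  have h2 : ∀ u : ∀ e, M.U e,
      ((M.intervene X x).factor u X v).toReal = if v X = x then 1 else 0 := by
    intro u
    simp only [factor, intervene, if_true, PMF.pure_apply]
    split_ifs <;> simp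
  have h3 : ∀ u : ∀ e, M.U e, ∏ i, ((M.intervene X x).factor u i v).toReal
      = (if v X = x then 1 else 0) * ∏ i ∈ Finset.univ.erase X, (M.factor u i v).toReal := by
    intro u
    rw [← Finset.mul_prod_erase _ _ (Finset.mem_univ X), h2]
    congr 1
    exact Finset.prod_congr rfl fun i hi => by rw [h1 u i (Finset.ne_of_mem_erase hi)]
  change ∑ u : (∀ e, M.U e), (∏ e, (M.hid e (u e)).toReal)
    * ∏ i, ((M.intervene X x).factor u i v).toReal = _
  simp_rw [h3]
  split_ifs <;> simp [setFactor]

/-! ### Conditional distributions -/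

/-- The conditional probability of `v i` given the earlier variables. -/
def cond (i : Fin n) (v : Fin n → Fin s) : ℝ :=
  -- The uniform default makes this a probability distribution in v i for every past, also one of
  -- probability zero.
  if M.setFactor (G.before i) v = 0 then 1 / s
  else M.setFactor (insert i (G.before i)) v / M.setFactor (G.before i) v

theorem cond_nonneg (i : Fin n) (v : Fin n → Fin s) : 0 ≤ M.cond i v := by
  unfold cond
  split_ifs
  · positivity
  · exact div_nonneg (M.setFactor_nonneg _ _) (M.setFactor_nonneg _ _)

/-- True in the default case too: `setFactor` decreases when the set grows, so the numerator
vanishes with the denominator. -/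
theorem cond_mul (i : Fin n) (v : Fin n → Fin s) :
    M.cond i v * M.setFactor (G.before i) v = M.setFactor (insert i (G.before i)) v := by
  unfold cond
  split_ifs with h
  · rw [h, mul_zero]
    exact le_antisymm (M.setFactor_nonneg _ _)
      ((M.setFactor_anti (Finset.subset_insert i _) v).trans h.le)
  · exact div_mul_cancel₀ _ h

theorem dependsOn_cond (i : Fin n) : DependsOn (M.cond i) (G.scope i : Set (Fin n)) := by
  intro v w h
  have h1 := M.dependsOn_setFactor (insert i (G.before i)) h
  have h2 := M.dependsOn_setFactor (G.before i)
    (fun j hj => h j (G.paPlus_mono (Finset.subset_insert i _) hj))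
  unfold cond
  rw [h1, h2]

theorem not_mem_before (i : Fin n) : i ∉ G.before i := by simp [ADMG.before]

/-- The children of i have larger rank, so none lies among i and its predecessors in the
c-component, and summing over the value of i turns the numerator into the denominator. -/
theorem isChain_cond [NeZero s] : IsChain G.rank M.cond := by
  refine ⟨fun i => (M.dependsOn_cond i).mono fun j hj => G.rank_le_of_mem_scope hj, ?_⟩
  intro i v
  have h1 : ∀ a, M.setFactor (G.before i) (Function.update v i a) = M.setFactor (G.before i) v :=
    fun a => dependsOn_update (M.dependsOn_setFactor _)
      (fun h => lt_irrefl _ (G.rank_lt_of_mem_paPlus_before h)) v a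
  unfold cond
  simp_rw [h1]
  split_ifs with h
  · have : (s : ℝ) ≠ 0 := by exact_mod_cast NeZero.ne s
    simp [this]
  · rw [← Finset.sum_div, M.sum_setFactor_update _ (Finset.mem_insert_self _ _),
      Finset.erase_insert (not_mem_before i), div_self h]
    intro j hj hd
    have := G.rank_le_of_mem_scope (G.mem_paPlus.2 (Or.inl hj))
    exact absurd (G.rank_lt hd) (not_lt.2 this)

/-- The factor of a union of c-components is the product of the conditional probabilities. -/
theorem prod_cond (A : Finset (Fin n)) (hA : ∀ i ∈ A, G.cComp i ⊆ A) (v : Fin n → Fin s) :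
    ∏ i ∈ A, M.cond i v = M.setFactor A v := by
  -- Induction over initial segments of the order. When i is added, the segment consists of `before
  -- i` and a rest `R` outside the c-component of i. The factor of `R` splits off both with and
  -- without i, so `cond i` is the only change.
  have key : ∀ t : ℕ, ∏ i ∈ A.filter (fun i => G.rank i < t), M.cond i v
      = M.setFactor (A.filter fun i => G.rank i < t) v := by
    intro t
    induction t with
    | zero => simp [M.setFactor_empty]
    | succ t ih =>
      by_cases hex : ∃ i ∈ A, G.rank i = t
      · obtain ⟨i, hi, hit⟩ := hex
        have e1 : A.filter (fun j => G.rank j < t + 1)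
            = insert i (A.filter fun j => G.rank j < t) := by
          ext j
          simp only [Finset.mem_filter, Finset.mem_insert]
          constructor
          · rintro ⟨h1, h2⟩
            rcases Nat.lt_succ_iff_lt_or_eq.1 h2 with h | h
            · exact Or.inr ⟨h1, h⟩
            · exact Or.inl (G.rank_injective (h.trans hit.symm))
          · rintro (rfl | ⟨h1, h2⟩)
            · exact ⟨hi, by omega⟩
            · exact ⟨h1, by omega⟩
        set R := (A.filter fun j => G.rank j < t) \ G.cComp i with hR
        have e2 : A.filter (fun j => G.rank j < t) = G.before i ∪ R := by
          ext j
          simp only [hR, ADMG.before, hit, Finset.mem_filter, Finset.mem_union, Finset.mem_sdiff]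
          constructor
          · intro h
            by_cases hj : j ∈ G.cComp i
            · exact Or.inl ⟨hj, h.2⟩
            · exact Or.inr ⟨h, hj⟩
          · rintro (⟨h1, h2⟩ | ⟨h, -⟩)
            · exact ⟨hA i hi h1, h2⟩
            · exact h
        have hsep : ∀ a ∈ insert i (G.before i), a ∈ G.cComp i :=
          fun a ha => G.insert_before_subset i ha
        have hRn : ∀ b ∈ R, b ∉ G.cComp i := fun b hb => (Finset.mem_sdiff.1 hb).2
        have hadj : ∀ a ∈ insert i (G.before i), ∀ b ∈ R, ¬ G.bi.Adj a b :=
          fun a ha b hb hab => hRn b hb (G.mem_cComp_of_adj (hsep a ha) hab)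
        have hdis : Disjoint (insert i (G.before i)) R :=
          Finset.disjoint_left.2 fun a ha hb => hRn a hb (hsep a ha)
        have e3 : insert i (A.filter fun j => G.rank j < t) = insert i (G.before i) ∪ R := by
          rw [e2, Finset.insert_union]
        have hni : i ∉ A.filter fun j => G.rank j < t := by simp [hit]
        rw [e1, Finset.prod_insert hni, ih, e3, M.setFactor_union _ _ hdis hadj, e2,
          M.setFactor_union _ _ (hdis.mono_left (Finset.subset_insert _ _))
            (fun a ha => hadj a (Finset.mem_insert_of_mem ha)), ← mul_assoc, M.cond_mul]
      · have e1 : A.filter (fun j => G.rank j < t + 1) = A.filter fun j => G.rank j < t := by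
          refine Finset.filter_congr fun j hj => ?_
          have : G.rank j ≠ t := fun h => hex ⟨j, hj, h⟩
          omega
        rw [e1, ih]
  have hall : A.filter (fun i => G.rank i < (Finset.univ.sup G.rank) + 1) = A := by
    refine Finset.filter_true_of_mem fun i _ => ?_
    exact Nat.lt_succ_of_le (Finset.le_sup (Finset.mem_univ i))
  have := key ((Finset.univ.sup G.rank) + 1)
  rwa [hall] at this

theorem obs_eq_prod_cond [NeZero s] (v : Fin n → Fin s) :
    (M.obs v).toReal = ∏ i, M.cond i v := by
  rw [M.obs_toReal, M.prod_cond _ fun i _ => Finset.subset_univ _]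

/-- `cond` is the conditional probability given the context. -/
theorem prob_cyl_scope [NeZero s] (i : Fin n) (v : Fin n → Fin s) :
    prob M.obs (cyl (G.scope i) v) = M.cond i v * prob M.obs (cyl (G.context i) v) := by
  have h1 : ∀ D : Finset (Fin n), prob M.obs (cyl D v)
      = ∑ w, (∏ j, M.cond j w) * if w ∈ cyl D v then 1 else 0 := by
    intro D
    refine Finset.sum_congr rfl fun w _ => ?_
    rw [← M.obs_eq_prod_cond]
    split_ifs <;> simp
  -- The tower property for the indicator of the scope cylinder: in the inner sum only the value v i
  -- of variable i survives.
  rw [h1, h1, M.isChain_cond.sum_mul_eq G.rank_injective i, Finset.mul_sum]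
  · refine Finset.sum_congr rfl fun w _ => ?_
    rw [mul_left_comm]
    congr 1
    have hmem : ∀ a, Function.update w i a ∈ cyl (G.scope i) v
        ↔ a = v i ∧ w ∈ cyl (G.context i) v := by
      intro a
      constructor
      · intro h
        refine ⟨by simpa using h i (G.self_mem_scope i), fun j hj => ?_⟩
        obtain ⟨h1, h2⟩ := Finset.mem_erase.1 hj
        have := h j h2
        rwa [Function.update_of_ne h1] at this
      · rintro ⟨rfl, h⟩ j hj
        by_cases hji : j = i
        · subst hji; simp
        · rw [Function.update_of_ne hji]
          exact h j (Finset.mem_erase.2 ⟨hji, hj⟩)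
    rw [Finset.sum_eq_single (v i)]
    · by_cases hw : w ∈ cyl (G.context i) v
      · have hin := (hmem (v i)).2 ⟨rfl, hw⟩
        rw [if_pos hin, if_pos hw, M.dependsOn_cond i (fun j hj => hin j hj)]
      · rw [if_neg (fun h => hw ((hmem _).1 h).2), if_neg hw, mul_zero, mul_zero]
    · intro a _ ha
      rw [if_neg (fun h => ha ((hmem _).1 h).1), mul_zero]
    · simp
  · intro w w' h
    have : w ∈ cyl (G.scope i) v ↔ w' ∈ cyl (G.scope i) v :=
      forall₂_congr fun j hj => by rw [h j (G.rank_le_of_mem_scope hj)]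
    simp only [this]

end CBN

/-! ### Distributions on finite types given by real weights -/

/-- The distribution with the given real weights. -/
def pmfOfReal {Ω : Type*} [Fintype Ω] (f : Ω → ℝ) (h0 : ∀ v, 0 ≤ f v) (h1 : ∑ v, f v = 1) :
    PMF Ω :=
  PMF.ofFintype (fun v => ENNReal.ofReal (f v)) <| by
    rw [← ENNReal.ofReal_sum_of_nonneg fun v _ => h0 v, h1, ENNReal.ofReal_one]

theorem pmfOfReal_toReal {Ω : Type*} [Fintype Ω] (f : Ω → ℝ) (h0 : ∀ v, 0 ≤ f v)
    (h1 : ∑ v, f v = 1) (v : Ω) : (pmfOfReal f h0 h1 v).toReal = f v := by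
  rw [pmfOfReal, PMF.ofFintype_apply, ENNReal.toReal_ofReal (h0 v)]

theorem pmf_ext_toReal {Ω : Type*} {p q : PMF Ω} (h : ∀ v, (p v).toReal = (q v).toReal) :
    p = q :=
  PMF.ext fun v => (ENNReal.toReal_eq_toReal_iff' (p.apply_ne_top v) (q.apply_ne_top v)).1 (h v)

theorem map_toReal {Ω Ω' : Type*} [Fintype Ω] [DecidableEq Ω'] (p : PMF Ω) (f : Ω → Ω') (w : Ω') :
    (p.map f w).toReal = ∑ v, if f v = w then (p v).toReal else 0 := by
  rw [PMF.map_apply, tsum_fintype, ENNReal.toReal_sum]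
  · refine Finset.sum_congr rfl fun v _ => ?_
    by_cases h : f v = w
    · rw [if_pos h, if_pos h.symm]
    · rw [if_neg h, if_neg (fun h' => h h'.symm), ENNReal.toReal_zero]
  · intro v _
    split_ifs
    · exact p.apply_ne_top v
    · exact ENNReal.zero_ne_top

theorem tvDist_map_le {Ω Ω' : Type*} [Fintype Ω] [Fintype Ω'] (p q : PMF Ω) (f : Ω → Ω') :
    tvDist (p.map f) (q.map f) ≤ tvDist p q := by
  unfold tvDist
  refine div_le_div_of_nonneg_right ?_ (by norm_num)
  calc ∑ w, |(p.map f w).toReal - (q.map f w).toReal|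
      ≤ ∑ w, ∑ v, if f v = w then |(p v).toReal - (q v).toReal| else 0 := by
        refine Finset.sum_le_sum fun w _ => ?_
        rw [map_toReal, map_toReal, ← Finset.sum_sub_distrib]
        refine (Finset.abs_sum_le_sum_abs _ _).trans (Finset.sum_le_sum fun v _ => ?_)
        split_ifs <;> simp
    _ = ∑ v, |(p v).toReal - (q v).toReal| := by
        rw [Finset.sum_comm]
        refine Finset.sum_congr rfl fun v _ => ?_
        simp

theorem tvDist_triangle {Ω : Type*} [Fintype Ω] (p q r : PMF Ω) :
    tvDist p r ≤ tvDist p q + tvDist q r := by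
  unfold tvDist
  rw [← add_div, ← Finset.sum_add_distrib]
  refine div_le_div_of_nonneg_right (Finset.sum_le_sum fun v _ => ?_) (by norm_num)
  exact abs_sub_le _ _ _

/-! ### The split distribution

Variables in the c-component of `X` see the natural value of `X`, all others see the value `x`. -/

theorem le_of_notMem_deviates {β : Type*} [Fintype β] {P : PMF β} {m : ℕ} {J : Finset (Fin m)}
    {l : ℝ} {A : Set β} {S : Fin m → β} (h : S ∉ deviates P J l A) :
    (countIn J A S - J.card * prob P A) ^ 2 ≤ 4 * l * (J.card * prob P A + l) :=
  not_lt.1 h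

namespace ADMG

variable {n : ℕ} (G : ADMG n) {s : ℕ} (X : Fin n) (x : Fin s)

/-- The assignment as seen by variable `i`: outside of the c-component of `X`, the value of `X` is
replaced by `x`. -/
def twist (i : Fin n) (v : Fin n → Fin s) : Fin n → Fin s :=
  if i ∈ G.cComp X then v else Function.update v X x

theorem twist_update (i : Fin n) (v : Fin n → Fin s) (a : Fin s) :
    G.twist X x i (Function.update v i a) = Function.update (G.twist X x i v) i a := by
  unfold twist
  split_ifs with h
  · rfl
  · rw [Function.update_comm]
    rintro rfl
    exact h (G.self_mem_cComp _)

theorem twist_congr (i : Fin n) {v w : Fin n → Fin s} {D : Set (Fin n)}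
    (h : ∀ j ∈ D, v j = w j) : ∀ j ∈ D, G.twist X x i v j = G.twist X x i w j := by
  intro j hj
  unfold twist
  split_ifs
  · exact h j hj
  · by_cases hjX : j = X
    · subst hjX; simp
    · rw [Function.update_of_ne hjX, Function.update_of_ne hjX, h j hj]

theorem isChain_twist {r : Fin n → (Fin n → Fin s) → ℝ} (hr : IsChain G.rank r) :
    IsChain G.rank fun i v => r i (G.twist X x i v) := by
  refine ⟨fun i v w h => hr.dep i (G.twist_congr X x i h), fun i v => ?_⟩
  simp_rw [twist_update]
  exact hr.sum_one i _

theorem chiSq_twist (r r' : Fin n → (Fin n → Fin s) → ℝ) (i : Fin n) (v : Fin n → Fin s) :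
    chiSq (fun i v => r i (G.twist X x i v)) (fun i v => r' i (G.twist X x i v)) i v
      = chiSq r r' i (G.twist X x i v) := by
  simp only [chiSq, twist_update]

theorem cComp_compl_closed (i : Fin n) (hi : i ∈ (G.cComp X)ᶜ) : G.cComp i ⊆ (G.cComp X)ᶜ := by
  intro j hj
  rw [Finset.mem_compl] at *
  intro h
  apply hi
  rw [← G.cComp_eq_of_mem h]
  exact G.cComp_comm.1 hj

end ADMG

namespace CBN

variable {n : ℕ} {G : ADMG n} {s : ℕ} (M : CBN G s) (X : Fin n) (x : Fin s)

/-- The weights of the split distribution. -/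
def splitLaw (v : Fin n → Fin s) : ℝ := ∏ i, M.cond i (G.twist X x i v)

/-- Both S and its complement are unions of c-components, so the conditionals on each side multiply
to one factor. All of S sees v, all of Sᶜ sees v with X set to x. -/
theorem splitLaw_eq (v : Fin n → Fin s) :
    M.splitLaw X x v = M.setFactor (G.cComp X) v
      * M.setFactor (G.cComp X)ᶜ (Function.update v X x) := by
  rw [splitLaw, ← Finset.prod_mul_prod_compl (G.cComp X),
    ← M.prod_cond (G.cComp X) (fun i hi => (G.cComp_eq_of_mem hi).subset),
    ← M.prod_cond (G.cComp X)ᶜ (G.cComp_compl_closed X)]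
  congr 1
  · refine Finset.prod_congr rfl fun i hi => ?_
    rw [ADMG.twist, if_pos hi]
  · refine Finset.prod_congr rfl fun i hi => ?_
    rw [ADMG.twist, if_neg (Finset.mem_compl.1 hi)]

theorem splitLaw_nonneg (v : Fin n → Fin s) : 0 ≤ M.splitLaw X x v :=
  Finset.prod_nonneg fun i _ => M.cond_nonneg i _

theorem setFactor_split (A : Finset (Fin n)) (hA : A ⊆ G.cComp X) (v : Fin n → Fin s) :
    M.setFactor (A ∪ (G.cComp X)ᶜ) v = M.setFactor A v * M.setFactor (G.cComp X)ᶜ v := by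
  refine M.setFactor_union _ _ ?_ ?_ v
  · exact Finset.disjoint_left.2 fun a ha hb => Finset.mem_compl.1 hb (hA ha)
  · exact fun a ha b hb hab => Finset.mem_compl.1 hb (G.mem_cComp_of_adj (hA ha) hab)

theorem sum_filter_update (g : (Fin n → Fin s) → ℝ) (w : Fin n → Fin s) (hw : w X = x) :
    (∑ v, if Function.update v X x = w then g v else 0) = ∑ a, g (Function.update w X a) := by
  rw [← Finset.sum_filter]
  refine Finset.sum_nbij' (fun v => v X) (fun a => Function.update w X a) ?_ ?_ ?_ ?_ ?_
  · simp
  · intro a _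
    simp [← hw]
  · intro v hv
    have : Function.update v X x = w := by simpa using hv
    rw [← this]; simp
  · simp
  · intro v hv
    have : Function.update v X x = w := by simpa using hv
    rw [← this]; simp

theorem marginal_toReal (P : PMF (Fin n → Fin s)) (D : Finset (Fin n)) (v : Fin n → Fin s) :
    (marginal P D fun j => v j).toReal = prob P (cyl D v) := by
  rw [marginal, map_toReal, prob]
  refine Finset.sum_congr rfl fun w _ => ?_
  refine if_congr ?_ rfl rfl
  constructor
  · intro h j hj; exact congrFun h ⟨j, hj⟩
  · intro h; funext j; exact h j j.2

/-! ### The interventional distribution as an image of the split distribution -/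

variable [NeZero s]

theorem sum_splitLaw : ∑ v, M.splitLaw X x v = 1 :=
  (G.isChain_twist X x M.isChain_cond).sum_prod G.rank_injective

theorem obs_split (v : Fin n → Fin s) :
    (M.obs v).toReal = M.setFactor (G.cComp X) v * M.setFactor (G.cComp X)ᶜ v := by
  rw [M.obs_toReal, ← M.setFactor_split X _ subset_rfl, Finset.union_compl]

theorem interv_split (v : Fin n → Fin s) :
    (M.interv X x v).toReal = if v X = x then
      M.setFactor ((G.cComp X).erase X) v * M.setFactor (G.cComp X)ᶜ v else 0 := by
  have : Finset.univ.erase X = (G.cComp X).erase X ∪ (G.cComp X)ᶜ := by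
    ext j
    have := G.self_mem_cComp X
    simp only [Finset.mem_erase, Finset.mem_univ, and_true, Finset.mem_union, Finset.mem_compl]
    constructor
    · intro h
      by_cases hj : j ∈ G.cComp X
      · exact Or.inl ⟨h, hj⟩
      · exact Or.inr hj
    · rintro (h | h)
      · exact h.1
      · rintro rfl; exact h this
  rw [M.interv_toReal, this, M.setFactor_split X _ (Finset.erase_subset _ _)]

/-- The split distribution. -/
def splitPMF : PMF (Fin n → Fin s) :=
  pmfOfReal (M.splitLaw X x) (M.splitLaw_nonneg X x) (M.sum_splitLaw X x)

/-- Overwriting X sums the split law over the natural value of X. The factor of Sᶜ does not see this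
value, and since X has no child in S the sum turns Q[S] into Q[S \ X]. -/
theorem interv_eq_map (hid : G.Identifiable X) :
    M.interv X x = (M.splitPMF X x).map fun v => Function.update v X x := by
  refine pmf_ext_toReal fun w => ?_
  rw [map_toReal, M.interv_split]
  simp only [splitPMF, pmfOfReal_toReal]
  split_ifs with hw
  · rw [sum_filter_update X x _ w hw]
    simp_rw [M.splitLaw_eq]
    simp only [Function.update_idem]
    rw [← Finset.sum_mul, M.sum_setFactor_update _ (G.self_mem_cComp X)]
    · congr 1
      rw [← hw, Function.update_eq_self]
    · exact fun j hj hd => hid j hd hj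
  · refine (Finset.sum_eq_zero fun v _ => if_neg ?_).symm
    rintro rfl
    simp at hw

theorem StronglyPositive.lt_prob {M : CBN G s} {X : Fin n} {α : ℝ}
    (h : M.StronglyPositive X α) (v : Fin n → Fin s) :
    α < prob M.obs (cyl (G.paPlus (G.cComp X)) v) := by
  rw [← marginal_toReal]; exact h _

/-- Summing the factor of the complement of a c-component over its own variables gives `1`. -/
theorem sum_setFactor_compl (w : Fin n → Fin s) :
    (∑ v, if v ∈ cyl (G.cComp X) w then M.setFactor (G.cComp X)ᶜ v else 0) = 1 := by
  -- Point masses at w i on the c-component, together with the true conditionals outside, form a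
  -- chain. Its total mass 1 is the sum in question.
  have hchain : IsChain G.rank fun i (v : Fin n → Fin s) =>
      if i ∈ G.cComp X then (if v i = w i then 1 else 0) else M.cond i v := by
    refine ⟨fun i v v' h => ?_, fun i v => ?_⟩
    · rw [h i (show G.rank i ≤ G.rank i from le_rfl), M.isChain_cond.dep i h]
    · split_ifs
      · simp
      · exact M.isChain_cond.sum_one i v
  rw [← hchain.sum_prod G.rank_injective]
  refine Finset.sum_congr rfl fun v _ => ?_
  rw [← Finset.prod_mul_prod_compl (G.cComp X)]
  have h2 : ∏ i ∈ (G.cComp X)ᶜ, (if i ∈ G.cComp X then (if v i = w i then (1 : ℝ) else 0)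
      else M.cond i v) = M.setFactor (G.cComp X)ᶜ v := by
    rw [← M.prod_cond (G.cComp X)ᶜ (G.cComp_compl_closed X)]
    exact Finset.prod_congr rfl fun i hi => if_neg (Finset.mem_compl.1 hi)
  rw [h2]
  by_cases hv : v ∈ cyl (G.cComp X) w
  · rw [if_pos hv, Finset.prod_eq_one, one_mul]
    intro i hi
    rw [if_pos hi, if_pos (hv i hi)]
  · rw [if_neg hv]
    have : ∃ i ∈ G.cComp X, v i ≠ w i := by
      by_contra hcon
      push Not at hcon
      exact hv hcon
    obtain ⟨i, hi, hne⟩ := this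
    rw [Finset.prod_eq_zero hi, zero_mul]
    rw [if_pos hi, if_neg hne]

/-- On the cylinder over Pa⁺(S) the factor Q[S] is constant, and the remaining factor Q[Sᶜ] sums to
at most 1. The cylinder, of probability more than α, is therefore no larger than Q[S]. -/
theorem StronglyPositive.lt_setFactor {M : CBN G s} {X : Fin n} {α : ℝ}
    (h : M.StronglyPositive X α) (w : Fin n → Fin s) : α < M.setFactor (G.cComp X) w := by
  refine (h.lt_prob w).trans_le ?_
  calc prob M.obs (cyl (G.paPlus (G.cComp X)) w)
      ≤ ∑ v, M.setFactor (G.cComp X) w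
          * (if v ∈ cyl (G.cComp X) w then M.setFactor (G.cComp X)ᶜ v else 0) := by
        refine Finset.sum_le_sum fun v _ => ?_
        by_cases hv : v ∈ cyl (G.paPlus (G.cComp X)) w
        · have hv' : v ∈ cyl (G.cComp X) w := fun j hj => hv j (G.mem_paPlus.2 (Or.inl hj))
          rw [if_pos hv, if_pos hv', M.obs_split X,
            M.dependsOn_setFactor _ (fun j hj => hv j hj)]
        · rw [if_neg hv]
          refine mul_nonneg (M.setFactor_nonneg _ _) ?_
          split_ifs
          · exact M.setFactor_nonneg _ _
          · exact le_rfl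
    _ = _ := by rw [← Finset.mul_sum, M.sum_setFactor_compl, mul_one]

/-- Under the split distribution, the context of every variable is at most `ρ` times as likely as
under the observational distribution. -/
def Dominated (ρ : ℝ) : Prop :=
  ∀ (i : Fin n) (g : (Fin n → Fin s) → ℝ), (∀ v, 0 ≤ g v) →
    DependsOn g (G.context i : Set (Fin n)) →
    ∑ v, M.splitLaw X x v * g (G.twist X x i v) ≤ ρ * ∑ v, (M.obs v).toReal * g v

/-- For i in S, the context lies in Pa⁺(S), where every assignment has P-probability above α, so
even the maximum of `g` is at most 1/α times its mean. For i outside S, the context is seen under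
P_x, and P_x ≤ Q[Sᶜ] ≤ Q[S] Q[Sᶜ] / α = P / α pointwise. -/
theorem dominated_of_stronglyPositive (hid : G.Identifiable X) {α : ℝ} (hα : 0 < α)
    (hpos : M.StronglyPositive X α) : M.Dominated X x α⁻¹ := by
  intro i g hg hdep
  by_cases hi : i ∈ G.cComp X
  · have hsub : (G.context i : Set (Fin n)) ⊆ G.paPlus (G.cComp X) := by
      intro j hj
      have := G.scope_subset i (Finset.mem_of_mem_erase hj)
      rwa [G.cComp_eq_of_mem hi] at this
    have key : ∀ v, g v ≤ α⁻¹ * ∑ v, (M.obs v).toReal * g v := by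
      intro v
      rw [← mul_le_mul_iff_right₀ hα, ← mul_assoc, mul_inv_cancel₀ hα.ne', one_mul]
      calc α * g v ≤ prob M.obs (cyl (G.paPlus (G.cComp X)) v) * g v :=
            mul_le_mul_of_nonneg_right (hpos.lt_prob v).le (hg v)
        _ ≤ _ := by
            rw [prob, Finset.sum_mul]
            refine Finset.sum_le_sum fun w _ => ?_
            split_ifs with hw
            · rw [hdep (fun j hj => hw j (hsub hj))]
            · rw [zero_mul]; exact mul_nonneg ENNReal.toReal_nonneg (hg w)
    calc ∑ v, M.splitLaw X x v * g (G.twist X x i v)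
        ≤ ∑ v, M.splitLaw X x v * (α⁻¹ * ∑ v, (M.obs v).toReal * g v) :=
          Finset.sum_le_sum fun v _ => mul_le_mul_of_nonneg_left (key _) (M.splitLaw_nonneg X x v)
      _ = _ := by rw [← Finset.sum_mul, M.sum_splitLaw, one_mul]
  · have h1 : ∑ v, M.splitLaw X x v * g (G.twist X x i v)
        = ∑ w, (M.interv X x w).toReal * g w := by
      rw [M.interv_eq_map X x hid]
      simp_rw [map_toReal, Finset.sum_mul]
      rw [Finset.sum_comm]
      refine Finset.sum_congr rfl fun v _ => ?_
      simp only [ite_mul, zero_mul]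
      rw [Finset.sum_ite_eq]
      simp [ADMG.twist, hi, splitPMF, pmfOfReal_toReal]
    rw [h1, Finset.mul_sum]
    refine Finset.sum_le_sum fun w _ => ?_
    rw [← mul_assoc]
    refine mul_le_mul_of_nonneg_right ?_ (hg w)
    have hnn : 0 ≤ α⁻¹ * (M.obs w).toReal := by positivity
    rw [M.interv_split]
    split_ifs
    · rw [M.obs_split X, ← mul_assoc]
      refine mul_le_mul_of_nonneg_right ?_ (M.setFactor_nonneg _ _)
      calc _ ≤ (1 : ℝ) := M.setFactor_le_one _ _
        _ = α⁻¹ * α := (inv_mul_cancel₀ hα.ne').symm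
        _ ≤ _ := mul_le_mul_of_nonneg_left (hpos.lt_setFactor w).le (by positivity)
    · exact hnn

/-- Without directed edges, Q[Sᶜ] does not depend on X, so the split law is P. Contexts of variables
outside S do not contain X. -/
theorem dominated_of_no_edges (h : ∀ i j, ¬ G.dir i j) : M.Dominated X x 1 := by
  intro i g _ hdep
  have hpa : ∀ S, G.paPlus S = S := by
    intro S; ext j; rw [G.mem_paPlus]; simp [h]
  rw [one_mul]
  refine le_of_eq (Finset.sum_congr rfl fun v _ => ?_)
  congr 1
  · rw [M.splitLaw_eq, M.obs_split X]
    congr 1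
    refine dependsOn_update (M.dependsOn_setFactor _) ?_ v x
    rw [hpa]
    simp [G.self_mem_cComp]
  · unfold ADMG.twist
    split_ifs with hi
    · rfl
    · refine dependsOn_update hdep ?_ v x
      intro hX
      have hX' : X ∈ G.scope i := Finset.mem_of_mem_erase hX
      rw [ADMG.scope, hpa] at hX'
      exact hi (G.cComp_comm.1 (G.insert_before_subset i hX'))

end CBN

/-! ### The estimator -/

namespace ADMG

variable {n : ℕ} (G : ADMG n) {s m : ℕ} (J : Finset (Fin m)) (l : ℕ) (S : Fin m → Fin n → Fin s)

/-- The smoothed empirical conditional probability of `v i` given the context. -/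
def est (i : Fin n) (v : Fin n → Fin s) : ℝ :=
  (countIn J (cyl (G.scope i) v) S + l) / (countIn J (cyl (G.context i) v) S + s * l)

theorem cyl_context_update (i : Fin n) (v : Fin n → Fin s) (a : Fin s) :
    cyl (G.context i) (Function.update v i a) = cyl (G.context i) v :=
  cyl_congr fun _ hj => Function.update_of_ne (Finset.ne_of_mem_erase hj) _ _

theorem sum_countIn_scope (i : Fin n) (v : Fin n → Fin s) :
    ∑ a, countIn J (cyl (G.scope i) (Function.update v i a)) S
      = countIn J (cyl (G.context i) v) S := by
  unfold countIn
  rw [Finset.card_eq_sum_card_fiberwise (f := fun j => S j i) (t := Finset.univ)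
    (by intro j _; simp)]
  refine Finset.sum_congr rfl fun a _ => ?_
  congr 1
  ext j
  simp only [Finset.mem_filter, and_assoc]
  refine and_congr_right fun _ => ?_
  constructor
  · intro h
    refine ⟨fun k hk => ?_, by simpa using h i (G.self_mem_scope i)⟩
    have := h k (Finset.mem_of_mem_erase hk)
    rwa [Function.update_of_ne (Finset.ne_of_mem_erase hk)] at this
  · rintro ⟨h1, h2⟩ k hk
    by_cases hki : k = i
    · subst hki; simpa using h2
    · rw [Function.update_of_ne hki]
      exact h1 k (Finset.mem_erase.2 ⟨hki, hk⟩)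

variable {l}

theorem est_den_pos [NeZero s] (hl : 0 < l) (i : Fin n) (v : Fin n → Fin s) :
    (0 : ℝ) < countIn J (cyl (G.context i) v) S + s * l := by
  have hs : 0 < s := Nat.pos_of_ne_zero (NeZero.ne s)
  positivity

theorem est_pos [NeZero s] (hl : 0 < l) (i : Fin n) (v : Fin n → Fin s) :
    0 < G.est J l S i v :=
  div_pos (by positivity) (G.est_den_pos J S hl i v)

theorem isChain_est [NeZero s] (hl : 0 < l) : IsChain G.rank (G.est J l S) := by
  refine ⟨fun i v w h => ?_, fun i v => ?_⟩
  · have h1 : cyl (G.scope i) v = cyl (G.scope i) w :=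
      cyl_congr fun j hj => h j (G.rank_le_of_mem_scope hj)
    have h2 : cyl (G.context i) v = cyl (G.context i) w :=
      cyl_congr fun j hj => h j (G.rank_lt_of_mem_context hj).le
    unfold est
    rw [h1, h2]
  · unfold est
    simp_rw [cyl_context_update]
    rw [← Finset.sum_div, div_eq_one_iff_eq (G.est_den_pos J S hl i v).ne',
      Finset.sum_add_distrib, ← Nat.cast_sum, G.sum_countIn_scope]
    simp

theorem isChain_est_twist [NeZero s] (X : Fin n) (x : Fin s) (hl : 0 < l) :
    IsChain G.rank fun i v => G.est J l S i (G.twist X x i v) :=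
  G.isChain_twist X x (G.isChain_est J S hl)

/-- The estimate of the split distribution. -/
def estPMF [NeZero s] (X : Fin n) (x : Fin s) (hl : 0 < l) : PMF (Fin n → Fin s) :=
  pmfOfReal (fun v => ∏ i, G.est J l S i (G.twist X x i v))
    (fun _ => Finset.prod_nonneg fun i _ => (G.est_pos J S hl i _).le)
    ((G.isChain_est_twist J S X x hl).sum_prod G.rank_injective)

end ADMG

/-- The values of `v` on `F` after the intervention `X := x`. -/
def readOff {n s : ℕ} (F : Finset (Fin n)) (X : Fin n) (x : Fin s) (v : Fin n → Fin s) :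
    F → Fin s :=
  fun j => Function.update v X x j

namespace CBN

variable {n : ℕ} {G : ADMG n} {s : ℕ} (M : CBN G s) {m : ℕ} (J : Finset (Fin m))

theorem dependsOn_chiSq (l : ℕ) (S : Fin m → Fin n → Fin s) (i : Fin n) :
    DependsOn (chiSq M.cond (G.est J l S) i) (G.context i : Set (Fin n)) := by
  intro v w h
  refine Finset.sum_congr rfl fun a _ => ?_
  have h1 : ∀ j ∈ (G.scope i : Set (Fin n)), Function.update v i a j = Function.update w i a j := by
    intro j hj
    by_cases hji : j = i
    · subst hji; simp
    · rw [Function.update_of_ne hji, Function.update_of_ne hji]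
      exact h j (Finset.mem_erase.2 ⟨hji, hj⟩)
  have h2 : G.est J l S i (Function.update v i a) = G.est J l S i (Function.update w i a) := by
    unfold ADMG.est
    rw [cyl_congr (D := G.scope i) h1, cyl_congr (D := G.context i)
      fun j hj => h1 j (Finset.mem_of_mem_erase hj)]
  rw [M.dependsOn_cond i h1, h2]

variable [NeZero s]

/-- The samples for which some empirical frequency is far from the true one. -/
def badSamples (l : ℕ) : Set (Fin m → Fin n → Fin s) :=
  ⋃ i ∈ (Finset.univ : Finset (Fin n)),
    ({S | ∃ v, S ∈ deviates M.obs J l (cyl (G.scope i) v)} ∪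
     {S | ∃ v, S ∈ deviates M.obs J l (cyl (G.context i) v)})

theorem iid_badSamples_le (l : ℕ) (hl : 0 < l) :
    (iid M.obs m).toOuterMeasure (M.badSamples J l)
      ≤ ENNReal.ofReal (4 * n * (s : ℝ) ^ (G.maxCComp * G.inDegree + G.maxCComp)
        * Real.exp (-l)) := by
  set K := G.maxCComp * G.inDegree + G.maxCComp
  have hs : (1 : ℝ) ≤ s := by exact_mod_cast Nat.one_le_iff_ne_zero.2 (NeZero.ne s)
  have hl' : (0 : ℝ) < l := by exact_mod_cast hl
  have hD : ∀ D : Finset (Fin n), D.card ≤ K →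
      (iid M.obs m).toOuterMeasure {S | ∃ v, S ∈ deviates M.obs J l (cyl D v)}
        ≤ ENNReal.ofReal ((s : ℝ) ^ K * (2 * Real.exp (-l))) := by
    intro D hD
    refine (iid_deviates_cyl_le M.obs m J D l hl').trans (ENNReal.ofReal_le_ofReal ?_)
    exact mul_le_mul_of_nonneg_right (pow_le_pow_right₀ hs hD) (by positivity)
  refine (MeasureTheory.measure_biUnion_finset_le _ _).trans ?_
  refine (Finset.sum_le_sum fun i _ => (MeasureTheory.measure_union_le _ _).trans
    (add_le_add (hD _ (G.card_scope_le i)) (hD _ ?_))).trans (le_of_eq ?_)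
  · have := G.card_context_add_one i
    have := G.card_scope_le i
    omega
  · rw [Finset.sum_const, nsmul_eq_mul, ← ENNReal.ofReal_add (by positivity) (by positivity),
      ← ENNReal.ofReal_natCast, ← ENNReal.ofReal_mul (by positivity)]
    congr 1
    simp
    ring

/-- A rare context is estimated badly but has small weight, and the product is bounded uniformly.
The means of the counts of scope and context differ by the factor `cond`, which is `prob_cyl_scope`.
-/
theorem prob_mul_chiSq_le (l : ℕ) (hl : 0 < l) (hJ : 0 < J.card) (S : Fin m → Fin n → Fin s)
    (hS : S ∉ M.badSamples J l) (i : Fin n) (v : Fin n → Fin s) :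
    prob M.obs (cyl (G.context i) v) * chiSq M.cond (G.est J l S) i v
      ≤ 1320 * (s * l) / J.card := by
  have hgood : ∀ w, S ∉ deviates M.obs J l (cyl (G.scope i) w)
      ∧ S ∉ deviates M.obs J l (cyl (G.context i) w) := by
    intro w
    simp only [badSamples, Finset.mem_univ, Set.iUnion_true, Set.mem_iUnion, not_exists,
      Set.mem_union, not_or] at hS
    exact ⟨fun h => (hS i).1 ⟨w, h⟩, fun h => (hS i).2 ⟨w, h⟩⟩
  have hJ' : (0 : ℝ) < J.card := by exact_mod_cast hJ
  have hl' : (0 : ℝ) < l := by exact_mod_cast hl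
  have h := smoothed_chi_sq_le s l (J.card * prob M.obs (cyl (G.context i) v))
    (countIn J (cyl (G.context i) v) S) (fun a => M.cond i (Function.update v i a))
    (fun a => countIn J (cyl (G.scope i) (Function.update v i a)) S) hl'
    (fun a => M.cond_nonneg i _) (M.isChain_cond.sum_one i v)
    (mul_nonneg hJ'.le (prob_nonneg _ _)) (Nat.cast_nonneg _) (fun a => Nat.cast_nonneg _)
    (le_of_notMem_deviates (hgood v).2) ?_
  · rw [le_div_iff₀ hJ']
    refine le_trans (le_of_eq ?_) h
    unfold chiSq ADMG.est
    simp_rw [ADMG.cyl_context_update]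
    ring
  · intro a
    have := le_of_notMem_deviates (hgood (Function.update v i a)).1
    rw [M.prob_cyl_scope, ADMG.cyl_context_update] at this
    rw [mul_left_comm]
    exact this

/-- True and estimated distributions on F are images of two chains under the same map, so their
chains are compared. For each variable, domination moves the expected χ²-error from the split law to
P, where it is summed over contexts. The extra s in the χ²-bound completes s^|context| to s^|scope|
≤ s^K. -/
theorem tvDist_est_le (X : Fin n) (x : Fin s) (F : Finset (Fin n)) (hid : G.Identifiable X)
    (ρ : ℝ) (hρ : 0 ≤ ρ) (hdom : M.Dominated X x ρ) (l : ℕ) (hl : 0 < l) (hJ : 0 < J.card)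
    (S : Fin m → Fin n → Fin s) (hS : S ∉ M.badSamples J l) :
    tvDist (marginal (M.interv X x) F) ((G.estPMF J S X x hl).map (readOff F X x)) ^ 2
      ≤ ρ * (n * (s : ℝ) ^ (G.maxCComp * G.inDegree + G.maxCComp) * (1320 * l) / J.card) := by
  set K := G.maxCComp * G.inDegree + G.maxCComp with hK
  have hs : (1 : ℝ) ≤ s := by exact_mod_cast Nat.one_le_iff_ne_zero.2 (NeZero.ne s)
  have htv0 : ∀ {Ω : Type} [Fintype Ω] (p q : PMF Ω), 0 ≤ tvDist p q := fun p q =>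
    div_nonneg (Finset.sum_nonneg fun _ _ => abs_nonneg _) (by norm_num)
  have h1 : marginal (M.interv X x) F = (M.splitPMF X x).map (readOff F X x) := by
    rw [M.interv_eq_map X x hid, marginal, PMF.map_comp]; rfl
  have h2 : tvDist (M.splitPMF X x) (G.estPMF J S X x hl)
      = (∑ v, |∏ i, M.cond i (G.twist X x i v) - ∏ i, G.est J l S i (G.twist X x i v)|) / 2 := by
    unfold tvDist splitPMF ADMG.estPMF
    simp only [pmfOfReal_toReal]
    rfl
  rw [h1]
  refine (pow_le_pow_left₀ (htv0 _ _) (tvDist_map_le _ _ _) 2).trans ?_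
  rw [h2]
  refine (sq_tv_le_sum_chiSq (G.isChain_twist X x M.isChain_cond)
    (G.isChain_est_twist J S X x hl) G.rank_injective (fun i v => M.cond_nonneg i _)
    (fun i v => G.est_pos J S hl i _)).trans ?_
  have hterm : ∀ i, ∑ v, (∏ j, M.cond j (G.twist X x j v))
      * chiSq (fun i v => M.cond i (G.twist X x i v))
        (fun i v => G.est J l S i (G.twist X x i v)) i v
      ≤ ρ * ((s : ℝ) ^ K * (1320 * l) / J.card) := by
    intro i
    simp_rw [ADMG.chiSq_twist]
    refine (hdom i (chiSq M.cond (G.est J l S) i) ?_ (M.dependsOn_chiSq J l S i)).trans ?_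
    · exact fun v => Finset.sum_nonneg fun a _ =>
        div_nonneg (sq_nonneg _) (G.est_pos J S hl i _).le
    · refine mul_le_mul_of_nonneg_left ?_ hρ
      refine (sum_le_of_cyl M.obs (G.context i) _ (M.dependsOn_chiSq J l S i) _
        (M.prob_mul_chiSq_le J l hl hJ S hS i)).trans ?_
      calc (s : ℝ) ^ (G.context i).card * (1320 * (s * l) / J.card)
          = (s : ℝ) ^ ((G.context i).card + 1) * (1320 * l) / J.card := by rw [pow_succ]; ring
        _ ≤ _ := by
            rw [G.card_context_add_one]
            gcongr
            exact G.card_scope_le i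
  refine (Finset.sum_le_sum fun i _ => hterm i).trans (le_of_eq ?_)
  rw [Finset.sum_const, nsmul_eq_mul]
  simp
  ring

end CBN

/-! ### Running programs -/

theorem run_append (inp : ℕ → ℚ) (L L' : List Instr) (μ : Mem) :
    run inp (L ++ L') μ = (run inp L μ).bind (run inp L') := by
  induction L generalizing μ with
  | nil => simp [run]
  | cons I L ih =>
    simp only [List.cons_append, run, PMF.bind_bind]
    exact congrArg _ (funext ih)

/-- The program `L` turns the memory `μ` into `ν`, with certainty. -/
def Runs (inp : ℕ → ℚ) (L : List Instr) (μ ν : Mem) : Prop := run inp L μ = PMF.pure ν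

theorem Runs.append {inp : ℕ → ℚ} {L L' : List Instr} {μ ν ξ : Mem} (h : Runs inp L μ ν)
    (h' : Runs inp L' ν ξ) : Runs inp (L ++ L') μ ξ := by
  unfold Runs at *
  rw [run_append, h, PMF.pure_bind, h']

theorem Runs.nil (inp : ℕ → ℚ) (μ : Mem) : Runs inp [] μ μ := rfl

/-- A sequence of constant assignments. -/
theorem runs_consts {κ : Type*} (inp : ℕ → ℚ) (cell : κ → ℕ) (val : κ → ℚ)
    (hcell : Function.Injective cell) (l : List κ) (μ : Mem) :
    ∃ ν, Runs inp (l.map fun j => Instr.const (cell j) (val j)) μ ν ∧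
      (∀ j ∈ l, ν (cell j) = val j) ∧ ∀ a, (∀ j ∈ l, a ≠ cell j) → ν a = μ a := by
  induction l generalizing μ with
  | nil => exact ⟨μ, Runs.nil inp μ, by simp, by simp⟩
  | cons j l ih =>
    obtain ⟨ν, h1, h2, h3⟩ := ih (Function.update μ (cell j) (val j))
    refine ⟨ν, ?_, ?_, ?_⟩
    · simpa [Runs, run, Instr.step] using h1
    · intro k hk
      by_cases hkl : k ∈ l
      · exact h2 k hkl
      · have hkj : k = j := by simpa [hkl] using hk
        subst hkj
        rw [h3 _ fun i hi he => hkl (by rw [hcell he]; exact hi), Function.update_self]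
    · intro a ha
      rw [h3 a fun i hi => ha i (List.mem_cons_of_mem _ hi),
        Function.update_of_ne (ha j List.mem_cons_self)]

/-- A sequence of input instructions. -/
theorem runs_reads {κ : Type*} (inp : ℕ → ℚ) (cell src : κ → ℕ)
    (hcell : Function.Injective cell) (l : List κ) (μ : Mem) :
    ∃ ν, Runs inp (l.map fun j => Instr.read (cell j) (src j)) μ ν ∧
      (∀ j ∈ l, ν (cell j) = inp (src j)) ∧ ∀ a, (∀ j ∈ l, a ≠ cell j) → ν a = μ a := by
  induction l generalizing μ with
  | nil => exact ⟨μ, Runs.nil inp μ, by simp, by simp⟩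
  | cons j l ih =>
    obtain ⟨ν, h1, h2, h3⟩ := ih (Function.update μ (cell j) (inp (src j)))
    refine ⟨ν, ?_, ?_, ?_⟩
    · simpa [Runs, run, Instr.step] using h1
    · intro k hk
      by_cases hkl : k ∈ l
      · exact h2 k hkl
      · have hkj : k = j := by simpa [hkl] using hk
        subst hkj
        rw [h3 _ fun i hi he => hkl (by rw [hcell he]; exact hi), Function.update_self]
    · intro a ha
      rw [h3 a fun i hi => ha i (List.mem_cons_of_mem _ hi),
        Function.update_of_ne (ha j List.mem_cons_self)]

/-! ### Codes of assignments -/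

/-- The number with the digits `v j`, `j ∈ l`, in base `s`. -/
def codeOf {κ : Type*} {s : ℕ} (l : List κ) (v : κ → Fin s) : ℕ :=
  Nat.ofDigits s (l.map fun j => (v j : ℕ))

theorem codeOf_cons {κ : Type*} {s : ℕ} (j : κ) (l : List κ) (v : κ → Fin s) :
    codeOf (j :: l) v = v j + s * codeOf l v := by
  simp [codeOf, Nat.ofDigits_cons]

theorem codeOf_lt {κ : Type*} {s : ℕ} (hs : 2 ≤ s) (l : List κ) (v : κ → Fin s) :
    codeOf l v < s ^ l.length := by
  have := Nat.ofDigits_lt_base_pow_length (b := s) (l := l.map fun j => (v j : ℕ)) (by omega)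
    (by simp)
  simpa [codeOf] using this

theorem codeOf_eq_iff {κ : Type*} {s : ℕ} (hs : 2 ≤ s) (l : List κ) (v w : κ → Fin s) :
    codeOf l v = codeOf l w ↔ ∀ j ∈ l, v j = w j := by
  constructor
  · intro h
    have := Nat.ofDigits_inj_of_len_eq (b := s) (by omega) (by simp) (by simp) (by simp) h
    rw [List.map_inj_left] at this
    exact fun j hj => Fin.ext (this j hj)
  · intro h
    unfold codeOf
    congr 1
    exact List.map_congr_left fun j hj => by rw [h j hj]

theorem codeOf_toList_eq_iff {κ : Type*} {s : ℕ} (hs : 2 ≤ s) (D : Finset κ) (v w : κ → Fin s) :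
    codeOf D.toList v = codeOf D.toList w ↔ v ∈ cyl D w := by
  rw [codeOf_eq_iff hs]
  exact forall_congr' fun j => by rw [Finset.mem_toList]

/-- The program that writes the number with the digits stored in the cells `l`, in the base stored
in cell `2`, to cell `1`. -/
def horner : List ℕ → List Instr
  | [] => [.const 1 0]
  | a :: l => horner l ++ [.times 1 1 2, .plus 1 1 a]

theorem length_horner (l : List ℕ) : (horner l).length = 2 * l.length + 1 := by
  induction l with
  | nil => rfl
  | cons a l ih => simp [horner, ih]; ring

theorem runs_horner {κ : Type*} {s : ℕ} (inp : ℕ → ℚ) (cell : κ → ℕ) (l : List κ)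
    (v : κ → Fin s) (μ : Mem) (h2 : μ 2 = s) (hcell : ∀ j ∈ l, cell j ≠ 1)
    (hv : ∀ j ∈ l, μ (cell j) = (v j : ℕ)) :
    Runs inp (horner (l.map cell)) μ (Function.update μ 1 (codeOf l v : ℕ)) := by
  induction l with
  | nil => simp [Runs, horner, run, Instr.step, codeOf]
  | cons j l ih =>
    have h := ih (fun k hk => hcell k (List.mem_cons_of_mem _ hk))
      (fun k hk => hv k (List.mem_cons_of_mem _ hk))
    rw [List.map_cons, horner]
    refine h.append ?_
    have hj := hcell j List.mem_cons_self
    simp only [Runs, run, Instr.step, PMF.pure_bind, Function.update_self, Function.update_idem]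
    rw [Function.update_of_ne hj, Function.update_of_ne (by norm_num : (2:ℕ) ≠ 1),
      hv j List.mem_cons_self, h2, codeOf_cons]
    congr 2
    push_cast
    ring

/-! ### Tables -/

/-- The address of entry `c` of table `t`. Cells below `20` are registers, cell `20 + j` holds the
value of variable `j`, and cell `20 + n` the value of the intervention. -/
def tab (n s t c : ℕ) : ℕ := 21 + n + t * s ^ n + c

theorem tab_inj {n s t c t' c' : ℕ} (hc : c < s ^ n) (hc' : c' < s ^ n) :
    tab n s t c = tab n s t' c' ↔ t = t' ∧ c = c' := by
  constructor
  · intro h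
    have h1 : t * s ^ n + c = t' * s ^ n + c' := by unfold tab at h; omega
    have hW : 0 < s ^ n := by omega
    have h2 := congrArg (· % s ^ n) h1
    simp only [Nat.mul_add_mod_self_right, Nat.mod_eq_of_lt hc, Nat.mod_eq_of_lt hc'] at h2
    subst h2
    exact ⟨Nat.eq_of_mul_eq_mul_right hW (by omega), rfl⟩
  · rintro ⟨rfl, rfl⟩; rfl

theorem le_tab (n s t c : ℕ) : 21 + n ≤ tab n s t c := by unfold tab; omega

/-- The program that adds the content of cell `9` to the entry of table `t` whose index is in
cell `1`. -/
def bump (n s t : ℕ) : List Instr :=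
  [.const 3 (tab n s t 0 : ℕ), .plus 3 3 1, .load 4 3, .plus 4 4 9, .store 3 4]

theorem floor_tab (n s t c : ℕ) : ⌊((tab n s t 0 : ℕ) : ℚ) + (c : ℚ)⌋₊ = tab n s t c := by
  rw [← Nat.cast_add, Nat.floor_natCast]; rfl

/-- The increment is taken from cell 9: it is 1 for the learner and 1/N for the tabulator. The
effect is written as an added indicator so that repeated updates add up to counts. -/
theorem runs_bump (inp : ℕ → ℚ) (n s t c : ℕ) (μ : Mem) (h1 : μ 1 = c) :
    ∃ ν, Runs inp (bump n s t) μ ν ∧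
      ∀ a, a ≠ 3 → a ≠ 4 → ν a = μ a + if a = tab n s t c then μ 9 else 0 := by
  have hfl := floor_tab n s t c
  have hle := le_tab n s t c
  refine ⟨_, by simp only [Runs, bump, run, Instr.step, PMF.pure_bind]; rfl, ?_⟩
  intro a h3 h4
  simp only [Function.update_self, Function.update_of_ne (by norm_num : (1:ℕ) ≠ 3),
    Function.update_of_ne (by norm_num : (3:ℕ) ≠ 4), Function.update_of_ne (by norm_num : (9:ℕ) ≠ 4),
    Function.update_of_ne (by norm_num : (9:ℕ) ≠ 3), h1, hfl]
  rw [Function.update_of_ne (by omega : tab n s t c ≠ 3),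
    Function.update_of_ne (by omega : tab n s t c ≠ 3)]
  by_cases ha : a = tab n s t c
  · subst ha; simp
  · simp [ha, Function.update_of_ne, h3, h4]

namespace ADMG

variable {n : ℕ} (G : ADMG n) (s : ℕ)

/-! ### The learner -/

/-- The program that counts the sample stored in the variable cells for the conditional
distribution of `i`. -/
def countStep (i : Fin n) : List Instr :=
  horner ((G.context i).toList.map fun j : Fin n => 20 + (j : ℕ)) ++ (bump n s (2 * i) ++
    ([.times 1 1 2, .plus 1 1 (20 + i)] ++ bump n s (2 * i + 1)))

/-- The program that reads sample `j` and counts it. -/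
def sampleBlock (j : ℕ) : List Instr :=
  ((List.finRange n).map fun t => .read (20 + (t : ℕ)) (j * n + t)) ++
    (List.finRange n).flatMap (G.countStep s)

/-- The learner: it counts the first `m` samples. -/
def learner (m : ℕ) : List Instr :=
  [.const 2 s, .const 9 1] ++ (List.range m).flatMap (G.sampleBlock s)

variable {s}

/-- What counting the sample `v` for the variable `i` adds to cell `a`. -/
def hit (i : Fin n) (v : Fin n → Fin s) (a : ℕ) : ℚ :=
  (if a = tab n s (2 * i) (codeOf (G.context i).toList v) then 1 else 0) +
    if a = tab n s (2 * i + 1) (codeOf (i :: (G.context i).toList) v) then 1 else 0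

theorem hit_eq_zero (i : Fin n) (v : Fin n → Fin s) {a : ℕ} (ha : a < 21 + n) :
    G.hit i v a = 0 := by
  have h1 := le_tab n s (2 * i) (codeOf (G.context i).toList v)
  have h2 := le_tab n s (2 * i + 1) (codeOf (i :: (G.context i).toList) v)
  rw [hit, if_neg (by omega), if_neg (by omega), add_zero]

theorem runs_countStep (inp : ℕ → ℚ) (i : Fin n) (v : Fin n → Fin s) (μ : Mem) (h2 : μ 2 = s)
    (h9 : μ 9 = 1) (hv : ∀ j : Fin n, μ (20 + j) = (v j : ℕ)) :
    ∃ ν, Runs inp (G.countStep s i) μ ν ∧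
      ∀ a, a ≠ 1 → a ≠ 3 → a ≠ 4 → ν a = μ a + G.hit i v a := by
  have r1 := runs_horner inp (fun j : Fin n => 20 + (j : ℕ)) (G.context i).toList v μ h2
    (fun j _ => by omega) (fun j _ => hv j)
  set c := codeOf (G.context i).toList v
  set μ₁ := Function.update μ 1 (c : ℚ) with hμ₁
  have k1 : ∀ a, a ≠ 1 → μ₁ a = μ a := fun a ha => Function.update_of_ne ha _ _
  obtain ⟨μ₂, r2, k2⟩ := runs_bump inp n s (2 * i) c μ₁ (Function.update_self _ _ _)
  have t1 := le_tab n s (2 * i) c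
  have e1 : μ₂ 1 = c := by
    rw [k2 1 (by norm_num) (by norm_num), if_neg (by omega), add_zero, hμ₁, Function.update_self]
  have e2 : μ₂ 2 = s := by
    rw [k2 2 (by norm_num) (by norm_num), if_neg (by omega), add_zero, k1 2 (by norm_num), h2]
  have ei : μ₂ (20 + i) = (v i : ℕ) := by
    rw [k2 _ (by omega) (by omega), if_neg (by omega), add_zero, k1 _ (by omega), hv]
  set c' := codeOf (i :: (G.context i).toList) v with hc'
  have r3 : Runs inp [.times 1 1 2, .plus 1 1 (20 + (i : ℕ))] μ₂ (Function.update μ₂ 1 (c' : ℚ)) := by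
    simp only [Runs, run, Instr.step, PMF.pure_bind, Function.update_self, Function.update_idem]
    rw [Function.update_of_ne (by omega : 20 + (i : ℕ) ≠ 1), e1, e2, ei, hc', codeOf_cons]
    congr 2
    push_cast
    ring
  set μ₃ := Function.update μ₂ 1 (c' : ℚ) with hμ₃
  have k3 : ∀ a, a ≠ 1 → μ₃ a = μ₂ a := fun a ha => Function.update_of_ne ha _ _
  obtain ⟨μ₄, r4, k4⟩ := runs_bump inp n s (2 * i + 1) c' μ₃ (Function.update_self _ _ _)
  refine ⟨μ₄, r1.append (r2.append (r3.append r4)),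
    fun a h1 h3 h4 => ?_⟩
  have n1 : μ₁ 9 = 1 := by rw [k1 9 (by norm_num), h9]
  have n3 : μ₃ 9 = 1 := by
    rw [k3 9 (by norm_num), k2 9 (by norm_num) (by norm_num), if_neg (by omega), add_zero, n1]
  rw [k4 a h3 h4, k3 a h1, k2 a h3 h4, k1 a h1, n1, n3, hit, add_assoc]

theorem runs_countSteps (inp : ℕ → ℚ) (l : List (Fin n)) (v : Fin n → Fin s) (μ : Mem)
    (h2 : μ 2 = s) (h9 : μ 9 = 1) (hv : ∀ j : Fin n, μ (20 + j) = (v j : ℕ)) :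
    ∃ ν, Runs inp (l.flatMap (G.countStep s)) μ ν ∧
      ∀ a, a ≠ 1 → a ≠ 3 → a ≠ 4 → ν a = μ a + (l.map fun i => G.hit i v a).sum := by
  induction l generalizing μ with
  | nil => exact ⟨μ, Runs.nil _ _, by simp⟩
  | cons i l ih =>
    obtain ⟨ν, r1, k1⟩ := G.runs_countStep inp i v μ h2 h9 hv
    have keep : ∀ a, a ≠ 1 → a ≠ 3 → a ≠ 4 → a < 21 + n → ν a = μ a := by
      intro a a1 a3 a4 ha
      rw [k1 a a1 a3 a4, G.hit_eq_zero i v ha, add_zero]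
    obtain ⟨ξ, r2, k2⟩ := ih ν
      (by rw [keep 2 (by norm_num) (by norm_num) (by norm_num) (by omega), h2])
      (by rw [keep 9 (by norm_num) (by norm_num) (by norm_num) (by omega), h9])
      (fun j => by rw [keep _ (by omega) (by omega) (by omega) (by omega), hv])
    refine ⟨ξ, r1.append r2, fun a a1 a3 a4 => ?_⟩
    rw [k2 a a1 a3 a4, k1 a a1 a3 a4, List.map_cons, List.sum_cons, add_assoc]

theorem varCell_injective : Function.Injective fun j : Fin n => 20 + (j : ℕ) :=
  fun i j h => Fin.ext (by simpa using h)

theorem runs_sampleBlock (inp : ℕ → ℚ) (j : ℕ) (v : Fin n → Fin s) (μ : Mem) (h2 : μ 2 = s)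
    (h9 : μ 9 = 1) (hv : ∀ t : Fin n, inp (j * n + t) = (v t : ℕ)) :
    ∃ ν, Runs inp (G.sampleBlock s j) μ ν ∧ ν 2 = s ∧ ν 9 = 1 ∧
      ∀ a, 21 + n ≤ a → ν a = μ a + ∑ i, G.hit i v a := by
  obtain ⟨ν, r1, k1, f1⟩ := runs_reads inp (fun t : Fin n => 20 + (t : ℕ)) (fun t => j * n + t)
    varCell_injective (List.finRange n) μ
  have f1' : ∀ a, a < 20 ∨ 20 + n ≤ a → ν a = μ a := fun a ha => f1 a fun t _ => by omega
  obtain ⟨ξ, r2, k2⟩ := G.runs_countSteps inp (List.finRange n) v ν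
    (by rw [f1' 2 (by omega), h2]) (by rw [f1' 9 (by omega), h9])
    (fun t => by rw [k1 t (List.mem_finRange t), hv])
  have hz : ∀ a, a < 21 + n → ((List.finRange n).map fun i => G.hit i v a).sum = 0 := by
    intro a ha
    refine List.sum_eq_zero fun q hq => ?_
    obtain ⟨i, -, rfl⟩ := List.mem_map.1 hq
    exact G.hit_eq_zero i v ha
  refine ⟨ξ, r1.append r2, ?_, ?_, ?_⟩
  · rw [k2 2 (by norm_num) (by norm_num) (by norm_num), hz 2 (by omega), f1' 2 (by omega), h2,
      add_zero]
  · rw [k2 9 (by norm_num) (by norm_num) (by norm_num), hz 9 (by omega), f1' 9 (by omega), h9,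
      add_zero]
  · intro a ha
    rw [k2 a (by omega) (by omega) (by omega), f1' a (by omega), ← List.sum_ofFn,
      List.ofFn_eq_map]

/-- The samples that the learner uses. -/
def used (M m : ℕ) : Finset (Fin M) := Finset.univ.filter fun j => (j : ℕ) < m

theorem card_used {M m : ℕ} (h : m ≤ M) : (used M m).card = m := by
  rw [used, Fin.card_filter_val_lt]
  exact min_eq_right h

theorem sampleInput_apply {M : ℕ} (S : Fin M → Fin n → Fin s) (j : Fin M) (t : Fin n) :
    sampleInput S (j * n + t) = (S j t : ℕ) := by
  have hlt : (j : ℕ) * n + t < M * n := by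
    have h1 : ((j : ℕ) + 1) * n ≤ M * n := Nat.mul_le_mul_right n j.2
    have h2 := t.2
    rw [Nat.succ_mul] at h1
    omega
  have hn : 0 < n := t.pos
  rw [sampleInput, dif_pos hlt]
  have e1 : ((j : ℕ) * n + t) / n = j := by
    rw [mul_comm, Nat.mul_add_div hn, Nat.div_eq_of_lt t.2, add_zero]
  have e2 : ((j : ℕ) * n + t) % n = t := by
    rw [Nat.mul_add_mod_self_right, Nat.mod_eq_of_lt t.2]
  simp only [e1, e2]

theorem runs_sampleBlocks {M : ℕ} (S : Fin M → Fin n → Fin s) (t : ℕ) (ht : t ≤ M) (μ : Mem)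
    (h2 : μ 2 = s) (h9 : μ 9 = 1) :
    ∃ ν, Runs (sampleInput S) ((List.range t).flatMap (G.sampleBlock s)) μ ν ∧
      ν 2 = s ∧ ν 9 = 1 ∧
      ∀ a, 21 + n ≤ a → ν a = μ a + ∑ j ∈ used M t, ∑ i, G.hit i (S j) a := by
  induction t with
  | zero => exact ⟨μ, Runs.nil _ _, h2, h9, by simp [used]⟩
  | succ t ih =>
    obtain ⟨ν, r1, ν2, ν9, k1⟩ := ih (by omega)
    obtain ⟨ξ, r2, ξ2, ξ9, k2⟩ := G.runs_sampleBlock (sampleInput S) t (S ⟨t, ht⟩) ν ν2 ν9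
      (fun i => sampleInput_apply S ⟨t, ht⟩ i)
    refine ⟨ξ, ?_, ξ2, ξ9, fun a ha => ?_⟩
    · rw [List.range_succ, List.flatMap_append, List.flatMap_singleton]
      exact r1.append r2
    · have hu : used M (t + 1) = insert ⟨t, ht⟩ (used M t) := by
        ext j
        simp only [used, Finset.mem_filter, Finset.mem_univ, true_and, Finset.mem_insert,
          Fin.ext_iff]
        omega
      rw [hu, Finset.sum_insert (by simp [used]), k2 a ha, k1 a ha]
      ring

/-- The memory `μ` holds the counts of the samples `S` in `J`, and an empty output table. -/
structure Holds {M : ℕ} (J : Finset (Fin M)) (S : Fin M → Fin n → Fin s) (μ : Mem) : Prop where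
  context : ∀ (i : Fin n) (v : Fin n → Fin s), μ (tab n s (2 * i) (codeOf (G.context i).toList v))
    = countIn J (cyl (G.context i) v) S
  scope : ∀ (i : Fin n) (v : Fin n → Fin s), μ (tab n s (2 * i + 1) (codeOf (i :: (G.context i).toList) v))
    = countIn J (cyl (G.scope i) v) S
  out : ∀ c, c < s ^ n → μ (tab n s (2 * n) c) = 0

/-! ### The tables after the learner has run -/

theorem codeOf_context_lt (hs : 2 ≤ s) (i : Fin n) (v : Fin n → Fin s) :
    codeOf (G.context i).toList v < s ^ n := by
  refine (codeOf_lt hs _ v).trans_le (Nat.pow_le_pow_right (by omega) ?_)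
  rw [Finset.length_toList]
  exact (Finset.card_le_univ _).trans (Fintype.card_fin n).le

theorem codeOf_scope_lt (hs : 2 ≤ s) (i : Fin n) (v : Fin n → Fin s) :
    codeOf (i :: (G.context i).toList) v < s ^ n := by
  refine (codeOf_lt hs _ v).trans_le (Nat.pow_le_pow_right (by omega) ?_)
  rw [List.length_cons, Finset.length_toList, G.card_context_add_one]
  exact (Finset.card_le_univ _).trans (Fintype.card_fin n).le

theorem codeOf_scope_eq_iff (hs : 2 ≤ s) (i : Fin n) (v w : Fin n → Fin s) :
    codeOf (i :: (G.context i).toList) v = codeOf (i :: (G.context i).toList) w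
      ↔ v ∈ cyl (G.scope i) w := by
  rw [codeOf_eq_iff hs]
  refine forall_congr' fun j => ?_
  have : j ∈ i :: (G.context i).toList ↔ j ∈ G.scope i := by
    rw [List.mem_cons, Finset.mem_toList, context, Finset.mem_erase]
    constructor
    · rintro (rfl | h)
      · exact G.self_mem_scope _
      · exact h.2
    · intro h
      by_cases hji : j = i
      · exact Or.inl hji
      · exact Or.inr ⟨hji, h⟩
  rw [this]

/-- Every code is below the table width s^n, so entries of different tables never collide. The even
tables hold context counts, the odd ones scope counts, and table 2n is left for the output. -/
theorem hit_context (hs : 2 ≤ s) (i k : Fin n) (v w : Fin n → Fin s) :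
    G.hit k w (tab n s (2 * i) (codeOf (G.context i).toList v))
      = if k = i then (if w ∈ cyl (G.context i) v then 1 else 0) else 0 := by
  simp only [hit, tab_inj (G.codeOf_context_lt hs i v) (G.codeOf_context_lt hs k w),
    tab_inj (G.codeOf_context_lt hs i v) (G.codeOf_scope_lt hs k w)]
  rw [if_neg (c := 2 * (i : ℕ) = 2 * k + 1 ∧ _) (fun h => by omega), add_zero]
  by_cases hk : k = i
  · subst hk
    simp only [true_and, if_true, eq_comm (a := codeOf _ v), codeOf_toList_eq_iff hs]
  · have : ¬ (2 * (i : ℕ) = 2 * k) := fun h => hk (Fin.ext (by omega))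
    simp [this, hk]

theorem hit_scope (hs : 2 ≤ s) (i k : Fin n) (v w : Fin n → Fin s) :
    G.hit k w (tab n s (2 * i + 1) (codeOf (i :: (G.context i).toList) v))
      = if k = i then (if w ∈ cyl (G.scope i) v then 1 else 0) else 0 := by
  simp only [hit, tab_inj (G.codeOf_scope_lt hs i v) (G.codeOf_context_lt hs k w),
    tab_inj (G.codeOf_scope_lt hs i v) (G.codeOf_scope_lt hs k w)]
  rw [if_neg (fun h => by omega), zero_add]
  by_cases hk : k = i
  · subst hk
    simp only [true_and, if_true, eq_comm (a := codeOf _ v), G.codeOf_scope_eq_iff hs]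
  · have : ¬ (2 * (i : ℕ) + 1 = 2 * k + 1) := fun h => hk (Fin.ext (by omega))
    simp only [this, hk, false_and, if_false]

theorem hit_out (hs : 2 ≤ s) (k : Fin n) (w : Fin n → Fin s) {c : ℕ} (hc : c < s ^ n) :
    G.hit k w (tab n s (2 * n) c) = 0 := by
  simp only [hit, tab_inj hc (G.codeOf_context_lt hs k w), tab_inj hc (G.codeOf_scope_lt hs k w)]
  rw [if_neg (fun h => by omega), if_neg (fun h => by omega), add_zero]

theorem runs_learner (hs : 2 ≤ s) {M : ℕ} (S : Fin M → Fin n → Fin s) (m : ℕ) (hm : m ≤ M) :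
    ∃ ν, Runs (sampleInput S) (G.learner s m) (fun _ => 0) ν ∧ G.Holds (used M m) S ν := by
  set μ : Mem := Function.update (Function.update (fun _ => 0) 2 (s : ℚ)) 9 1 with hμ
  have r0 : Runs (sampleInput S) [.const 2 s, .const 9 1] (fun _ => 0) μ := by
    simp only [Runs, run, Instr.step, PMF.pure_bind]; rfl
  obtain ⟨ν, r1, -, -, k1⟩ := G.runs_sampleBlocks S m hm μ (by simp [hμ]) (by simp [hμ])
  have hz : ∀ a, 21 + n ≤ a → ν a = ∑ j ∈ used M m, ∑ i, G.hit i (S j) a := by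
    intro a ha
    rw [k1 a ha, hμ, Function.update_of_ne (by omega), Function.update_of_ne (by omega), zero_add]
  refine ⟨ν, r0.append r1, ⟨fun i v => ?_, fun i v => ?_, fun c hc => ?_⟩⟩
  · rw [hz _ (le_tab _ _ _ _)]
    simp_rw [G.hit_context hs, Finset.sum_ite_eq', Finset.mem_univ, if_true]
    rw [countIn, Finset.card_filter]
    push_cast
    rfl
  · rw [hz _ (le_tab _ _ _ _)]
    simp_rw [G.hit_scope hs, Finset.sum_ite_eq', Finset.mem_univ, if_true]
    rw [countIn, Finset.card_filter]
    push_cast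
    rfl
  · rw [hz _ (le_tab _ _ _ _)]
    exact Finset.sum_eq_zero fun j _ => Finset.sum_eq_zero fun i _ => G.hit_out hs i (S j) hc

theorem sim_learned (hs : 2 ≤ s) (P : PMF (Fin n → Fin s)) (M m : ℕ) (hm : m ≤ M) :
    Sim (learned P M (G.learner s m)) (iid P M) fun μ S => G.Holds (used M m) S μ := by
  refine Sim.bind_left (Sim.refl _) ?_
  rintro S _ rfl
  obtain ⟨ν, r, h⟩ := G.runs_learner hs S m hm
  rw [show run _ _ _ = _ from r]
  exact Sim.pure h

end ADMG

namespace ADMG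

variable {n : ℕ} (G : ADMG n) {s : ℕ} (X : Fin n) (x : Fin s)

/-! ### The evaluator -/

/-- The cell that holds the value of variable `j` as seen by variable `i`. -/
def seenCell (i j : Fin n) : ℕ := if j = X ∧ i ∉ G.cComp X then 20 + n else 20 + j

/-- The variable cells hold `v` and the intervention `x`. -/
def VarsHold (x : Fin s) (v : Fin n → Fin s) (μ : Mem) : Prop :=
  (∀ j : Fin n, μ (20 + j) = (v j : ℕ)) ∧ μ (20 + n) = (x : ℕ)

theorem VarsHold.congr {x : Fin s} {v : Fin n → Fin s} {μ ν : Mem} (h : VarsHold x v μ)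
    (hν : ∀ a, 20 ≤ a → a ≤ 20 + n → ν a = μ a) : VarsHold x v ν :=
  ⟨fun j => by rw [hν _ (by omega) (by omega), h.1], by rw [hν _ (by omega) (by omega), h.2]⟩

theorem seenCell_bounds (i j : Fin n) : 20 ≤ G.seenCell X i j ∧ G.seenCell X i j ≤ 20 + n := by
  unfold seenCell
  split_ifs <;> omega

variable {X x}

theorem VarsHold.seenCell {v : Fin n → Fin s} {μ : Mem} (h : VarsHold x v μ) (i j : Fin n) :
    μ (G.seenCell X i j) = (G.twist X x i v j : ℕ) := by
  unfold ADMG.seenCell twist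
  by_cases hi : i ∈ G.cComp X
  · simp [hi, h.1]
  · by_cases hj : j = X
    · subst hj; simp [hi, h.2]
    · simp [hi, hj, h.1]

variable (X x)

theorem twist_self (i : Fin n) (v : Fin n → Fin s) : G.twist X x i v i = v i := by
  unfold twist
  split_ifs with h
  · rfl
  · refine Function.update_of_ne ?_ _ _
    rintro rfl
    exact h (G.self_mem_cComp _)

theorem Holds.congr {M : ℕ} {J : Finset (Fin M)} {S : Fin M → Fin n → Fin s} {μ ν : Mem}
    {G : ADMG n} (h : G.Holds J S μ) (hν : ∀ a, 21 + n ≤ a → ν a = μ a) : G.Holds J S ν :=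
  ⟨fun i v => by rw [hν _ (le_tab _ _ _ _), h.context],
    fun i v => by rw [hν _ (le_tab _ _ _ _), h.scope],
    fun c hc => by rw [hν _ (le_tab _ _ _ _), h.out c hc]⟩

/-- The estimate `est` as a rational number. -/
def estQ {M : ℕ} (J : Finset (Fin M)) (l : ℕ) (S : Fin M → Fin n → Fin s) (i : Fin n)
    (v : Fin n → Fin s) : ℚ :=
  (countIn J (cyl (G.scope i) v) S + l) / (countIn J (cyl (G.context i) v) S + s * l)

theorem cast_estQ {M : ℕ} (J : Finset (Fin M)) (l : ℕ) (S : Fin M → Fin n → Fin s) (i : Fin n)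
    (v : Fin n → Fin s) : (G.estQ J l S i v : ℝ) = G.est J l S i v := by
  simp [estQ, est]

variable (s)

/-- The program that multiplies cell `8` by the estimated conditional probability of variable `i`.
Cells `5` and `6` hold `l` and `s * l`. -/
def multFactor (i : Fin n) : List Instr :=
  horner ((G.context i).toList.map (G.seenCell X i)) ++
    [.const 3 (tab n s (2 * i) 0 : ℕ), .plus 3 3 1, .load 4 3, .plus 4 4 6,
      .times 1 1 2, .plus 1 1 (20 + i), .const 3 (tab n s (2 * i + 1) 0 : ℕ), .plus 3 3 1,
      .load 3 3, .plus 3 3 5, .divide 4 3 4, .times 8 8 4]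

variable {s}

theorem runs_multFactor (inp : ℕ → ℚ) {M : ℕ} (J : Finset (Fin M)) (l : ℕ)
    (S : Fin M → Fin n → Fin s) (i : Fin n) (v : Fin n → Fin s) (μ : Mem) (h2 : μ 2 = s)
    (h5 : μ 5 = l) (h6 : μ 6 = s * l) (hv : VarsHold x v μ) (hd : G.Holds J S μ) :
    ∃ ν, Runs inp (G.multFactor s X i) μ ν ∧
      ν 8 = μ 8 * G.estQ J l S i (G.twist X x i v) ∧
      ∀ a, a ≠ 1 → a ≠ 3 → a ≠ 4 → a ≠ 8 → ν a = μ a := by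
  have r1 := runs_horner inp (G.seenCell X i) (G.context i).toList (G.twist X x i v) μ h2
    (fun j _ => by have := (G.seenCell_bounds X i j).1; omega) (fun j _ => hv.seenCell G i j)
  set w := G.twist X x i v with hw
  set c := codeOf (G.context i).toList w with hc
  set c' := codeOf (i :: (G.context i).toList) w with hc'
  have hcc : ((c' : ℕ) : ℚ) = c * s + (v i : ℕ) := by
    rw [hc', codeOf_cons, hw, G.twist_self, ← hw, ← hc]; push_cast; ring
  have f1 := floor_tab n s (2 * i) c
  have f2 := floor_tab n s (2 * i + 1) c'
  have b1 := le_tab n s (2 * i) c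
  have b2 := le_tab n s (2 * i + 1) c'
  have d1 : μ (tab n s (2 * i) c) = _ := hd.context i w
  have d2 : μ (tab n s (2 * i + 1) c') = _ := hd.scope i w
  have hvi := hv.1 i
  refine ⟨_, r1.append (by simp only [Runs, run, Instr.step, PMF.pure_bind]; rfl), ?_, ?_⟩
  · have n1 : (20 + (i : ℕ)) ≠ 1 := by omega
    have n3 : (20 + (i : ℕ)) ≠ 3 := by omega
    have n4 : (20 + (i : ℕ)) ≠ 4 := by omega
    have m1 : tab n s (2 * i) c ≠ 1 := by omega
    have m3 : tab n s (2 * i) c ≠ 3 := by omega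
    have p1 : tab n s (2 * i + 1) c' ≠ 1 := by omega
    have p3 : tab n s (2 * i + 1) c' ≠ 3 := by omega
    have p4 : tab n s (2 * i + 1) c' ≠ 4 := by omega
    simp only [Function.update_apply, n1, n3, n4, if_false, if_true, h2, h5, h6, hvi, ← hcc,
      f1, f2, m1, m3, p1, p3, p4, Nat.reduceEqDiff,
      OfNat.ofNat_ne_one, OfNat.one_ne_ofNat]
    rw [d1, d2, estQ]
  · intro a a1 a3 a4 a8
    simp [Function.update_apply, a1, a3, a4, a8]

theorem runs_multFactors (inp : ℕ → ℚ) {M : ℕ} (J : Finset (Fin M)) (l : ℕ)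
    (S : Fin M → Fin n → Fin s) (is : List (Fin n)) (v : Fin n → Fin s) (μ : Mem) (h2 : μ 2 = s)
    (h5 : μ 5 = l) (h6 : μ 6 = s * l) (hv : VarsHold x v μ) (hd : G.Holds J S μ) :
    ∃ ν, Runs inp (is.flatMap (G.multFactor s X)) μ ν ∧
      ν 8 = μ 8 * (is.map fun i => G.estQ J l S i (G.twist X x i v)).prod ∧
      ∀ a, a ≠ 1 → a ≠ 3 → a ≠ 4 → a ≠ 8 → ν a = μ a := by
  induction is generalizing μ with
  | nil => exact ⟨μ, Runs.nil _ _, by simp, fun _ _ _ _ _ => rfl⟩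
  | cons i is ih =>
    obtain ⟨ν, r1, e1, k1⟩ := G.runs_multFactor X x inp J l S i v μ h2 h5 h6 hv hd
    obtain ⟨ξ, r2, e2, k2⟩ := ih ν (by rw [k1] <;> first | exact h2 | norm_num)
      (by rw [k1] <;> first | exact h5 | norm_num) (by rw [k1] <;> first | exact h6 | norm_num)
      (hv.congr fun a _ _ => k1 a (by omega) (by omega) (by omega) (by omega))
      (hd.congr fun a _ => k1 a (by omega) (by omega) (by omega) (by omega))
    refine ⟨ξ, r1.append r2, ?_, fun a a1 a3 a4 a8 => ?_⟩
    · rw [e2, e1, List.map_cons, List.prod_cons, mul_assoc]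
    · rw [k2 a a1 a3 a4 a8, k1 a a1 a3 a4 a8]

variable (s)

/-- The program that adds the estimated probability of an assignment to cell `7`. The assignment
is given by `u` outside of `D`, and by the variable cells in `D`. -/
def addTerm (D : Finset (Fin n)) (u : {j // j ∉ D} → Fin s) : List Instr :=
  ((Finset.univ : Finset {j // j ∉ D}).toList.map fun j => .const (20 + (j : ℕ)) ((u j : ℕ) : ℚ))
    ++ ([.const 8 1] ++ ((List.finRange n).flatMap (G.multFactor s X) ++ [.plus 7 7 8]))

variable {s}

/-- The assignment that is `v` in `D` and `u` elsewhere. -/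
def glue (D : Finset (Fin n)) (v : Fin n → Fin s) (u : {j // j ∉ D} → Fin s) : Fin n → Fin s :=
  fun j => if h : j ∈ D then v j else u ⟨j, h⟩

theorem runs_addTerm (inp : ℕ → ℚ) {M : ℕ} (J : Finset (Fin M)) (l : ℕ)
    (S : Fin M → Fin n → Fin s) (D : Finset (Fin n)) (v : Fin n → Fin s)
    (u : {j // j ∉ D} → Fin s) (μ : Mem) (h2 : μ 2 = s) (h5 : μ 5 = l) (h6 : μ 6 = s * l)
    (hv : ∀ j ∈ D, μ (20 + (j : ℕ)) = (v j : ℕ)) (hx : μ (20 + n) = (x : ℕ))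
    (hd : G.Holds J S μ) :
    ∃ ν, Runs inp (G.addTerm s X D u) μ ν ∧
      ν 7 = μ 7 + ∏ i, G.estQ J l S i (G.twist X x i (glue D v u)) ∧
      (∀ j ∈ D, ν (20 + (j : ℕ)) = μ (20 + (j : ℕ))) ∧
      ∀ a, a < 20 ∨ 20 + n ≤ a → a ≠ 1 → a ≠ 3 → a ≠ 4 → a ≠ 7 → a ≠ 8 → ν a = μ a := by
  obtain ⟨μ₁, r1, e1, k1⟩ := runs_consts inp (fun j : {j // j ∉ D} => 20 + ((j : Fin n) : ℕ))
    (fun j => ((u j : ℕ) : ℚ)) (fun i j h => Subtype.ext (varCell_injective h))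
    (Finset.univ : Finset {j // j ∉ D}).toList μ
  have k1D : ∀ j ∈ D, μ₁ (20 + (j : ℕ)) = μ (20 + (j : ℕ)) := by
    intro j hj
    refine k1 _ fun i _ h => i.2 ?_
    have : j = (i : Fin n) := varCell_injective h
    exact this ▸ hj
  have k1' : ∀ a, a < 20 ∨ 20 + n ≤ a → μ₁ a = μ a := fun a ha => k1 a fun j _ => by
    have := j.1.2
    omega
  set μ₂ := Function.update μ₁ 8 1 with hμ₂
  have r2 : Runs inp [.const 8 1] μ₁ μ₂ := by simp only [Runs, run, Instr.step, PMF.pure_bind]; rfl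
  have k2 : ∀ a, a ≠ 8 → μ₂ a = μ₁ a := fun a ha => Function.update_of_ne ha _ _
  have hv2 : VarsHold x (glue D v u) μ₂ := by
    refine ⟨fun j => ?_, ?_⟩
    · rw [k2 _ (by omega)]
      by_cases hj : j ∈ D
      · rw [k1D j hj, hv j hj, glue, dif_pos hj]
      · rw [glue, dif_neg hj]
        exact e1 ⟨j, hj⟩ (by simp)
    · rw [k2 _ (by omega), k1' _ (by omega), hx]
  obtain ⟨μ₃, r3, e3, k3⟩ := G.runs_multFactors X x inp J l S (List.finRange n) (glue D v u) μ₂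
    (by rw [k2 2 (by norm_num), k1' 2 (by omega), h2])
    (by rw [k2 5 (by norm_num), k1' 5 (by omega), h5])
    (by rw [k2 6 (by norm_num), k1' 6 (by omega), h6]) hv2
    (hd.congr fun a _ => by rw [k2 a (by omega), k1' a (by omega)])
  have r4 : Runs inp [.plus 7 7 8] μ₃ (Function.update μ₃ 7 (μ₃ 7 + μ₃ 8)) := by
    simp only [Runs, run, Instr.step, PMF.pure_bind]
  refine ⟨_, r1.append (r2.append (r3.append r4)), ?_, ?_, ?_⟩
  · rw [Function.update_self, e3, k3 7 (by norm_num) (by norm_num) (by norm_num) (by norm_num),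
      k2 7 (by norm_num), k1' 7 (by omega), hμ₂, Function.update_self, one_mul, ← List.prod_ofFn,
      List.ofFn_eq_map]
  · intro j hj
    rw [Function.update_of_ne (by omega), k3 _ (by omega) (by omega) (by omega) (by omega),
      k2 _ (by omega), k1D j hj]
  · intro a ha a1 a3 a4 a7 a8
    rw [Function.update_of_ne a7, k3 a a1 a3 a4 a8, k2 a a8, k1' a ha]

theorem runs_addTerms (inp : ℕ → ℚ) {M : ℕ} (J : Finset (Fin M)) (l : ℕ)
    (S : Fin M → Fin n → Fin s) (D : Finset (Fin n)) (v : Fin n → Fin s)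
    (us : List ({j // j ∉ D} → Fin s)) (μ : Mem) (h2 : μ 2 = s) (h5 : μ 5 = l)
    (h6 : μ 6 = s * l) (hv : ∀ j ∈ D, μ (20 + (j : ℕ)) = (v j : ℕ))
    (hx : μ (20 + n) = (x : ℕ)) (hd : G.Holds J S μ) :
    ∃ ν, Runs inp (us.flatMap (G.addTerm s X D)) μ ν ∧
      ν 7 = μ 7
        + (us.map fun u => ∏ i, G.estQ J l S i (G.twist X x i (glue D v u))).sum := by
  induction us generalizing μ with
  | nil => exact ⟨μ, Runs.nil _ _, by simp⟩
  | cons u us ih =>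
    obtain ⟨ν, r1, e1, d1, k1⟩ := G.runs_addTerm X x inp J l S D v u μ h2 h5 h6 hv hx hd
    obtain ⟨ξ, r2, e2⟩ := ih ν (by rw [k1] <;> first | exact h2 | norm_num)
      (by rw [k1] <;> first | exact h5 | norm_num) (by rw [k1] <;> first | exact h6 | norm_num)
      (fun j hj => by rw [d1 j hj, hv j hj])
      (by rw [k1 _ (by omega) (by omega) (by omega) (by omega) (by omega) (by omega), hx])
      (hd.congr fun a _ => k1 a (by omega) (by omega) (by omega) (by omega) (by omega) (by omega))
    refine ⟨ξ, r1.append r2, ?_⟩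
    rw [e2, e1, List.map_cons, List.sum_cons, add_assoc]

/-- The evaluator for the estimate of the interventional distribution on `F`. -/
def evaluator (F : Finset (Fin n)) (l : ℕ) : List Instr :=
  [.const 2 s, .const 5 l, .const 6 (s * l), .const (20 + n) (x : ℕ), .const 7 0] ++
    (((F.erase X).toList.map fun j => .read (20 + (j : ℕ)) j) ++
      -- X is never fixed by the query, even if it belongs to F: its natural value has to be summed
      -- out.
      (((Finset.univ : Finset ({j // j ∉ F.erase X} → Fin s)).toList.flatMap
        (G.addTerm s X (F.erase X))) ++
        -- Under P_x the queried value of X must be x. Without jumps, equality is the product of the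
        -- two inequalities.
        if X ∈ F then [.read 3 X, .const 4 (x : ℕ), .compare 1 3 4, .compare 3 4 3, .times 7 7 1,
          .times 0 7 3] else [.const 1 1, .times 0 7 1]))

theorem queryInput_apply {F : Finset (Fin n)} (w : F → Fin s) (j : F) :
    queryInput w ((j : Fin n) : ℕ) = (w j : ℕ) := by
  have h : ∃ hn : ((j : Fin n) : ℕ) < n, (⟨j, hn⟩ : Fin n) ∈ F := ⟨j.1.2, j.2⟩
  rw [queryInput, dif_pos h]

/-- The value computed by the evaluator. -/
def evalValue {M : ℕ} (J : Finset (Fin M)) (l : ℕ) (S : Fin M → Fin n → Fin s)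
    (F : Finset (Fin n)) (v : Fin n → Fin s) : ℚ :=
  (if X ∈ F → v X = x then 1 else 0)
    * ∑ u, ∏ i, G.estQ J l S i (G.twist X x i (glue (F.erase X) v u))

theorem runs_evaluator {M : ℕ} (J : Finset (Fin M)) (l : ℕ) (S : Fin M → Fin n → Fin s)
    (F : Finset (Fin n)) (v : Fin n → Fin s) (μ : Mem) (hd : G.Holds J S μ) :
    ∃ ν, Runs (queryInput fun j : F => v j) (G.evaluator X x F l) μ ν ∧
      ν 0 = G.evalValue X x J l S F v := by
  set inp := queryInput fun j : F => v j with hinp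
  have hin : ∀ j ∈ F, inp (j : ℕ) = (v j : ℕ) := fun j hj =>
    queryInput_apply (fun j : F => v j) ⟨j, hj⟩
  obtain ⟨μ₁, r1, hμ₁⟩ : ∃ μ₁, Runs inp [.const 2 s, .const 5 l, .const 6 (s * l),
      .const (20 + n) (x : ℕ), .const 7 0] μ μ₁ ∧ (μ₁ 2 = s ∧ μ₁ 5 = l ∧ μ₁ 6 = s * l ∧
      μ₁ (20 + n) = (x : ℕ) ∧ μ₁ 7 = 0 ∧ ∀ a, 21 + n ≤ a → μ₁ a = μ a) := by
    refine ⟨_, by simp only [Runs, run, Instr.step, PMF.pure_bind]; rfl, ?_⟩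
    have q2 : 2 ≠ 20 + n := by omega
    have q5 : 5 ≠ 20 + n := by omega
    have q6 : 6 ≠ 20 + n := by omega
    have q7 : 20 + n ≠ 7 := by omega
    refine ⟨?_, ?_, ?_, ?_, ?_, ?_⟩
    · simp [q2]
    · simp [q5]
    · simp [q6]
    · simp [q7]
    · simp
    · intro a ha
      rw [Function.update_of_ne (by omega), Function.update_of_ne (by omega),
        Function.update_of_ne (by omega), Function.update_of_ne (by omega),
        Function.update_of_ne (by omega)]
  obtain ⟨m2, m5, m6, mx, m7, mk⟩ := hμ₁
  obtain ⟨μ₂, r2, e2, k2⟩ := runs_reads inp (fun j : Fin n => 20 + (j : ℕ)) (fun j => (j : ℕ))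
    varCell_injective (F.erase X).toList μ₁
  have k2' : ∀ a, a < 20 ∨ 20 + n ≤ a → μ₂ a = μ₁ a := fun a ha => k2 a fun j _ => by omega
  obtain ⟨μ₃, r3, e3⟩ := G.runs_addTerms X x inp J l S (F.erase X) v
    (Finset.univ : Finset ({j // j ∉ F.erase X} → Fin s)).toList μ₂
    (by rw [k2' 2 (by omega), m2]) (by rw [k2' 5 (by omega), m5]) (by rw [k2' 6 (by omega), m6])
    (fun j hj => by
      rw [e2 j (Finset.mem_toList.2 hj), hin j (Finset.mem_of_mem_erase hj)])
    (by rw [k2' _ (by omega), mx])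
    (hd.congr fun a ha => by rw [k2' a (by omega), mk a ha])
  rw [k2' 7 (by omega), m7, zero_add, Finset.sum_map_toList] at e3
  by_cases hX : X ∈ F
  · obtain ⟨μ₄, r4, e4⟩ : ∃ μ₄, Runs inp (if X ∈ F then [.read 3 X, .const 4 (x : ℕ),
        .compare 1 3 4, .compare 3 4 3, .times 7 7 1, .times 0 7 3]
        else [.const 1 1, .times 0 7 1]) μ₃ μ₄ ∧
        μ₄ 0 = μ₃ 7 * (if v X = x then 1 else 0) := by
      rw [if_pos hX]
      refine ⟨_, by simp only [Runs, run, Instr.step, PMF.pure_bind]; rfl, ?_⟩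
      simp only [Function.update_apply, hin X hX]
      norm_num
      by_cases hvx : v X = x
      · simp [hvx]
      · rw [if_neg hvx]
        rcases lt_or_gt_of_ne hvx with h | h
        · have : ¬ (x ≤ v X) := not_le.2 h
          simp [this]
        · have : ¬ (v X ≤ x) := not_le.2 h
          simp [this]
    refine ⟨μ₄, r1.append (r2.append (r3.append r4)), ?_⟩
    rw [e4, e3, evalValue, mul_comm]
    simp [hX]
  · obtain ⟨μ₄, r4, e4⟩ : ∃ μ₄, Runs inp (if X ∈ F then [.read 3 X, .const 4 (x : ℕ),
        .compare 1 3 4, .compare 3 4 3, .times 7 7 1, .times 0 7 3]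
        else [.const 1 1, .times 0 7 1]) μ₃ μ₄ ∧ μ₄ 0 = μ₃ 7 := by
      rw [if_neg hX]
      refine ⟨_, by simp only [Runs, run, Instr.step, PMF.pure_bind]; rfl, ?_⟩
      simp
    refine ⟨μ₄, r1.append (r2.append (r3.append r4)), ?_⟩
    rw [e4, e3, evalValue]
    simp [hX]

/-- The fibre of `readOff` over v is empty if X is queried with a value other than x, and otherwise
fixes exactly the coordinates in F \ X. This matches the sum formed by the evaluator. -/
theorem sum_readOff (F : Finset (Fin n)) (g : (Fin n → Fin s) → ℝ) (v : Fin n → Fin s) :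
    (∑ w, if readOff F X x w = (fun j : F => v j) then g w else 0)
      = (if X ∈ F → v X = x then 1 else 0) * ∑ u, g (glue (F.erase X) v u) := by
  have hiff : ∀ w : Fin n → Fin s, readOff F X x w = (fun j : F => v j) ↔
      (X ∈ F → v X = x) ∧ ∀ j ∈ F.erase X, w j = v j := by
    intro w
    constructor
    · intro h
      refine ⟨fun hX => ?_, fun j hj => ?_⟩
      · have := congrFun h ⟨X, hX⟩
        simpa [readOff] using this.symm
      · have := congrFun h ⟨j, Finset.mem_of_mem_erase hj⟩
        simpa [readOff, Finset.ne_of_mem_erase hj] using this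
    · rintro ⟨h1, h2⟩
      funext ⟨j, hj⟩
      by_cases hjX : j = X
      · subst hjX
        simp [readOff, h1 hj]
      · simpa [readOff, hjX] using h2 j (Finset.mem_erase.2 ⟨hjX, hj⟩)
  by_cases hX : X ∈ F → v X = x
  · rw [if_pos hX, one_mul, ← Finset.sum_filter]
    refine Finset.sum_nbij' (fun w j => w j) (fun u => glue (F.erase X) v u) ?_ ?_ ?_ ?_ ?_
    · simp
    · intro u _
      simp only [Finset.mem_filter, Finset.mem_univ, true_and, hiff]
      exact ⟨hX, fun j hj => by rw [glue, dif_pos hj]⟩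
    · intro w hw
      have h := ((hiff w).1 (Finset.mem_filter.1 hw).2).2
      funext j
      by_cases hj : j ∈ F.erase X
      · rw [glue, dif_pos hj, h j hj]
      · rw [glue, dif_neg hj]
    · intro u _
      funext j
      rw [glue, dif_neg j.2]
    · intro w hw
      have h := ((hiff w).1 (Finset.mem_filter.1 hw).2).2
      congr 1
      funext j
      by_cases hj : j ∈ F.erase X
      · rw [glue, dif_pos hj, h j hj]
      · rw [glue, dif_neg hj]
  · rw [if_neg hX, zero_mul]
    exact Finset.sum_eq_zero fun w _ => if_neg fun h => hX ((hiff w).1 h).1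

/-- On the data returned by the learner, the evaluator computes the estimated distribution. -/
theorem isCloseEvaluator_evaluator [NeZero s] {M : ℕ} (J : Finset (Fin M)) {l : ℕ} (hl : 0 < l)
    (S : Fin M → Fin n → Fin s) (F : Finset (Fin n)) (μ : Mem) (hd : G.Holds J S μ)
    (D : PMF (F → Fin s)) (ε : ℝ)
    (hD : tvDist D ((G.estPMF J S X x hl).map (readOff F X x)) ≤ ε) :
    IsCloseEvaluator (G.evaluator X x F l) μ D ε := by
  refine ⟨_, hD, fun w => ?_⟩
  obtain ⟨v, hv⟩ := exists_extension F w
  have hw : w = fun j : F => v j := funext fun j => (hv j).symm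
  obtain ⟨ν, r, e⟩ := G.runs_evaluator X x J l S F v μ hd
  rw [hw, show run _ _ _ = _ from r, PMF.pure_map, e, map_toReal]
  congr 1
  simp only [estPMF, pmfOfReal_toReal]
  have := sum_readOff X x F (fun v => ∏ i, G.est J l S i (G.twist X x i v)) v
  rw [this, evalValue]
  push_cast
  simp only [cast_estQ]
  congr 1
  split_ifs <;> simp

/-! ### Length of the evaluator -/

theorem length_flatMap_le {κ κ' : Type*} (l : List κ) (f : κ → List κ') (b : ℕ)
    (h : ∀ j ∈ l, (f j).length ≤ b) : (l.flatMap f).length ≤ l.length * b := by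
  induction l with
  | nil => simp
  | cons j l ih =>
    have h1 := h j List.mem_cons_self
    have h2 := ih fun k hk => h k (List.mem_cons_of_mem _ hk)
    rw [List.flatMap_cons, List.length_append, List.length_cons, Nat.succ_mul]
    omega

theorem length_multFactor_le (i : Fin n) :
    (G.multFactor s X i).length ≤ 15 * (G.maxCComp * G.inDegree + G.maxCComp) := by
  have h1 := G.card_context_add_one i
  have h2 := G.card_scope_le i
  simp only [multFactor, List.length_append, length_horner, List.length_map, Finset.length_toList,
    List.length_cons, List.length_nil]
  omega

theorem one_le_width (X : Fin n) : 1 ≤ G.maxCComp * G.inDegree + G.maxCComp := by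
  have h1 := Finset.card_pos.2 ⟨X, G.self_mem_scope X⟩
  have h2 := G.card_scope_le X
  omega

theorem length_evaluator_le (hs : 2 ≤ s) (F : Finset (Fin n)) (l : ℕ) :
    (G.evaluator X x F l).length ≤
      30 * (n * s * (G.maxCComp * G.inDegree + G.maxCComp) * s ^ (n - F.card)) := by
  have hK := G.one_le_width X
  set K := G.maxCComp * G.inDegree + G.maxCComp with hKdef
  have hn : 1 ≤ n := X.pos
  have hnK : n ≤ n * K := Nat.le_mul_of_pos_right n hK
  have hF : F.card ≤ n := (Finset.card_le_univ F).trans (Fintype.card_fin n).le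
  have hE1 : (F.erase X).card ≤ F.card := Finset.card_erase_le
  have hE2 : F.card ≤ (F.erase X).card + 1 := by
    have := Finset.pred_card_le_card_erase (s := F) (a := X)
    omega
  have hfree : Fintype.card {j // j ∉ F.erase X} = n - (F.erase X).card := by
    rw [Fintype.card_subtype_compl, Fintype.card_fin, Fintype.card_coe]
  have hterm : ∀ u ∈ (Finset.univ : Finset ({j // j ∉ F.erase X} → Fin s)).toList,
      (G.addTerm s X (F.erase X) u).length ≤ 18 * (n * K) := by
    intro u _
    have h1 := length_flatMap_le (List.finRange n) (G.multFactor s X) (15 * K)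
      fun i _ => G.length_multFactor_le X i
    rw [List.length_finRange, Nat.mul_left_comm] at h1
    simp only [addTerm, List.length_append, List.length_map, Finset.length_toList,
      List.length_cons, List.length_nil, Finset.card_univ, hfree]
    omega
  have hbody := length_flatMap_le _ (G.addTerm s X (F.erase X)) _ hterm
  rw [Finset.length_toList, Finset.card_univ, Fintype.card_fun, hfree, Fintype.card_fin] at hbody
  -- Summing over X as well costs at most one factor s, the one in the claimed running time.
  have hpow : s ^ (n - (F.erase X).card) ≤ s * s ^ (n - F.card) := by
    rw [← pow_succ']
    exact Nat.pow_le_pow_right (by omega) (by omega)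
  have hpost : ∀ A B : List Instr, A.length ≤ 6 → B.length ≤ 6 →
      (if X ∈ F then A else B).length ≤ 6 := by
    intro A B hA hB; split_ifs <;> assumption
  have hp := hpost [.read 3 X, .const 4 (x : ℕ), .compare 1 3 4, .compare 3 4 3, .times 7 7 1,
    .times 0 7 3] [.const 1 1, .times 0 7 1] (by simp) (by simp)
  have h1 : s ^ (n - (F.erase X).card) * (18 * (n * K)) ≤ 18 * (n * s * K * s ^ (n - F.card)) := by
    calc _ ≤ (s * s ^ (n - F.card)) * (18 * (n * K)) := Nat.mul_le_mul_right _ hpow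
      _ = _ := by ring
  have h2 : n ≤ n * s * K * s ^ (n - F.card) := by
    have : 1 ≤ s ^ (n - F.card) := Nat.one_le_pow _ _ (by omega)
    calc n = n * 1 * 1 * 1 := by ring
      _ ≤ _ := by gcongr; omega
  simp only [evaluator, List.length_append, List.length_map, Finset.length_toList,
    List.length_cons, List.length_nil]
  omega

end ADMG

/-! ### Sampling from a categorical distribution with coins -/

theorem coin_toReal (q : ℚ) (h0 : 0 ≤ q) (h1 : q ≤ 1) (r : Bool) :
    (coin q r).toReal = if r then (q : ℝ) else 1 - q := by
  have h0' : (0 : ℝ) ≤ q := by exact_mod_cast h0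
  have h1' : (q : ℝ) ≤ 1 := by exact_mod_cast h1
  have hmin : min (ENNReal.ofReal (q : ℝ)) 1 = ENNReal.ofReal q :=
    min_eq_left (ENNReal.ofReal_le_one.2 h1')
  cases r
  · simp only [coin, PMF.ofFintype_apply, cond_false, hmin]
    rw [ENNReal.toReal_sub_of_le (ENNReal.ofReal_le_one.2 h1') ENNReal.one_ne_top,
      ENNReal.toReal_ofReal h0']
    simp
  · simp [coin, PMF.ofFintype_apply, hmin, ENNReal.toReal_ofReal h0']

/-- The law of a variable that starts at `0` and is replaced by `a = 0, 1, …, t - 1` in turn, with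
probability `w a / ∑_{b ≤ a} w b`. -/
def catLaw (w : ℕ → ℚ) : ℕ → PMF ℕ
  | 0 => PMF.pure 0
  | t + 1 => (catLaw w t).bind fun b =>
      (coin (w t / ∑ a ∈ Finset.range (t + 1), w a)).map fun r => if r then t else b

/-- The last coin is independent of the earlier ones and may be tossed first. -/
theorem catLaw_succ (w : ℕ → ℚ) (t : ℕ) : catLaw w (t + 1)
    = (coin (w t / ∑ a ∈ Finset.range (t + 1), w a)).bind
      fun r => if r then PMF.pure t else catLaw w t := by
  rw [catLaw]
  simp only [← PMF.bind_pure_comp]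
  rw [PMF.bind_comm]
  congr 1
  funext r
  cases r
  · simp only [Function.comp_apply, Bool.false_eq_true, if_false]
    exact PMF.bind_pure _
  · simp only [Function.comp_apply, if_true]
    exact PMF.bind_const _ _

/-- Reservoir sampling: each later step keeps b with probability equal to the ratio of consecutive
partial sums, and these ratios telescope. One pass over the weights suffices, and their total need
not be known beforehand. -/
theorem catLaw_toReal (w : ℕ → ℚ) (hw : ∀ a, 0 < w a) (t b : ℕ) :
    (catLaw w (t + 1) b).toReal
      = if b ≤ t then (w b : ℝ) / (∑ a ∈ Finset.range (t + 1), w a : ℚ) else 0 := by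
  have hpos : ∀ t, 0 < ∑ a ∈ Finset.range (t + 1), w a := fun t =>
    Finset.sum_pos (fun a _ => hw a) ⟨0, by simp⟩
  have hstep : ∀ t, (catLaw w (t + 1) b).toReal
      = (w t / (∑ a ∈ Finset.range (t + 1), w a : ℚ) : ℝ) * (if b = t then 1 else 0)
        + (1 - w t / (∑ a ∈ Finset.range (t + 1), w a : ℚ) : ℝ) * (catLaw w t b).toReal := by
    intro t
    have q0 : 0 ≤ w t / ∑ a ∈ Finset.range (t + 1), w a := (div_pos (hw t) (hpos t)).le
    have q1 : w t / ∑ a ∈ Finset.range (t + 1), w a ≤ 1 := by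
      rw [div_le_one (hpos t)]
      exact Finset.single_le_sum (fun a _ => (hw a).le) (by simp)
    rw [catLaw_succ, PMF.bind_apply, tsum_fintype, Fintype.sum_bool, ENNReal.toReal_add,
      ENNReal.toReal_mul, ENNReal.toReal_mul, coin_toReal _ q0 q1, coin_toReal _ q0 q1]
    · simp only [if_true, Bool.false_eq_true, if_false, PMF.pure_apply]
      push_cast
      congr 2
      split_ifs <;> simp
    · exact ENNReal.mul_ne_top (PMF.apply_ne_top _ _) (PMF.apply_ne_top _ _)
    · exact ENNReal.mul_ne_top (PMF.apply_ne_top _ _) (PMF.apply_ne_top _ _)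
  induction t with
  | zero =>
    rw [hstep 0]
    have : (w 0 : ℝ) ≠ 0 := by exact_mod_cast (hw 0).ne'
    by_cases hb : b = 0
    · subst hb; simp [this]
    · simp [this, hb]
  | succ t ih =>
    rw [hstep (t + 1), ih]
    have h1 : ((∑ a ∈ Finset.range (t + 1), w a : ℚ) : ℝ) ≠ 0 := by exact_mod_cast (hpos t).ne'
    have h2 : ((∑ a ∈ Finset.range (t + 1 + 1), w a : ℚ) : ℝ) ≠ 0 := by
      exact_mod_cast (hpos (t + 1)).ne'
    have h3 : ((∑ a ∈ Finset.range (t + 1 + 1), w a : ℚ) : ℝ)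
        = (∑ a ∈ Finset.range (t + 1), w a : ℚ) + w (t + 1) := by
      rw [Finset.sum_range_succ]; push_cast; rfl
    rcases lt_trichotomy b (t + 1) with hb | hb | hb
    · rw [if_neg hb.ne, if_pos (by omega), if_pos (by omega)]
      rw [h3] at h2 ⊢
      field_simp
      ring
    · subst hb
      rw [if_pos rfl, if_neg (by omega), if_pos le_rfl]
      ring
    · rw [if_neg hb.ne', if_neg (by omega), if_neg (by omega)]
      ring

/-! ### Sampling along an order -/

section Sequential

variable {ι : Type*} [Fintype ι] [DecidableEq ι] {s : ℕ} {rank : ι → ℕ}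
  {r : ι → (ι → Fin s) → ℝ}

/-- The conditional distribution of variable `i`. -/
def IsChain.condPMF (hr : IsChain rank r) (h0 : ∀ i v, 0 ≤ r i v) (i : ι) (v : ι → Fin s) :
    PMF (Fin s) :=
  pmfOfReal (fun a => r i (Function.update v i a)) (fun _ => h0 i _) (hr.sum_one i v)

/-- Draw the variables in the list one after the other. -/
def IsChain.seqLaw (hr : IsChain rank r) (h0 : ∀ i v, 0 ≤ r i v) :
    List ι → (ι → Fin s) → PMF (ι → Fin s)
  | [], v => PMF.pure v
  | i :: l, v => (hr.condPMF h0 i v).bind fun a => hr.seqLaw h0 l (Function.update v i a)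

/-- Because the list increases in rank, values drawn after i do not affect `r i`, which may thus be
evaluated at the final assignment w. -/
theorem IsChain.seqLaw_toReal (hr : IsChain rank r) (h0 : ∀ i v, 0 ≤ r i v) (l : List ι)
    (hl : l.Pairwise fun i j => rank i < rank j) (v w : ι → Fin s) :
    (hr.seqLaw h0 l v w).toReal
      = if ∀ j ∉ l, w j = v j then (l.map fun i => r i w).prod else 0 := by
  induction l generalizing v with
  | nil =>
    rw [IsChain.seqLaw, PMF.pure_apply]
    by_cases h : w = v
    · subst h; simp
    · rw [if_neg h, if_neg (fun h' => h (funext fun j => h' j (by simp)))]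
      simp
  | cons i l ih =>
    obtain ⟨hil, hl'⟩ := List.pairwise_cons.1 hl
    have hi : i ∉ l := fun h => lt_irrefl _ (hil i h)
    rw [IsChain.seqLaw, PMF.bind_apply, tsum_fintype, ENNReal.toReal_sum (fun a _ =>
      ENNReal.mul_ne_top (PMF.apply_ne_top _ _) (PMF.apply_ne_top _ _)),
      Finset.sum_eq_single (w i)]
    · rw [ENNReal.toReal_mul, ih hl', IsChain.condPMF, pmfOfReal_toReal]
      have hiff : (∀ j ∉ l, w j = Function.update v i (w i) j) ↔ ∀ j ∉ i :: l, w j = v j := by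
        refine forall_congr' fun j => ?_
        by_cases hji : j = i
        · subst hji; simp
        · simp [hji]
      by_cases h : ∀ j ∉ i :: l, w j = v j
      · rw [if_pos (hiff.2 h), if_pos h, List.map_cons, List.prod_cons]
        congr 1
        refine hr.dep i fun j hj => ?_
        refine (hiff.2 h j fun hjl => ?_).symm
        exact absurd (hil j hjl) (not_lt.2 hj)
      · rw [if_neg (fun h' => h (hiff.1 h')), if_neg h, mul_zero]
    · intro a _ ha
      rw [ENNReal.toReal_mul, ih hl', if_neg, mul_zero]
      intro h
      exact ha (by simpa using (h i hi).symm)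
    · simp

theorem IsChain.seqLaw_eq [NeZero s] (hr : IsChain rank r) (hrank : Function.Injective rank)
    (h0 : ∀ i v, 0 ≤ r i v) (l : List ι) (hl : l.Pairwise fun i j => rank i < rank j)
    (hall : ∀ i, i ∈ l) (v : ι → Fin s) :
    hr.seqLaw h0 l v = pmfOfReal (fun w => ∏ i, r i w)
      (fun w => Finset.prod_nonneg fun i _ => h0 i w) (hr.sum_prod hrank) := by
  refine pmf_ext_toReal fun w => ?_
  rw [hr.seqLaw_toReal h0 l hl, pmfOfReal_toReal, if_pos (fun j hj => (hj (hall j)).elim)]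
  have hnd : l.Nodup := hl.imp fun h he => by rw [he] at h; exact lt_irrefl _ h
  rw [← List.prod_toFinset _ hnd]
  refine Finset.prod_congr ?_ fun _ _ => rfl
  ext i
  simp [hall]

end Sequential

/-- There is a list of the vertices in topological order. -/
theorem ADMG.exists_order {n : ℕ} (G : ADMG n) :
    ∃ l : List (Fin n), (∀ i, i ∈ l) ∧ l.Pairwise fun i j => G.rank i < G.rank j := by
  have i1 : IsTrans (Fin n) fun i j => G.rank i ≤ G.rank j := ⟨fun _ _ _ => le_trans⟩
  have i2 : Std.Antisymm fun i j : Fin n => G.rank i ≤ G.rank j :=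
    ⟨fun _ _ h h' => G.rank_injective (le_antisymm h h')⟩
  have i3 : Std.Total fun i j : Fin n => G.rank i ≤ G.rank j := ⟨fun _ _ => le_total _ _⟩
  refine ⟨Finset.univ.sort fun i j => G.rank i ≤ G.rank j, by simp, ?_⟩
  have h1 := Finset.pairwise_sort (Finset.univ : Finset (Fin n)) fun i j => G.rank i ≤ G.rank j
  have h2 := Finset.sort_nodup (Finset.univ : Finset (Fin n)) fun i j => G.rank i ≤ G.rank j
  exact (h1.and h2).imp fun h => lt_of_le_of_ne h.1 fun he => h.2 (G.rank_injective he)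

/-- The vertices in topological order. -/
def ADMG.order {n : ℕ} (G : ADMG n) : List (Fin n) := G.exists_order.choose

theorem iid_succ {β : Type*} [Fintype β] (P : PMF β) (t : ℕ) :
    iid P (t + 1) = (iid P t).bind fun T => P.map fun b => (Fin.snoc T b : Fin (t + 1) → β) := by
  refine pmf_ext_toReal fun T => ?_
  rw [iid_toReal, PMF.bind_apply, tsum_fintype, ENNReal.toReal_sum (fun a _ =>
      ENNReal.mul_ne_top (PMF.apply_ne_top _ _) (PMF.apply_ne_top _ _)),
      Finset.sum_eq_single fun j : Fin t => T j.castSucc]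
  · rw [ENNReal.toReal_mul, iid_toReal, map_toReal, Finset.sum_eq_single (T (Fin.last t))]
    · have h : (Fin.snoc (fun j : Fin t => T j.castSucc) (T (Fin.last t)) : Fin (t + 1) → β) = T :=
        Fin.snoc_init_self T
      rw [if_pos h, Fin.prod_univ_castSucc]
    · intro b _ hb
      refine if_neg fun h => hb ?_
      rw [← h, Fin.snoc_last]
    · simp
  · intro T' _ hT'
    rw [ENNReal.toReal_mul, map_toReal, Finset.sum_eq_zero, mul_zero]
    intro b _
    refine if_neg fun h => hT' ?_
    rw [← h]
    exact funext fun j => by simp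
  · simp

theorem countIn_snoc {β : Type*} {t : ℕ} (A : Set β) (T : Fin t → β) (b : β) :
    countIn Finset.univ A (Fin.snoc T b : Fin (t + 1) → β)
      = countIn Finset.univ A T + if b ∈ A then 1 else 0 := by
  unfold countIn
  rw [Finset.card_filter, Finset.card_filter, Fin.sum_univ_castSucc]
  simp

namespace ADMG

variable {n : ℕ} (G : ADMG n) (s : ℕ) (X : Fin n)

/-! ### The sampler -/

/-- One step of drawing a value for variable `i`: its value is replaced by `a` with the right
probability. Cell `3` holds the address of the count, cell `6` the sum of the weights so far. -/
def drawStep (i : Fin n) (a : ℕ) : List Instr :=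
  [.load 4 3, .plus 4 4 5, .plus 6 6 4, .divide 4 4 6] ++ (.flip 8 4 ::
    -- Adding (a - value) times the coin is a conditional assignment without a jump. Cell 10 holds 1
    -- and advances the address.
    [.const 4 a, .minus 4 4 (20 + i), .times 4 4 8, .plus (20 + i) (20 + i) 4, .plus 3 3 10])

/-- The program that draws a value for variable `i`, given the values of its context. -/
def drawVar (i : Fin n) : List Instr :=
  horner ((G.context i).toList.map (G.seenCell X i)) ++
    -- Variable i is the lowest digit of the scope code, so the s counts for a fixed context are
    -- consecutive, starting at the code with digit 0.
    ([.times 1 1 2, .const 3 (tab n s (2 * i + 1) 0 : ℕ), .plus 3 3 1, .const 6 0,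
      .const (20 + i) 0] ++ (List.range s).flatMap (drawStep i))

variable {s} {x : Fin s}

/-- The cells changed by drawing variable `i`. -/
def Untouched (i : Fin n) (μ ν : Mem) : Prop :=
  ∀ a, a ≠ 1 → a ≠ 3 → a ≠ 4 → a ≠ 6 → a ≠ 8 → a ≠ 20 + (i : ℕ) → ν a = μ a

theorem sim_drawStep (inp : ℕ → ℚ) (i : Fin n) (a : ℕ) (w W b : ℚ) (adr : ℕ) (μ : Mem)
    (h3 : μ 3 = adr) (h10 : μ 10 = 1) (hw : μ adr + μ 5 = w)
    (h6 : μ 6 = W) (hb : μ (20 + i) = b) :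
    Sim (run inp (drawStep i a) μ) (coin (w / (W + w))) fun ν r =>
      Untouched i μ ν ∧ ν 3 = (adr + 1 : ℕ) ∧ ν 6 = W + w ∧ ν (20 + i) = if r then (a : ℚ) else b := by
  obtain ⟨μ₁, r1, e4, e6, k1⟩ : ∃ μ₁, Runs inp [.load 4 3, .plus 4 4 5, .plus 6 6 4,
      .divide 4 4 6] μ μ₁ ∧ μ₁ 4 = w / (W + w) ∧ μ₁ 6 = W + w ∧
      ∀ c, c ≠ 4 → c ≠ 6 → μ₁ c = μ c := by
    refine ⟨_, by simp only [Runs, run, Instr.step, PMF.pure_bind]; rfl, ?_, ?_, ?_⟩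
    · simp [h3, hw, h6]
    · simp [h3, hw, h6]
    · intro c c4 c6
      simp [c4, c6]
  rw [drawStep, run_append, show run inp _ μ = _ from r1, PMF.pure_bind, run, Instr.step, e4,
    PMF.bind_map]
  refine Sim.bind_left (Sim.refl _) ?_
  rintro r _ rfl
  obtain ⟨μ₂, r2, f3, f6, fi, k2⟩ : ∃ μ₂, Runs inp [.const 4 a, .minus 4 4 (20 + i), .times 4 4 8,
      .plus (20 + (i : ℕ)) (20 + i) 4, .plus 3 3 10] (Function.update μ₁ 8 (if r then 1 else 0)) μ₂ ∧
      μ₂ 3 = (adr + 1 : ℕ) ∧ μ₂ 6 = W + w ∧ μ₂ (20 + i) = (if r then (a : ℚ) else b) ∧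
      ∀ c, c ≠ 3 → c ≠ 4 → c ≠ 8 → c ≠ 20 + (i : ℕ) → μ₂ c = μ₁ c := by
    have n3 : (20 + (i : ℕ)) ≠ 3 := by omega
    have n3' : 3 ≠ (20 + (i : ℕ)) := by omega
    have n4 : (20 + (i : ℕ)) ≠ 4 := by omega
    have n6 : 6 ≠ (20 + (i : ℕ)) := by omega
    have n8 : (20 + (i : ℕ)) ≠ 8 := by omega
    have n8' : 8 ≠ (20 + (i : ℕ)) := by omega
    have n10 : 10 ≠ (20 + (i : ℕ)) := by omega
    have bi : μ₁ (20 + i) = b := by rw [k1 _ (by omega) (by omega), hb]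
    have b3 : μ₁ 3 = adr := by rw [k1 _ (by omega) (by omega), h3]
    have b10 : μ₁ 10 = 1 := by rw [k1 _ (by omega) (by omega), h10]
    refine ⟨_, by simp only [Runs, run, Instr.step, PMF.pure_bind]; rfl, ?_, ?_, ?_, ?_⟩
    · simp [Function.update_apply, n3', n10, b3, b10]
    · simp [Function.update_apply, n6, e6]
    · cases r <;> simp [Function.update_apply, n3, n4, n8, bi]
    · intro c c3 c4 c8 ci
      simp [Function.update_apply, c3, c4, c8, ci]
  rw [Function.comp_apply, show run inp _ _ = _ from r2]
  refine Sim.pure ⟨?_, f3, f6, fi⟩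
  intro c c1 c3 c4 c6 c8 ci
  rw [k2 c c3 c4 c8 ci, k1 c c4 c6]

/-- The bound b ≤ t - 1, with truncated subtraction to cover t = 0, later shows that the drawn
number is a letter of the alphabet. -/
theorem sim_drawSteps (inp : ℕ → ℚ) (i : Fin n) (w : ℕ → ℚ) (adr t : ℕ) (μ : Mem)
    (h3 : μ 3 = adr) (h10 : μ 10 = 1) (hadr : 21 + n ≤ adr)
    (hw : ∀ a < t, μ (adr + a) + μ 5 = w a) (h6 : μ 6 = 0) (hb : μ (20 + i) = 0) :
    Sim (run inp ((List.range t).flatMap (drawStep i)) μ) (catLaw w t) fun ν b =>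
      Untouched i μ ν ∧ ν 3 = (adr + t : ℕ) ∧ ν 6 = ∑ a ∈ Finset.range t, w a ∧
        ν (20 + i) = (b : ℚ) ∧ b ≤ t - 1 := by
  induction t with
  | zero =>
    refine Sim.pure ⟨fun _ _ _ _ _ _ _ => rfl, by simpa using h3, by simpa using h6, ?_, le_rfl⟩
    simpa using hb
  | succ t ih =>
    rw [List.range_succ, List.flatMap_append, List.flatMap_singleton, run_append, catLaw]
    refine (ih fun a ha => hw a (by omega)).bind ?_
    rintro ν b ⟨hu, k3, k6, kb, hbt⟩
    have hstep := sim_drawStep inp i t (w t) (∑ a ∈ Finset.range t, w a) b (adr + t) ν k3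
      (by rw [hu 10] <;> first | exact h10 | omega)
      (by rw [hu (adr + t) (by omega) (by omega) (by omega) (by omega) (by omega) (by omega),
        hu 5 (by omega) (by omega) (by omega) (by omega) (by omega) (by omega), hw t (by omega)])
      k6 kb
    rw [Finset.sum_range_succ]
    refine hstep.map_right ?_
    rintro ξ r ⟨hu', q3, q6, qb⟩
    refine ⟨?_, q3, q6, ?_, ?_⟩
    · intro c c1 c3 c4 c6 c8 ci
      rw [hu' c c1 c3 c4 c6 c8 ci, hu c c1 c3 c4 c6 c8 ci]
    · rw [qb]; cases r <;> simp
    · split_ifs <;> omega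

/-- The state between the steps of the sampler: the variable cells hold `v`, the output table holds
`o`. -/
structure Ready {M : ℕ} (J : Finset (Fin M)) (S : Fin M → Fin n → Fin s) (x : Fin s) (l : ℕ)
    (q : ℚ) (v : Fin n → Fin s) (o : ℕ → ℚ) (μ : Mem) : Prop where
  cell2 : μ 2 = s
  cell5 : μ 5 = l
  cell9 : μ 9 = q
  cell10 : μ 10 = 1
  vars : VarsHold x v μ
  scope : ∀ (i : Fin n) (w : Fin n → Fin s),
    μ (tab n s (2 * i + 1) (codeOf (i :: (G.context i).toList) w))
      = countIn J (cyl (G.scope i) w) S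
  out : ∀ c, c < s ^ n → μ (tab n s (2 * n) c) = o c

variable (x) {M : ℕ} (J : Finset (Fin M)) (S : Fin M → Fin n → Fin s) {l : ℕ}

/-- The estimated conditional distribution of variable `i`. -/
def drawPMF [NeZero s] (hl : 0 < l) (i : Fin n) (v : Fin n → Fin s) : PMF (Fin s) :=
  (G.isChain_est_twist J S X x hl).condPMF (fun i _ => (G.est_pos J S hl i _).le) i v

/-- The smoothed scope counts add up to the smoothed context count, so normalizing them gives the
estimated conditional distribution. -/
theorem catLaw_eq_map [NeZero s] (hl : 0 < l) (i : Fin n) (v : Fin n → Fin s) (w : ℕ → ℚ)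
    (hw0 : ∀ a, 0 < w a)
    (hw : ∀ a : Fin s, w a =
      countIn J (cyl (G.scope i) (Function.update (G.twist X x i v) i a)) S + l) :
    catLaw w s = (G.drawPMF X x J S hl i v).map fun a : Fin s => (a : ℕ) := by
  obtain ⟨t, rfl⟩ : ∃ t, s = t + 1 := ⟨s - 1, by have := NeZero.ne s; omega⟩
  refine pmf_ext_toReal fun b => ?_
  rw [catLaw_toReal w hw0, map_toReal]
  have hsum : ∑ a ∈ Finset.range (t + 1), w a
      = countIn J (cyl (G.context i) (G.twist X x i v)) S + (t + 1 : ℕ) * l := by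
    rw [Finset.sum_range, Finset.sum_congr rfl fun a _ => hw a, Finset.sum_add_distrib,
      ← Nat.cast_sum, G.sum_countIn_scope]
    simp
  have hval : ∀ a : Fin (t + 1), (G.drawPMF X x J S hl i v a).toReal
      = (w a : ℝ) / (∑ a ∈ Finset.range (t + 1), w a : ℚ) := by
    intro a
    rw [drawPMF, IsChain.condPMF, pmfOfReal_toReal, twist_update, est, cyl_context_update, hsum,
      hw a]
    push_cast
    rfl
  simp only [hval]
  split_ifs with hb
  · rw [Finset.sum_eq_single (⟨b, Nat.lt_succ_of_le hb⟩ : Fin (t + 1))]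
    · simp
    · intro a _ ha
      exact if_neg fun h => ha (Fin.ext h)
    · simp
  · refine (Finset.sum_eq_zero fun a _ => if_neg ?_).symm
    have := a.2
    omega

theorem sim_drawVar [NeZero s] (inp : ℕ → ℚ) (hl : 0 < l) (q : ℚ) (i : Fin n)
    (v : Fin n → Fin s) (o : ℕ → ℚ) (μ : Mem) (h : G.Ready J S x l q v o μ) :
    Sim (run inp (G.drawVar s X i) μ) (G.drawPMF X x J S hl i v) fun ν a =>
      G.Ready J S x l q (Function.update v i a) o ν := by
  have r1 := runs_horner inp (G.seenCell X i) (G.context i).toList (G.twist X x i v) μ h.cell2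
    (fun j _ => by have := (G.seenCell_bounds X i j).1; omega) (fun j _ => h.vars.seenCell G i j)
  set z := G.twist X x i v with hz
  set c := codeOf (G.context i).toList z with hc
  set adr := tab n s (2 * i + 1) (c * s) with hadr
  have hle : 21 + n ≤ adr := le_tab _ _ _ _
  have hcode : ∀ a : Fin s, codeOf (i :: (G.context i).toList) (Function.update z i a)
      = c * s + a := by
    intro a
    rw [codeOf_cons, Function.update_self, hc, mul_comm, add_comm]
    congr 2
    unfold codeOf
    congr 1
    refine List.map_congr_left fun j hj => ?_
    rw [Function.update_of_ne (Finset.ne_of_mem_erase (Finset.mem_toList.1 hj))]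
  obtain ⟨μ₁, r2, e3, e6, ei, k1⟩ : ∃ μ₁, Runs inp [.times 1 1 2,
      .const 3 (tab n s (2 * i + 1) 0 : ℕ), .plus 3 3 1, .const 6 0, .const (20 + (i : ℕ)) 0]
      (Function.update μ 1 (c : ℚ)) μ₁ ∧ μ₁ 3 = adr ∧ μ₁ 6 = 0 ∧ μ₁ (20 + i) = 0 ∧
      Untouched i μ μ₁ := by
    have n3 : 3 ≠ (20 + (i : ℕ)) := by omega
    have n6 : 6 ≠ (20 + (i : ℕ)) := by omega
    refine ⟨_, by simp only [Runs, run, Instr.step, PMF.pure_bind]; rfl, ?_, ?_, ?_, ?_⟩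
    · simp [n3, h.cell2, hadr, tab]
    · simp [n6]
    · simp
    · intro a a1 a3 a4 a6 a8 ai
      simp [a1, a3, a6, ai]
  -- The value 1 beyond the alphabet is never drawn. It only keeps all weights positive.
  let w : ℕ → ℚ := fun a => if ha : a < s then
    countIn J (cyl (G.scope i) (Function.update z i ⟨a, ha⟩)) S + l else 1
  have hw0 : ∀ a, 0 < w a := by
    intro a
    simp only [w]
    split_ifs
    · positivity
    · norm_num
  have hw : ∀ a < s, μ₁ (adr + a) + μ₁ 5 = w a := by
    intro a ha
    rw [k1 _ (by omega) (by omega) (by omega) (by omega) (by omega) (by omega),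
      k1 5 (by omega) (by omega) (by omega) (by omega) (by omega) (by omega), h.cell5]
    have h1 := h.scope i (Function.update z i ⟨a, ha⟩)
    rw [hcode] at h1
    have h2 : adr + a = tab n s (2 * i + 1) (c * s + a) := by rw [hadr]; unfold tab; omega
    simp only [w, dif_pos ha]
    rw [h2, h1]
  have hsim := sim_drawSteps inp i w adr s μ₁ e3
    (by rw [k1 10 (by omega) (by omega) (by omega) (by omega) (by omega) (by omega), h.cell10])
    hle hw e6 ei
  rw [G.catLaw_eq_map X x J S hl i v w hw0 (fun a => by simp [w, hz])] at hsim
  rw [drawVar, run_append, show run inp _ μ = _ from r1, PMF.pure_bind, run_append,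
    show run inp _ _ = _ from r2, PMF.pure_bind]
  have hs : 0 < s := Nat.pos_of_ne_zero (NeZero.ne s)
  -- The coupling is with a law on ℕ. Reduction modulo s returns to the alphabet and changes
  -- nothing, because the drawn number is below s.
  have hback : ((G.drawPMF X x J S hl i v).map fun a : Fin s => (a : ℕ)).map
      (fun b : ℕ => (⟨b % s, Nat.mod_lt b hs⟩ : Fin s)) = G.drawPMF X x J S hl i v := by
    rw [PMF.map_comp]
    have : ((fun b : ℕ => (⟨b % s, Nat.mod_lt b hs⟩ : Fin s)) ∘ fun a : Fin s => (a : ℕ)) = id := by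
      funext a
      exact Fin.ext (Nat.mod_eq_of_lt a.2)
    rw [this, PMF.map_id]
  rw [← hback]
  refine hsim.map_right ?_
  rintro ν b ⟨hu, -, -, hb, hbs⟩
  have hmod : b % s = b := Nat.mod_eq_of_lt (by omega)
  have keep : ∀ a, a ≠ 1 → a ≠ 3 → a ≠ 4 → a ≠ 6 → a ≠ 8 → a ≠ 20 + (i : ℕ) → ν a = μ a :=
    fun a a1 a3 a4 a6 a8 ai => (hu a a1 a3 a4 a6 a8 ai).trans (k1 a a1 a3 a4 a6 a8 ai)
  have big : ∀ a, 21 + n ≤ a → ν a = μ a := fun a ha =>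
    keep a (by omega) (by omega) (by omega) (by omega) (by omega) (by omega)
  have low : ∀ a, a < 20 → a ≠ 1 → a ≠ 3 → a ≠ 4 → a ≠ 6 → a ≠ 8 → ν a = μ a :=
    fun a ha a1 a3 a4 a6 a8 => keep a a1 a3 a4 a6 a8 (by omega)
  refine ⟨?_, ?_, ?_, ?_, ⟨fun j => ?_, ?_⟩, fun k u => ?_, fun c hc => ?_⟩
  · rw [low 2 (by norm_num) (by norm_num) (by norm_num) (by norm_num) (by norm_num) (by norm_num),
      h.cell2]
  · rw [low 5 (by norm_num) (by norm_num) (by norm_num) (by norm_num) (by norm_num) (by norm_num),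
      h.cell5]
  · rw [low 9 (by norm_num) (by norm_num) (by norm_num) (by norm_num) (by norm_num) (by norm_num),
      h.cell9]
  · rw [low 10 (by norm_num) (by norm_num) (by norm_num) (by norm_num) (by norm_num) (by norm_num),
      h.cell10]
  · by_cases hji : j = i
    · subst hji
      rw [hb, Function.update_self]
      simp only [hmod]
    · have : (j : ℕ) ≠ i := fun h => hji (Fin.ext h)
      rw [keep _ (by omega) (by omega) (by omega) (by omega) (by omega) (by omega), h.vars.1,
        Function.update_of_ne hji]
  · rw [keep _ (by omega) (by omega) (by omega) (by omega) (by omega) (by omega), h.vars.2]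
  · rw [big _ (le_tab _ _ _ _), h.scope]
  · rw [big _ (le_tab _ _ _ _), h.out c hc]

theorem sim_drawVars [NeZero s] (inp : ℕ → ℚ) (hl : 0 < l) (q : ℚ) (is : List (Fin n))
    (v : Fin n → Fin s) (o : ℕ → ℚ) (μ : Mem) (h : G.Ready J S x l q v o μ) :
    Sim (run inp (is.flatMap (G.drawVar s X)) μ)
      ((G.isChain_est_twist J S X x hl).seqLaw (fun i _ => (G.est_pos J S hl i _).le) is v)
      fun ν w => G.Ready J S x l q w o ν := by
  induction is generalizing v μ with
  | nil => exact Sim.pure h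
  | cons i is ih =>
    rw [List.flatMap_cons, run_append, IsChain.seqLaw]
    exact (G.sim_drawVar X x J S inp hl q i v o μ h).bind fun ν a hν => ih _ ν hν

/-! ### Tabulating -/

/-- The cell that holds the value of `j` after the intervention. -/
def outCell (j : Fin n) : ℕ := if j = X then 20 + n else 20 + j

variable (s)

/-- The program that adds the content of cell `9` to the entry of the output table that belongs to
the drawn assignment. -/
def tally (F : Finset (Fin n)) : List Instr :=
  horner ((Finset.univ : Finset F).toList.map fun j : F => outCell X j) ++ bump n s (2 * n)

variable {s}

/-- The entry of the output table for an assignment to `F`. -/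
def outCode {F : Finset (Fin n)} (w : F → Fin s) : ℕ :=
  codeOf (Finset.univ : Finset F).toList w

theorem outCode_inj (hs : 2 ≤ s) {F : Finset (Fin n)} {w w' : F → Fin s} :
    outCode w = outCode w' ↔ w = w' := by
  rw [outCode, outCode, codeOf_eq_iff hs]
  constructor
  · intro h; funext j; exact h j (by simp)
  · rintro rfl _ _; rfl

theorem outCode_lt (hs : 2 ≤ s) {F : Finset (Fin n)} (w : F → Fin s) : outCode w < s ^ n := by
  refine (codeOf_lt hs _ w).trans_le (Nat.pow_le_pow_right (by omega) ?_)
  rw [Finset.length_toList, Finset.card_univ, Fintype.card_coe]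
  exact (Finset.card_le_univ _).trans (Fintype.card_fin n).le

theorem runs_tally (hs : 2 ≤ s) (inp : ℕ → ℚ) (F : Finset (Fin n)) (q : ℚ) (v : Fin n → Fin s)
    (o : ℕ → ℚ) (μ : Mem) (h : G.Ready J S x l q v o μ) :
    ∃ ν, Runs inp (tally s X F) μ ν ∧ G.Ready J S x l q v
      (fun c => o c + if c = outCode (readOff F X x v) then q else 0) ν := by
  have r1 := runs_horner inp (fun j : F => outCell X j) (Finset.univ : Finset F).toList
    (readOff F X x v) μ h.cell2 (fun j _ => by unfold outCell; split_ifs <;> omega)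
    (fun j _ => by
      unfold outCell readOff
      split_ifs with hj
      · rw [h.vars.2, hj, Function.update_self]
      · rw [h.vars.1, Function.update_of_ne hj])
  obtain ⟨ν, r2, k⟩ := runs_bump inp n s (2 * n) (outCode (readOff F X x v)) _
    (Function.update_self 1 _ μ)
  have hlt := outCode_lt hs (readOff F X x v)
  have hle := le_tab n s (2 * n) (outCode (readOff F X x v))
  have k' : ∀ a, a ≠ 1 → a ≠ 3 → a ≠ 4 → ν a = μ a
      + if a = tab n s (2 * n) (outCode (readOff F X x v)) then q else 0 := by
    intro a a1 a3 a4
    rw [k a a3 a4, Function.update_of_ne a1, Function.update_of_ne (by norm_num), h.cell9]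
  have low : ∀ a, a < 21 + n → a ≠ 1 → a ≠ 3 → a ≠ 4 → ν a = μ a := by
    intro a ha a1 a3 a4
    rw [k' a a1 a3 a4, if_neg (by omega), add_zero]
  refine ⟨ν, r1.append r2, ?_, ?_, ?_, ?_, ?_, fun i w => ?_, fun c hc => ?_⟩
  · rw [low 2 (by omega) (by norm_num) (by norm_num) (by norm_num), h.cell2]
  · rw [low 5 (by omega) (by norm_num) (by norm_num) (by norm_num), h.cell5]
  · rw [low 9 (by omega) (by norm_num) (by norm_num) (by norm_num), h.cell9]
  · rw [low 10 (by omega) (by norm_num) (by norm_num) (by norm_num), h.cell10]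
  · exact h.vars.congr fun a _ _ => low a (by omega) (by omega) (by omega) (by omega)
  · have hb := le_tab n s (2 * i + 1) (codeOf (i :: (G.context i).toList) w)
    rw [k' _ (by omega) (by omega) (by omega), if_neg, add_zero, h.scope]
    rw [tab_inj (G.codeOf_scope_lt hs i w) hlt]
    omega
  · have hb := le_tab n s (2 * n) c
    rw [k' _ (by omega) (by omega) (by omega), h.out c hc]
    simp only [tab_inj hc hlt, true_and]

variable (s)

/-- Draw one assignment and tally it. -/
def round (F : Finset (Fin n)) : List Instr := G.order.flatMap (G.drawVar s X) ++ tally s X F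

variable {s}

/-- Drawing all variables in topological order realizes the estimated split law whatever the cells
held before. Consecutive rounds are therefore independent draws. -/
theorem sim_round [NeZero s] (hs : 2 ≤ s) (inp : ℕ → ℚ) (hl : 0 < l) (F : Finset (Fin n)) (q : ℚ)
    (v : Fin n → Fin s) (o : ℕ → ℚ) (μ : Mem) (h : G.Ready J S x l q v o μ) :
    Sim (run inp (G.round s X F) μ) (G.estPMF J S X x hl) fun ν w => G.Ready J S x l q w
      (fun c => o c + if c = outCode (readOff F X x w) then q else 0) ν := by
  have h1 := G.sim_drawVars X x J S inp hl q G.order v o μ h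
  rw [IsChain.seqLaw_eq _ G.rank_injective _ G.order G.exists_order.choose_spec.2
    G.exists_order.choose_spec.1] at h1
  rw [round, run_append]
  refine h1.bind_left ?_
  intro ν w hν
  obtain ⟨ξ, r, hξ⟩ := G.runs_tally X x J S hs inp F q w o ν hν
  rw [show run inp _ ν = _ from r]
  exact Sim.pure hξ

theorem sim_rounds [NeZero s] (hs : 2 ≤ s) (inp : ℕ → ℚ) (hl : 0 < l) (F : Finset (Fin n)) (q : ℚ)
    (v : Fin n → Fin s) (μ : Mem) (h : G.Ready J S x l q v (fun _ => 0) μ) (t : ℕ) :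
    Sim (run inp ((List.range t).flatMap fun _ => G.round s X F) μ)
      (iid (G.estPMF J S X x hl) t) fun ν T => ∃ v, G.Ready J S x l q v
        (fun c => countIn Finset.univ {w | c = outCode (readOff F X x w)} T * q) ν := by
  induction t with
  | zero =>
    have : iid (G.estPMF J S X x hl) 0 = PMF.pure (fun j => j.elim0) := by
      refine pmf_ext_toReal fun T => ?_
      have hT : T = fun j => j.elim0 := funext fun j => j.elim0
      rw [iid_toReal, PMF.pure_apply, if_pos hT]
      simp
    rw [this]
    refine Sim.pure ⟨v, ?_⟩
    simpa [countIn] using h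
  | succ t ih =>
    rw [List.range_succ, List.flatMap_append, List.flatMap_singleton, run_append, iid_succ]
    refine ih.bind ?_
    rintro ν T ⟨u, hu⟩
    refine (G.sim_round X x J S hs inp hl F q u _ ν hu).map_right ?_
    intro ξ w hξ
    refine ⟨w, ?_⟩
    convert hξ using 2 with c
    rw [countIn_snoc]
    push_cast
    simp only [Set.mem_ofPred_eq]
    split_ifs <;> ring

/-- The tabulating program: it draws `N` assignments and stores their empirical distribution. -/
def tabulator (F : Finset (Fin n)) (l N : ℕ) : List Instr :=
  [.const 2 s, .const 5 l, .const 9 (1 / N), .const 10 1, .const (20 + n) (x : ℕ)] ++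
    (((List.finRange n).map fun j : Fin n => .const (20 + (j : ℕ)) 0) ++
      (List.range N).flatMap fun _ => G.round s X F)

theorem sim_tabulator [NeZero s] (hs : 2 ≤ s) (inp : ℕ → ℚ) (hl : 0 < l) (F : Finset (Fin n))
    (N : ℕ) (μ : Mem) (hd : G.Holds J S μ) :
    Sim (run inp (G.tabulator X x F l N) μ) (iid (G.estPMF J S X x hl) N) fun ν T =>
      ∃ v, G.Ready J S x l (1 / N) v
        (fun c => countIn Finset.univ {w | c = outCode (readOff F X x w)} T * (1 / N)) ν := by
  obtain ⟨μ₁, r1, e2, e5, e9, e10, ex, k1⟩ : ∃ μ₁, Runs inp [.const 2 s, .const 5 l,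
      .const 9 (1 / N), .const 10 1, .const (20 + n) (x : ℕ)] μ μ₁ ∧ μ₁ 2 = s ∧ μ₁ 5 = l ∧
      μ₁ 9 = 1 / N ∧ μ₁ 10 = 1 ∧ μ₁ (20 + n) = (x : ℕ) ∧ ∀ a, 21 + n ≤ a → μ₁ a = μ a := by
    have q2 : 2 ≠ 20 + n := by omega
    have q5 : 5 ≠ 20 + n := by omega
    have q9 : 9 ≠ 20 + n := by omega
    have q10 : 10 ≠ 20 + n := by omega
    refine ⟨_, by simp only [Runs, run, Instr.step, PMF.pure_bind]; rfl, ?_, ?_, ?_, ?_, ?_, ?_⟩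
    · simp [q2]
    · simp [q5]
    · simp [q9]
    · simp [q10]
    · simp
    · intro a ha
      rw [Function.update_of_ne (by omega), Function.update_of_ne (by omega),
        Function.update_of_ne (by omega), Function.update_of_ne (by omega),
        Function.update_of_ne (by omega)]
  obtain ⟨μ₂, r2, e2', k2⟩ := runs_consts inp (fun j : Fin n => 20 + (j : ℕ)) (fun _ => 0)
    varCell_injective (List.finRange n) μ₁
  have k2' : ∀ a, a < 20 ∨ 20 + n ≤ a → μ₂ a = μ₁ a := fun a ha => k2 a fun j _ => by omega
  have hready : G.Ready J S x l (1 / N) (fun _ => 0) (fun _ => 0) μ₂ := by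
    refine ⟨?_, ?_, ?_, ?_, ⟨fun j => ?_, ?_⟩, fun i w => ?_, fun c hc => ?_⟩
    · rw [k2' 2 (by omega), e2]
    · rw [k2' 5 (by omega), e5]
    · rw [k2' 9 (by omega), e9]
    · rw [k2' 10 (by omega), e10]
    · rw [e2' j (List.mem_finRange j)]; simp
    · rw [k2' _ (by omega), ex]
    · have hb := le_tab n s (2 * i + 1) (codeOf (i :: (G.context i).toList) w)
      rw [k2' _ (by omega), k1 _ hb, hd.scope]
    · have hb := le_tab n s (2 * n) c
      rw [k2' _ (by omega), k1 _ hb, hd.out c hc]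
  rw [tabulator, run_append, show run inp _ μ = _ from r1, PMF.pure_bind, run_append,
    show run inp _ μ₁ = _ from r2, PMF.pure_bind]
  exact G.sim_rounds X x J S hs inp hl F (1 / N) _ μ₂ hready N

variable (n s)

/-- The table look-up. -/
def lookup (F : Finset (Fin n)) : List Instr :=
  [.const 2 s] ++ (((Finset.univ : Finset F).toList.map fun j : F =>
      .read (20 + ((j : Fin n) : ℕ)) (j : Fin n)) ++
    (horner ((Finset.univ : Finset F).toList.map fun j : F => 20 + ((j : Fin n) : ℕ)) ++
      [.const 3 (tab n s (2 * n) 0 : ℕ), .plus 3 3 1, .load 0 3]))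

variable {n s}

theorem runs_lookup (F : Finset (Fin n)) (w : F → Fin s) (μ : Mem) :
    ∃ ν, Runs (queryInput w) (lookup n s F) μ ν ∧ ν 0 = μ (tab n s (2 * n) (outCode w)) := by
  have r1 : Runs (queryInput w) [.const 2 s] μ (Function.update μ 2 s) := by
    simp only [Runs, run, Instr.step, PMF.pure_bind]
  obtain ⟨μ₂, r2, e2, k2⟩ := runs_reads (queryInput w) (fun j : F => 20 + ((j : Fin n) : ℕ))
    (fun j : F => ((j : Fin n) : ℕ)) (fun i j h => Subtype.ext (varCell_injective h))
    (Finset.univ : Finset F).toList (Function.update μ 2 (s : ℚ))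
  have k2' : ∀ a, a < 20 ∨ 20 + n ≤ a → μ₂ a = Function.update μ 2 (s : ℚ) a :=
    fun a ha => k2 a fun j _ => by
      have := j.1.2
      omega
  have r3 := runs_horner (queryInput w) (fun j : F => 20 + ((j : Fin n) : ℕ))
    (Finset.univ : Finset F).toList w μ₂ (by rw [k2' 2 (by omega), Function.update_self])
    (fun j _ => by omega) (fun j hj => by rw [e2 j hj, queryInput_apply])
  have hle := le_tab n s (2 * n) (outCode w)
  refine ⟨_, r1.append (r2.append (r3.append
    (by simp only [Runs, run, Instr.step, PMF.pure_bind]; rfl))), ?_⟩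
  have hfl := floor_tab n s (2 * n) (codeOf (Finset.univ : Finset F).toList w)
  simp only [Function.update_self, Function.update_of_ne (by norm_num : (1:ℕ) ≠ 3), hfl]
  change Function.update _ 3 _ (tab n s (2 * n) (outCode w)) = _
  rw [Function.update_of_ne (by omega), Function.update_of_ne (by omega),
    Function.update_of_ne (by omega), k2' _ (by omega), Function.update_of_ne (by omega)]

theorem length_lookup (F : Finset (Fin n)) : (lookup n s F).length = 3 * F.card + 5 := by
  simp only [lookup, List.length_append, List.length_map, Finset.length_toList, length_horner,
    Finset.card_univ, Fintype.card_coe, List.length_cons, List.length_nil]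
  ring

end ADMG

/-! ### Empirical distributions -/

section Empirical

variable {β γ : Type*} (g : β → γ) {N : ℕ} (T : Fin N → β)

theorem sum_countIn_fiber (A : Finset γ) :
    ∑ w ∈ A, countIn Finset.univ {b | g b = w} T = countIn Finset.univ {b | g b ∈ A} T := by
  unfold countIn
  rw [Finset.card_eq_sum_card_fiberwise (f := fun j => g (T j)) (t := A)
    (by intro j hj; simpa using hj)]
  refine Finset.sum_congr rfl fun w hw => ?_
  congr 1
  ext j
  simp only [Finset.mem_filter, Finset.mem_univ, true_and, Set.mem_ofPred_eq]
  constructor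
  · rintro rfl; exact ⟨hw, rfl⟩
  · exact fun h => h.2

variable [Fintype γ]

/-- The empirical distribution of `g` on the sample `T`. -/
def empirical (hN : 0 < N) : PMF γ :=
  pmfOfReal (fun w => (countIn Finset.univ {b | g b = w} T : ℝ) / N) (fun _ => by positivity) <| by
    rw [← Finset.sum_div, ← Nat.cast_sum, sum_countIn_fiber]
    have : (N : ℝ) ≠ 0 := by exact_mod_cast hN.ne'
    simp [countIn, this]

variable [Fintype β] (P : PMF β)

/-- The samples for which the empirical frequency of some event is far from its probability. -/
def badDraws (N : ℕ) (l : ℝ) : Set (Fin N → β) :=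
  ⋃ A ∈ (Finset.univ : Finset (Finset γ)), deviates P Finset.univ l {b | g b ∈ A}

/-- A union bound over all events of γ. Its cost 2^|γ| enters N only through the logarithm, which
produces the s^f in the tabulation time. -/
theorem iid_badDraws_le (l : ℝ) (hl : 0 < l) :
    (iid P N).toOuterMeasure (badDraws g P N l)
      ≤ ENNReal.ofReal (2 ^ Fintype.card γ * (2 * Real.exp (-l))) := by
  refine (MeasureTheory.measure_biUnion_finset_le _ _).trans
    ((Finset.sum_le_sum fun A _ => iid_deviates_le P N _ _ l hl).trans (le_of_eq ?_))
  rw [Finset.sum_const, nsmul_eq_mul, ENNReal.ofReal_mul (by positivity), Finset.card_univ,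
    Fintype.card_finset]
  simp [ENNReal.ofReal_pow]

theorem sq_tvDist_empirical_le (hN : 0 < N) (l : ℝ) (hl : 0 < l) (hT : T ∉ badDraws g P N l) :
    (N * tvDist (P.map g) (empirical g T hN)) ^ 2 ≤ 4 * l * (N + l) := by
  set p : γ → ℝ := fun w => (P.map g w).toReal with hp
  set e : γ → ℝ := fun w => (empirical g T hN w).toReal with he
  -- The event that attains the total variation distance. It depends on the draws, which is why all
  -- events have to be controlled at once.
  set A := Finset.univ.filter fun w => p w ≤ e w with hA
  have hN' : (N : ℝ) ≠ 0 := by exact_mod_cast hN.ne'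
  have htv : tvDist (P.map g) (empirical g T hN) = ∑ w ∈ A, (e w - p w) := by
    have h0 : ∑ w, (e w - p w) = 0 := by
      rw [Finset.sum_sub_distrib, sum_toReal, sum_toReal, sub_self]
    have h1 : ∑ w, |p w - e w| = ∑ w ∈ A, (e w - p w) + ∑ w ∈ Aᶜ, -(e w - p w) := by
      rw [← Finset.sum_add_sum_compl A]
      congr 1
      · refine Finset.sum_congr rfl fun w hw => ?_
        rw [abs_sub_comm, abs_of_nonneg]
        have := (Finset.mem_filter.1 hw).2
        linarith
      · refine Finset.sum_congr rfl fun w hw => ?_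
        have : ¬ p w ≤ e w := by simpa [hA] using hw
        rw [abs_of_nonneg (by linarith)]
        ring
    rw [← Finset.sum_add_sum_compl A] at h0
    rw [tvDist, h1, Finset.sum_neg_distrib]
    linarith
  have hpA : ∑ w ∈ A, p w = prob P {b | g b ∈ A} := by
    simp only [hp, map_toReal, prob]
    rw [Finset.sum_comm]
    refine Finset.sum_congr rfl fun b _ => ?_
    rw [Finset.sum_ite_eq]
    by_cases h : g b ∈ A <;> simp [h]
  have heA : N * ∑ w ∈ A, e w = countIn Finset.univ {b | g b ∈ A} T := by
    simp only [he, empirical, pmfOfReal_toReal]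
    rw [← Finset.sum_div, ← Nat.cast_sum, sum_countIn_fiber]
    field_simp
  have hgood : T ∉ deviates P Finset.univ l {b | g b ∈ A} := by
    intro h
    apply hT
    simp only [badDraws, Finset.mem_univ, Set.iUnion_true, Set.mem_iUnion]
    exact ⟨A, h⟩
  have := le_of_notMem_deviates hgood
  rw [Finset.card_univ, Fintype.card_fin] at this
  rw [htv, Finset.sum_sub_distrib, mul_sub, heA, hpA]
  refine this.trans ?_
  have h1 := prob_le_one P {b | g b ∈ A}
  have h2 : (N : ℝ) * prob P {b | g b ∈ A} ≤ N := mul_le_of_le_one_right (by positivity) h1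
  nlinarith

end Empirical

namespace ADMG

variable {n : ℕ} (G : ADMG n) {s : ℕ} (X : Fin n) (x : Fin s)

/-- On the table of the tabulating program, the look-up computes the empirical distribution. -/
theorem isCloseEvaluator_lookup (hs : 2 ≤ s) {M : ℕ} (J : Finset (Fin M)) (l : ℕ)
    (S : Fin M → Fin n → Fin s) (F : Finset (Fin n)) {N : ℕ} (hN : 0 < N)
    (T : Fin N → Fin n → Fin s) (v : Fin n → Fin s) (μ : Mem)
    (h : G.Ready J S x l (1 / N) v
      (fun c => countIn Finset.univ {w | c = outCode (readOff F X x w)} T * (1 / N)) μ)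
    (D : PMF (F → Fin s)) (ε : ℝ) (hD : tvDist D (empirical (readOff F X x) T hN) ≤ ε) :
    IsCloseEvaluator (lookup n s F) μ D ε := by
  refine ⟨_, hD, fun w => ?_⟩
  obtain ⟨ν, r, e⟩ := runs_lookup F w μ
  rw [show run _ _ _ = _ from r, PMF.pure_map, e, h.out _ (outCode_lt hs w), empirical,
    pmfOfReal_toReal]
  have : {u : Fin n → Fin s | outCode w = outCode (readOff F X x u)}
      = {u | readOff F X x u = w} := by
    ext u
    simp only [Set.mem_ofPred_eq, outCode_inj hs]
    exact eq_comm
  rw [this]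
  push_cast
  rw [mul_one_div]

/-! ### Lengths of the programs -/

variable (s)

theorem length_learner_le (m : ℕ) (hm : 0 < m) (X : Fin n) :
    (G.learner s m).length ≤ 16 * (m * n * (G.maxCComp * G.inDegree + G.maxCComp)) := by
  have hK := G.one_le_width X
  set K := G.maxCComp * G.inDegree + G.maxCComp with hKdef
  have hn : 1 ≤ n := X.pos
  have hstep : ∀ i ∈ List.finRange n, (G.countStep s i).length ≤ 13 * K := by
    intro i _
    have h1 := G.card_context_add_one i
    have h2 := G.card_scope_le i
    simp only [countStep, bump, List.length_append, length_horner, List.length_map,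
      Finset.length_toList, List.length_cons, List.length_nil]
    omega
  have h1 := length_flatMap_le _ _ _ hstep
  rw [List.length_finRange, Nat.mul_left_comm] at h1
  have hnK : n ≤ n * K := Nat.le_mul_of_pos_right n hK
  have hblock : ∀ j ∈ List.range m, (G.sampleBlock s j).length ≤ 14 * (n * K) := by
    intro j _
    simp only [sampleBlock, List.length_append, List.length_map, List.length_finRange]
    omega
  have h2 := length_flatMap_le _ _ _ hblock
  rw [List.length_range, Nat.mul_left_comm, ← mul_assoc m] at h2
  have h3 : 1 ≤ m * n * K := Nat.mul_pos (Nat.mul_pos hm hn) hK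
  simp only [learner, List.length_append, List.length_cons, List.length_nil]
  omega

theorem length_order_le : G.order.length ≤ n := by
  have h : G.order.Nodup := G.exists_order.choose_spec.2.imp
    fun h he => by rw [he] at h; exact lt_irrefl _ h
  simpa using h.length_le_card

variable {s}

theorem length_tabulator_le (hs : 2 ≤ s) (F : Finset (Fin n)) (l N : ℕ) (hN : 0 < N) :
    (G.tabulator X x F l N).length
      ≤ 21 * (n * s * (G.maxCComp * G.inDegree + G.maxCComp) * N) := by
  have hK := G.one_le_width X
  set K := G.maxCComp * G.inDegree + G.maxCComp with hKdef
  have hn : 1 ≤ n := X.pos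
  have hsK : s ≤ s * K := Nat.le_mul_of_pos_right s hK
  have h2K : 2 * K ≤ s * K := Nat.mul_le_mul_right K hs
  have hF : F.card ≤ n := (Finset.card_le_univ F).trans (Fintype.card_fin n).le
  have hdraw : ∀ i ∈ G.order, (G.drawVar s X i).length ≤ 14 * (s * K) := by
    intro i _
    have h1 := G.card_context_add_one i
    have h2 := G.card_scope_le i
    have h3 := length_flatMap_le (List.range s) (drawStep i) 10 fun a _ => by
      simp [drawStep]
    rw [List.length_range] at h3
    simp only [drawVar, List.length_append, length_horner, List.length_map,
      Finset.length_toList, List.length_cons, List.length_nil]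
    omega
  have h1 := length_flatMap_le _ _ _ hdraw
  have h1' : G.order.length * (14 * (s * K)) ≤ 14 * (n * s * K) := by
    calc _ ≤ n * (14 * (s * K)) := Nat.mul_le_mul_right _ G.length_order_le
      _ = _ := by ring
  have hnsK : 2 * n ≤ n * s * K := by
    calc 2 * n = n * 2 * 1 := by ring
      _ ≤ _ := by gcongr
  have hround : ∀ t ∈ List.range N, (G.round s X F).length ≤ 18 * (n * s * K) := by
    intro t _
    simp only [round, tally, bump, List.length_append, length_horner, List.length_map,
      Finset.length_toList, List.length_cons, List.length_nil, Finset.card_univ,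
      Fintype.card_coe]
    omega
  have h2 := length_flatMap_le _ _ _ hround
  rw [List.length_range, Nat.mul_left_comm, mul_comm N] at h2
  have h3 : n * s * K ≤ n * s * K * N := Nat.le_mul_of_pos_right _ hN
  simp only [tabulator, List.length_append, List.length_cons, List.length_nil, List.length_map,
    List.length_finRange]
  omega

end ADMG

/-! ### The guarantees -/

namespace CBN

variable {n : ℕ} {G : ADMG n} {s : ℕ} [NeZero s] (M : CBN G s) (X : Fin n) (x : Fin s)

theorem evaluator_guarantee (hs : 2 ≤ s) (F : Finset (Fin n)) (m m' l : ℕ) (hm : m' ≤ m)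
    (hl : 0 < l) (ε : ℝ) (η : ℝ≥0∞)
    (hbad : (iid M.obs m).toOuterMeasure (M.badSamples (ADMG.used m m') l) ≤ η)
    (htv : ∀ S ∉ M.badSamples (ADMG.used m m') l, tvDist (marginal (M.interv X x) F)
      ((G.estPMF (ADMG.used m m') S X x hl).map (readOff F X x)) ≤ ε) :
    (learned M.obs m (G.learner s m')).toOuterMeasure
      {μ | IsCloseEvaluator (G.evaluator X x F l) μ (marginal (M.interv X x) F) ε}ᶜ ≤ η := by
  refine ((G.sim_learned hs M.obs m m' hm).toOuterMeasure_le ?_).trans hbad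
  intro μ S hS hμ
  by_contra hgood
  exact hμ (G.isCloseEvaluator_evaluator X x _ hl S F μ hS _ _ (htv S hgood))

/-- Error and failure probability split into those of the learned law and those of its empirical
approximation. The bounds for the draws are uniform in the law, since the law drawn from depends on
the random samples. -/
theorem lookup_guarantee (hs : 2 ≤ s) (F : Finset (Fin n)) (m m' l N : ℕ) (hm : m' ≤ m)
    (hl : 0 < l) (hN : 0 < N) (ε : ℝ) (η η' : ℝ≥0∞) (t : ℝ)
    (hbad : (iid M.obs m).toOuterMeasure (M.badSamples (ADMG.used m m') l) ≤ η)
    (htv : ∀ S ∉ M.badSamples (ADMG.used m m') l, tvDist (marginal (M.interv X x) F)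
      ((G.estPMF (ADMG.used m m') S X x hl).map (readOff F X x)) ≤ ε / 2)
    (hbad' : ∀ P : PMF (Fin n → Fin s),
      (iid P N).toOuterMeasure (badDraws (readOff F X x) P N t) ≤ η')
    (htv' : ∀ (P : PMF (Fin n → Fin s)) (T : Fin N → Fin n → Fin s),
      T ∉ badDraws (readOff F X x) P N t →
      tvDist (P.map (readOff F X x)) (empirical (readOff F X x) T hN) ≤ ε / 2) :
    ((learned M.obs m (G.learner s m')).bind
      (run (fun _ => 0) (G.tabulator X x F l N))).toOuterMeasure
      {μ | IsCloseEvaluator (ADMG.lookup n s F) μ (marginal (M.interv X x) F) ε}ᶜ ≤ η + η' := by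
  set J := ADMG.used m m' with hJ
  have hsim : Sim ((learned M.obs m (G.learner s m')).bind
      (run (fun _ => 0) (G.tabulator X x F l N)))
      ((iid M.obs m).bind fun S => (iid (G.estPMF J S X x hl) N).map fun T => (S, T))
      fun ν ST => ∃ v, G.Ready J ST.1 x l (1 / N) v (fun c =>
        countIn Finset.univ {w | c = ADMG.outCode (readOff F X x w)} ST.2 * (1 / N)) ν := by
    refine (G.sim_learned hs M.obs m m' hm).bind fun μ S hS => ?_
    exact (G.sim_tabulator X x J S hs _ hl F N μ hS).map_right fun ν T h => h
  refine (hsim.toOuterMeasure_le (B := {ST | ST.1 ∈ M.badSamples J l ∨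
    ST.2 ∈ badDraws (readOff F X x) (G.estPMF J ST.1 X x hl) N t}) ?_).trans ?_
  · rintro ν ⟨S, T⟩ ⟨v, hv⟩ hν
    by_contra hgood
    simp only [Set.mem_ofPred_eq, not_or] at hgood
    refine hν (G.isCloseEvaluator_lookup X x hs J l S F hN T v ν hv _ _ ?_)
    refine (tvDist_triangle _ ((G.estPMF J S X x hl).map (readOff F X x)) _).trans ?_
    have h1 := htv S hgood.1
    have h2 := htv' _ T hgood.2
    linarith
  · refine (toOuterMeasure_bind_le _ _ (M.badSamples J l) _ η' ?_).trans
      (add_le_add hbad le_rfl)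
    intro S hS
    rw [PMF.toOuterMeasure_map_apply]
    refine le_trans (MeasureTheory.measure_mono ?_) (hbad' (G.estPMF J S X x hl))
    rintro T (h | h)
    · exact (hS h).elim
    · exact h

/-- The s values of X define disjoint events, each of probability more than α. -/
theorem StronglyPositive.mul_lt_one {M : CBN G s} {X : Fin n} {α : ℝ}
    (h : M.StronglyPositive X α) : s * α < 1 := by
  have h1 : ∀ a : Fin s, α < ∑ w, if w X = a then (M.obs w).toReal else 0 := by
    intro a
    refine (h.lt_prob fun _ => a).trans_le (Finset.sum_le_sum fun w _ => ?_)
    by_cases hw : w ∈ cyl (G.paPlus (G.cComp X)) fun _ => a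
    · rw [if_pos hw, if_pos (hw X (G.mem_paPlus.2 (Or.inl (G.self_mem_cComp X))))]
    · rw [if_neg hw]; split_ifs <;> simp
  have h2 : ∑ _a : Fin s, α < ∑ a : Fin s, ∑ w, if w X = a then (M.obs w).toReal else 0 :=
    Finset.sum_lt_sum_of_nonempty ⟨0, Finset.mem_univ _⟩ fun a _ => h1 a
  rw [Finset.sum_comm] at h2
  simp only [Finset.sum_ite_eq, Finset.mem_univ, if_true, sum_toReal] at h2
  simpa using h2

end CBN

/-! ### The choice of the parameters -/

/-- The last bound is for K · m because that many samples will be requested although m are used. The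
factor K ≤ 2 log(2 + T) and the part of l that does not come from δ account for the two logarithms.
-/
theorem exists_sample_size {n s K : ℕ} (hn : 1 ≤ n) (hs : 2 ≤ s) (hK : 1 ≤ K) {ρ ε δ T : ℝ}
    (hρ : 1 ≤ ρ) (hε : 0 < ε) (hε1 : ε < 1) (hδ : 0 < δ) (hδ1 : δ < 1)
    (hT : ρ * (n * (s : ℝ) ^ K) / ε ^ 2 ≤ T) :
    ∃ l m : ℕ, 0 < l ∧ 0 < m ∧ 4 * n * (s : ℝ) ^ K * Real.exp (-l) ≤ δ / 2 ∧
      ρ * (n * (s : ℝ) ^ K * (1320 * l) / m) ≤ (ε / 2) ^ 2 ∧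
      ((K * m : ℕ) : ℝ) ≤ 60000 * T * Real.log (2 + T) ^ 2 * (1 + Real.log (1 / δ)) := by
  have hn' : (1 : ℝ) ≤ n := by exact_mod_cast hn
  have hs' : (2 : ℝ) ≤ s := by exact_mod_cast hs
  have hε2 : 0 < ε ^ 2 := by positivity
  have hsK : (2 : ℝ) ^ K ≤ (s : ℝ) ^ K := pow_le_pow_left₀ (by norm_num) hs' K
  have h2K : (2 : ℝ) ≤ 2 ^ K := le_self_pow₀ (by norm_num) (by omega)
  set y : ℝ := n * (s : ℝ) ^ K with hy
  have hsy : (s : ℝ) ^ K ≤ y := le_mul_of_one_le_left (by positivity) hn'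
  have hy2 : 2 ≤ y := by linarith
  set Y : ℝ := ρ * y / ε ^ 2 with hY
  have hyY : y ≤ Y := by
    rw [hY, le_div_iff₀ hε2]
    have h1 : y * ε ^ 2 ≤ y * 1 :=
      mul_le_mul_of_nonneg_left (pow_le_one₀ hε.le hε1.le) (by linarith)
    nlinarith
  have hL : 0 ≤ Real.log (1 / δ) := Real.log_nonneg (by rw [le_div_iff₀ hδ]; linarith)
  set D := Real.log (1 / δ) with hD
  set w := Real.log (2 + T) with hw
  have hT2 : 2 ≤ T := by linarith
  have hlog2 : (1 / 2 : ℝ) < Real.log 2 := by have := Real.log_two_gt_d9; linarith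
  have hw4 : 2 * Real.log 2 ≤ w := by
    have : Real.log (2 ^ 2) ≤ w := Real.log_le_log (by norm_num) (by linarith)
    rwa [Real.log_pow] at this
  -- 2^K ≤ s^K ≤ T and log 2 > 1/2.
  have hwK : (K : ℝ) ≤ 2 * w := by
    have : Real.log (2 ^ K) ≤ w := Real.log_le_log (by positivity) (by linarith)
    rw [Real.log_pow] at this
    have hK0 : (0 : ℝ) ≤ K := by positivity
    nlinarith
  have hyw : Real.log y ≤ w := Real.log_le_log (by linarith) (by linarith)
  have hr : Real.log (8 * y / δ) = 3 * Real.log 2 + Real.log y + D := by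
    rw [hD, one_div, Real.log_inv, Real.log_div (by positivity) hδ.ne',
      Real.log_mul (by norm_num) (by positivity), show (8 : ℝ) = 2 ^ 3 by norm_num, Real.log_pow]
    push_cast
    ring
  have hlogy : 0 ≤ Real.log y := Real.log_nonneg (by linarith)
  -- Chosen so that 4 y exp(-l) ≤ δ / 2.
  set l := ⌈Real.log (8 * y / δ)⌉₊ with hl
  have hlpos : 0 < l := Nat.ceil_pos.2 (by rw [hr]; linarith)
  have hl1 : (1 : ℝ) ≤ l := by exact_mod_cast hlpos
  have hlle : (l : ℝ) ≤ 5 * w * (1 + D) := by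
    have h1 := (Nat.ceil_lt_add_one (a := Real.log (8 * y / δ)) (by rw [hr]; linarith)).le
    rw [← hl, hr] at h1
    have h2 : D ≤ 5 * w * D := by nlinarith
    calc (l : ℝ) ≤ 3 * Real.log 2 + Real.log y + D + 1 := h1
      _ ≤ 5 * w * (1 + D) := by linarith
  -- 5280 = 4 · 1320, the 4 coming from the accuracy ε / 2.
  set m := ⌈5280 * Y * l⌉₊ with hm
  have hYl : 1 ≤ Y * l := by nlinarith
  have hmpos : 0 < m := Nat.ceil_pos.2 (by nlinarith)
  have hm1 : 5280 * Y * l ≤ m := Nat.le_ceil _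
  have hm2 : (m : ℝ) ≤ 5281 * (Y * l) := by
    have := (Nat.ceil_lt_add_one (a := 5280 * Y * l) (by nlinarith)).le
    rw [← hm] at this
    linarith
  refine ⟨l, m, hlpos, hmpos, ?_, ?_, ?_⟩
  · have h1 : Real.exp (-l) ≤ δ / (8 * y) := by
      have : Real.log (8 * y / δ) ≤ l := Nat.le_ceil _
      rw [Real.exp_neg, ← inv_div]
      refine inv_anti₀ (by positivity) ?_
      rwa [← Real.log_le_iff_le_exp (by positivity)]
    calc 4 * n * (s : ℝ) ^ K * Real.exp (-l) = 4 * y * Real.exp (-l) := by rw [hy]; ring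
      _ ≤ 4 * y * (δ / (8 * y)) := by gcongr
      _ = δ / 2 := by field_simp; norm_num
  · have hmp : (0 : ℝ) < m := by exact_mod_cast hmpos
    rw [← mul_div_assoc, div_le_iff₀ hmp]
    have : ρ * y = Y * ε ^ 2 := by rw [hY]; field_simp
    calc ρ * (y * (1320 * l)) = ε ^ 2 / 4 * (5280 * Y * l) := by
          rw [← mul_assoc, this]; ring
      _ ≤ ε ^ 2 / 4 * m := by gcongr
      _ = _ := by ring
  · have hw0 : 0 ≤ w := by linarith
    push_cast
    calc (K : ℝ) * m ≤ (2 * w) * (5281 * (T * (5 * w * (1 + D)))) := by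
          gcongr
          refine hm2.trans ?_
          gcongr
      _ = 52810 * (T * w ^ 2 * (1 + D)) := by ring
      _ ≤ 60000 * (T * w ^ 2 * (1 + D)) :=
          mul_le_mul_of_nonneg_right (by norm_num) (by positivity)
      _ = _ := by ring

theorem exists_draw_count {a : ℕ} (ha : 1 ≤ a) {ε δ : ℝ} (hε : 0 < ε) (hε1 : ε < 1) (hδ : 0 < δ)
    (hδ1 : δ < 1) :
    ∃ (N : ℕ) (t : ℝ), 0 < N ∧ 0 < t ∧ 2 ^ a * (2 * Real.exp (-t)) ≤ δ / 2 ∧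
      4 * t * (N + t) ≤ (N * (ε / 2)) ^ 2 ∧ (N : ℝ) ≤ 99 * (a / ε ^ 2) * (1 + Real.log (1 / δ)) := by
  have ha' : (1 : ℝ) ≤ a := by exact_mod_cast ha
  have hε2 : 0 < ε ^ 2 := by positivity
  have hε21 : ε ^ 2 ≤ 1 := pow_le_one₀ hε.le hε1.le
  have hL : 0 ≤ Real.log (1 / δ) := Real.log_nonneg (by rw [le_div_iff₀ hδ]; linarith)
  have hlog2 : (1 / 2 : ℝ) < Real.log 2 := by have := Real.log_two_gt_d9; linarith
  have hlog2' : Real.log 2 < 7 / 10 := by have := Real.log_two_lt_d9; linarith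
  have h4 : Real.log (4 / δ) = 2 * Real.log 2 + Real.log (1 / δ) := by
    rw [one_div, Real.log_inv, Real.log_div (by norm_num) hδ.ne',
      show (4 : ℝ) = 2 ^ 2 by norm_num, Real.log_pow]
    push_cast
    ring
  set D := Real.log (1 / δ) with hD
  -- Chosen so that 2^a · 2 exp(-t) = δ / 2.
  set t : ℝ := a * Real.log 2 + Real.log (4 / δ) with ht
  have ht1 : 1 ≤ t := by rw [ht, h4]; nlinarith
  have ht3 : t ≤ 3 * a * (1 + D) := by
    have : D ≤ a * D := le_mul_of_one_le_left hL ha'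
    have : 0 ≤ a * D := by positivity
    rw [ht, h4]
    nlinarith
  -- As t ≤ N, the deviation 4t(N + t) is at most 8tN, which is at most (Nε/2)² as soon as N ≥ 32t /
  -- ε².
  set N := ⌈32 * t / ε ^ 2⌉₊ with hN
  have hN1 : 32 * t / ε ^ 2 ≤ N := Nat.le_ceil _
  have hpos : 0 < 32 * t / ε ^ 2 := by positivity
  have hN2 : (N : ℝ) ≤ 33 * t / ε ^ 2 := by
    have h1 := (Nat.ceil_lt_add_one hpos.le).le
    have h2 : 1 ≤ t / ε ^ 2 := by rw [le_div_iff₀ hε2]; linarith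
    calc (N : ℝ) ≤ 32 * t / ε ^ 2 + 1 := h1
      _ ≤ 32 * t / ε ^ 2 + t / ε ^ 2 := by gcongr
      _ = _ := by ring
  refine ⟨N, t, Nat.ceil_pos.2 hpos, by linarith, ?_, ?_, ?_⟩
  · have : Real.exp (-t) = (2 ^ a)⁻¹ * (δ / 4) := by
      rw [ht, neg_add, Real.exp_add, ← Real.log_pow, ← Real.log_inv, ← Real.log_inv,
        Real.exp_log (by positivity), Real.exp_log (by positivity), inv_div]
    rw [this]
    field_simp
    norm_num
  · rw [div_le_iff₀ hε2] at hN1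
    have hN0 : (0 : ℝ) ≤ N := by positivity
    have htN : t ≤ N := by nlinarith
    calc 4 * t * (N + t) ≤ 4 * t * (N + N) := by gcongr
      _ = 32 * t * N / 4 := by ring
      _ ≤ N * ε ^ 2 * N / 4 := by gcongr
      _ = _ := by ring
  · calc (N : ℝ) ≤ 33 * t / ε ^ 2 := hN2
      _ ≤ 33 * (3 * a * (1 + D)) / ε ^ 2 := by gcongr
      _ = _ := by ring

/-- If d > 0, then kd + k ≤ 2kd and ρ = 1/α works. If d = 0, the target has no power of s at all, so
s^k must be paid by α^(-k), which leaves room only for ρ = 1. -/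
theorem ADMG.exists_dominating {n : ℕ} (G : ADMG n) {s : ℕ} [NeZero s] (X : Fin n) (x : Fin s)
    {α : ℝ} (hid : G.Identifiable X) (hα : 0 < α) (hsα : s * α < 1) :
    ∃ ρ : ℝ, 1 ≤ ρ ∧
      ρ * (s : ℝ) ^ (G.maxCComp * G.inDegree + G.maxCComp)
        ≤ (s : ℝ) ^ (2 * G.maxCComp * G.inDegree) / α ^ G.maxCComp ∧
      ∀ M : CBN G s, M.StronglyPositive X α → M.Dominated X x ρ := by
  have hs : (1 : ℝ) ≤ s := by exact_mod_cast Nat.one_le_iff_ne_zero.2 (NeZero.ne s)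
  have hα1 : α ≤ 1 := by nlinarith
  have hk : 1 ≤ G.maxCComp := by
    have := G.one_le_width X
    by_contra h
    have h0 : G.maxCComp = 0 := by omega
    simp [h0] at this
  set k := G.maxCComp
  set d := G.inDegree with hd
  have hαk : 0 < α ^ k := by positivity
  by_cases h0 : d = 0
  · refine ⟨1, le_rfl, ?_, fun M _ => M.dominated_of_no_edges X x fun i j hij => ?_⟩
    · rw [h0, mul_zero, mul_zero, zero_add, pow_zero, one_mul, le_div_iff₀ hαk, ← mul_pow]
      exact pow_le_one₀ (by positivity) hsα.le
    · have h1 : (G.parents j).card ≤ G.inDegree :=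
        Finset.le_sup (f := fun j => (G.parents j).card) (Finset.mem_univ j)
      have h2 : 0 < (G.parents j).card := Finset.card_pos.2 ⟨i, by simpa [parents] using hij⟩
      omega
  · refine ⟨α⁻¹, (one_le_inv₀ hα).2 hα1, ?_,
      fun M hM => M.dominated_of_stronglyPositive X x hid hα hM⟩
    rw [div_eq_inv_mul]
    have h1 : k ≤ k * d := Nat.le_mul_of_pos_right k (Nat.pos_of_ne_zero h0)
    have h2 : k * d + k ≤ 2 * k * d := by rw [mul_assoc]; omega
    have h3 : α ^ k ≤ α := pow_le_of_le_one hα.le hα1 (by omega)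
    gcongr

/-! ### The trivial alphabet -/

theorem isCloseEvaluator_of_subsingleton {n s : ℕ} (hs : s = 1) {F : Finset (Fin n)} (μ : Mem)
    (D : PMF (F → Fin s)) {ε : ℝ} (hε : 0 < ε) : IsCloseEvaluator [.const 0 1] μ D ε := by
  subst hs
  refine ⟨D, by simpa [tvDist] using hε.le, fun w => ?_⟩
  have h := sum_toReal D
  rw [Fintype.sum_unique, Subsingleton.elim default w] at h
  rw [h]
  simp [run, Instr.step, PMF.pure_map]

end CausalLearning

end

/-! ### The main theorem: choice of programs and parameters -/

open CausalLearning in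
theorem mainTheorem2 :
    -- absolute constants: `C` for the `O`, `c` for the power of the logarithm in the soft-`O`
    ∃ (C : ℝ) (c : ℕ), 0 < C ∧
    ∀ (n s : ℕ) [NeZero s] (G : ADMG n) (X : Fin n) (x : Fin s) (F : Finset (Fin n))
      (α ε δ : ℝ),
    G.Identifiable X → 0 < α → 0 < ε → ε < 1 → 0 < δ → δ < 1 →
    ∀ (k d f : ℕ) (T : ℝ), k = G.maxCComp → d = G.inDegree → f = F.card →
      T = (s : ℝ) ^ (2 * k * d) * n / (α ^ k * ε ^ 2) →
    -- `m` samples, a learner `L`, an evaluator `E` that works on the data returned by `L`,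
    -- a tabulating program `B` that also works on these data, and a table look-up `Q`
    ∃ (m : ℕ) (L E B Q : List Instr),
      (m : ℝ) ≤ C * T * Real.log (2 + T) ^ c * (1 + Real.log (1 / δ)) ∧
      (L.length : ℝ) ≤ C * (m * n * (s : ℝ) ^ (2 * k * d)) ∧
      (E.length : ℝ) ≤ C * (n * s * (k * d + k) * (s : ℝ) ^ (n - f)) ∧
      (B.length : ℝ) ≤
        C * (n * s * (k * d + k) * ((s : ℝ) ^ f / ε ^ 2)) * (1 + Real.log (1 / δ)) ∧
      (Q.length : ℝ) ≤ C * (f + 1) ∧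
      ∀ M : CBN G s, M.StronglyPositive X α →
        1 - δ ≤ ((learned M.obs m L).toOuterMeasure
          {μ | IsCloseEvaluator E μ (marginal (M.interv X x) F) ε}).toReal ∧
        1 - δ ≤ (((learned M.obs m L).bind (run (fun _ => 0) B)).toOuterMeasure
          {μ | IsCloseEvaluator Q μ (marginal (M.interv X x) F) ε}).toReal := by
  refine ⟨60000, 2, by norm_num, ?_⟩
  rintro n s _ G X x F α ε δ hid hα hε hε1 hδ hδ1 k d f T rfl rfl rfl hT
  have hL : 0 ≤ Real.log (1 / δ) := Real.log_nonneg (by rw [le_div_iff₀ hδ]; linarith)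
  have hs1 : 1 ≤ s := Nat.one_le_iff_ne_zero.2 (NeZero.ne s)
  have hs1' : (1 : ℝ) ≤ s := by exact_mod_cast hs1
  have hn : 1 ≤ n := X.pos
  have hT0 : 0 ≤ T := by rw [hT]; positivity
  have hK := G.one_le_width X
  have hwidth : (1 : ℝ) ≤ n * s * (G.maxCComp * G.inDegree + G.maxCComp) := by
    exact_mod_cast Nat.mul_pos (Nat.mul_pos hn hs1) hK
  have hm0 : 0 ≤ 60000 * T * Real.log (2 + T) ^ 2 * (1 + Real.log (1 / δ)) := by positivity
  -- Positional codes are used in base at least 2. With a single letter there is only one assignment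
  -- to F, of probability 1.
  by_cases hsp : s = 1
  · refine ⟨0, [], [.const 0 1], [], [.const 0 1], ?_, ?_, ?_, ?_, ?_, fun M _ => ?_⟩
    · simpa using hm0
    · simp
    · have h1 : (1 : ℝ) ≤ (s : ℝ) ^ (n - F.card) := one_le_pow₀ hs1'
      have := one_le_mul_of_one_le_of_one_le hwidth h1
      simp only [List.length_cons, List.length_nil, zero_add, Nat.cast_one]
      linarith
    · simp only [List.length_nil, Nat.cast_zero]
      positivity
    · have : (0 : ℝ) ≤ F.card := by positivity
      simp only [List.length_cons, List.length_nil, zero_add, Nat.cast_one]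
      linarith
    · have h : ∀ p : PMF Mem, 1 - δ ≤ (p.toOuterMeasure
          {μ | IsCloseEvaluator [.const 0 1] μ (marginal (M.interv X x) F) ε}).toReal := by
        intro p
        refine le_toReal_toOuterMeasure _ _ _ hδ.le ?_
        have : {μ | IsCloseEvaluator [.const 0 1] μ (marginal (M.interv X x) F) ε} = Set.univ :=
          Set.eq_univ_of_forall fun μ => isCloseEvaluator_of_subsingleton hsp μ _ hε
        rw [this]
        simp
      exact ⟨h _, h _⟩
  -- If no net is α-strongly positive, the guarantees are void. Otherwise one such net yields sα <
  -- 1.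
  by_cases hM : ∃ M : CBN G s, M.StronglyPositive X α
  swap
  · refine ⟨0, [], [], [], [], by simpa using hm0, by simp, ?_, ?_, ?_, fun M h => (hM ⟨M, h⟩).elim⟩
    all_goals simp only [List.length_nil, Nat.cast_zero]; positivity
  obtain ⟨M₀, hM₀⟩ := hM
  have hs : 2 ≤ s := by omega
  obtain ⟨ρ, hρ, hρT, hdom⟩ := G.exists_dominating X x hid hα hM₀.mul_lt_one
  set K := G.maxCComp * G.inDegree + G.maxCComp with hKdef
  have hKr : ((G.maxCComp : ℝ) * G.inDegree + G.maxCComp) = K := by rw [hKdef]; push_cast; ring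
  rw [hKr] at hwidth ⊢
  have hT' : ρ * (n * (s : ℝ) ^ K) / ε ^ 2 ≤ T := by
    calc ρ * (n * (s : ℝ) ^ K) / ε ^ 2 = ρ * (s : ℝ) ^ K * n / ε ^ 2 := by ring
      _ ≤ (s : ℝ) ^ (2 * G.maxCComp * G.inDegree) / α ^ G.maxCComp * n / ε ^ 2 := by gcongr
      _ = T := by rw [hT]; field_simp
  obtain ⟨l, m, hl, hm, hbad, htv, hbound⟩ :=
    exists_sample_size hn hs hK hρ hε hε1 hδ hδ1 hT'
  obtain ⟨N, t, hN, ht, hbad', htv', hbound'⟩ :=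
    exists_draw_count (a := s ^ F.card) (Nat.one_le_pow _ _ hs1) hε hε1 hδ hδ1
  have hmK : m ≤ K * m := Nat.le_mul_of_pos_left m hK
  -- Only m of the K · m samples are read. Counting takes O(m n K) steps, and the larger sample
  -- number absorbs K, which s^(2kd) would not do for d = 0.
  refine ⟨K * m, G.learner s m, G.evaluator X x F l, G.tabulator X x F l N, ADMG.lookup n s F,
    hbound, ?_, ?_, ?_, ?_, fun M hM => ?_⟩
  · have h1 : ((G.learner s m).length : ℝ) ≤ 16 * (m * n * K) := by
      exact_mod_cast G.length_learner_le s m hm X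
    have h2 : (1 : ℝ) ≤ (s : ℝ) ^ (2 * G.maxCComp * G.inDegree) := one_le_pow₀ hs1'
    have h3 : (m * n * K : ℝ) ≤ m * n * K * (s : ℝ) ^ (2 * G.maxCComp * G.inDegree) :=
      le_mul_of_one_le_right (by positivity) h2
    have h4 : (0 : ℝ) ≤ m * n * K := by positivity
    push_cast
    calc ((G.learner s m).length : ℝ) ≤ 16 * (m * n * K) := h1
      _ ≤ 60000 * (m * n * K * (s : ℝ) ^ (2 * G.maxCComp * G.inDegree)) := by linarith
      _ = _ := by ring
  · have h1 : ((G.evaluator X x F l).length : ℝ) ≤ 30 * (n * s * K * (s : ℝ) ^ (n - F.card)) := by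
      exact_mod_cast G.length_evaluator_le X x hs F l
    refine h1.trans (mul_le_mul_of_nonneg_right (by norm_num) (by positivity))
  · have h1 : ((G.tabulator X x F l N).length : ℝ) ≤ 21 * (n * s * K * N) := by
      exact_mod_cast G.length_tabulator_le X x hs F l N hN
    push_cast at hbound'
    calc ((G.tabulator X x F l N).length : ℝ) ≤ 21 * (n * s * K * N) := h1
      _ ≤ 21 * (n * s * K * (99 * ((s : ℝ) ^ F.card / ε ^ 2) * (1 + Real.log (1 / δ)))) := by
        gcongr
      _ = 2079 * (n * s * K * ((s : ℝ) ^ F.card / ε ^ 2) * (1 + Real.log (1 / δ))) := by ring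
      _ ≤ 60000 * (n * s * K * ((s : ℝ) ^ F.card / ε ^ 2) * (1 + Real.log (1 / δ))) :=
        mul_le_mul_of_nonneg_right (by norm_num) (by positivity)
      _ = _ := by ring
  · rw [ADMG.length_lookup]
    have : (0 : ℝ) ≤ F.card := by positivity
    push_cast
    linarith
  · have hsample : (iid M.obs (K * m)).toOuterMeasure (M.badSamples (ADMG.used (K * m) m) l)
        ≤ ENNReal.ofReal (δ / 2) :=
      (M.iid_badSamples_le _ l hl).trans (ENNReal.ofReal_le_ofReal hbad)
    have hest : ∀ S ∉ M.badSamples (ADMG.used (K * m) m) l, tvDist (marginal (M.interv X x) F)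
        ((G.estPMF (ADMG.used (K * m) m) S X x hl).map (readOff F X x)) ≤ ε / 2 := by
      intro S hS
      have hc := ADMG.card_used hmK
      have h := M.tvDist_est_le _ X x F hid ρ (by linarith) (hdom M hM) l hl
        (by rw [hc]; exact hm) S hS
      rw [hc] at h
      exact abs_le_of_sq_le_sq' (h.trans htv) (by linarith) |>.2
    have hdraws : ∀ P : PMF (Fin n → Fin s),
        (iid P N).toOuterMeasure (badDraws (readOff F X x) P N t) ≤ ENNReal.ofReal (δ / 2) := by
      intro P
      refine (iid_badDraws_le _ P t ht).trans (ENNReal.ofReal_le_ofReal ?_)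
      simpa using hbad'
    have hemp : ∀ (P : PMF (Fin n → Fin s)) (S : Fin N → Fin n → Fin s),
        S ∉ badDraws (readOff F X x) P N t →
        tvDist (P.map (readOff F X x)) (empirical (readOff F X x) S hN) ≤ ε / 2 := by
      intro P S hS
      have h := (sq_tvDist_empirical_le _ S P hN t ht hS).trans htv'
      have hN' : (0 : ℝ) < N := by exact_mod_cast hN
      exact le_of_mul_le_mul_left (abs_le_of_sq_le_sq' h (by positivity)).2 hN'
    constructor
    · refine le_toReal_toOuterMeasure _ _ _ hδ.le (M.evaluator_guarantee X x hs F (K * m) m l hmK hl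
        ε _ (hsample.trans (ENNReal.ofReal_le_ofReal (by linarith))) fun S hS =>
          (hest S hS).trans (by linarith))
    · refine le_toReal_toOuterMeasure _ _ _ hδ.le ((M.lookup_guarantee X x hs F (K * m) m l N hmK hl
        hN ε _ _ t hsample hest hdraws hemp).trans ?_)
      rw [← ENNReal.ofReal_add (by positivity) (by positivity), add_halves]
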